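/- Setting. Let $N(\mu,I)$ be the Gaussian on $\mathbb R^d$ with identity covariance. A set of $n$ obliviously $\varepsilon$-contaminated samples from $D$ is drawn as follows: an adversary fixes $Y_1,\dots,Y_k\in\mathbb R^d$ with $k=\lfloor\varepsilon n\rfloor$; then $Y_{k+1},\dots,Y_n$ are drawn i.i.d. from $D$; then $Y_1,\dots,Y_n$ are permuted uniformly at random. A dataset $X_1,\dots,X_n\in\mathbb R^d$ is $\kappa$-friendly (at rate $\varepsilon$) if (1) for all disjoint $S,T\subseteq[n]$ with $|S|,|T|\le\varepsilon n$, $\ \bigl|\bigl\langle\sum_{i\in S}X_i,\sum_{i\in T}X_i\bigr\rangle\bigr|\le\kappa\sqrt{|S||T|}\,\max(\sqrt{\varepsilon nd},\varepsilon n)$; (2) $|\langle X_i,X_j\rangle|\le\kappa\sqrt d$ for all $i\ne j$; (3) $\bigl|\|X_i\|_2^2-d\bigr|\le\kappa\sqrt d$ for all $i$. A tester is a (measurable, randomized) map from datasets to $\{\text{accept},\text{reject}\}$; its output is correct if it accepts when $D=N(0,I)$ and rejects when $D=N(\mu,I)$ with $\|\mu\|_2\ge\alpha$. It succeeds with probability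 $p$ under oblivious $\varepsilon$-contamination if, for $D=N(0,I)$ and for every $D=N(\mu,I)$ with $\|\mu\|_2\ge\alpha$, and for every choice of the adversary, its output is correct with probability at least $p$. It succeeds with probability $p$ under $\kappa$-friendly oblivious $\varepsilon$-contamination if in all these cases, with probability at least $p$, its output is correct or the dataset is not $\kappa$-friendly. Theorem. There are a constant $C$ and a function $L:\mathbb N\to\mathbb N$ with $L(x)\le C(1+\log x)^C$ for all $x\ge1$ such that the following holds. Let $d\ge2$, $n\ge0$ be integers with $n\le(1.1)^d$, let $0<\alpha\le1$, let $\varepsilon\in[0,1]$ be such that $\varepsilon n$ is an integer, let $p>2/3$, and let $\kappa=(10\log(nd))^{2000}$. If some tester with $n$ samples succeeds with probability $p$ under $\kappa$-friendly oblivious $\varepsilon$-contamination, then some tester with $n\cdot L(nd)=n\cdot\mathrm{poly}(\log(nd))$ samples succeeds with probability $p-0.01$ under arbitrary oblivious $\varepsilon/2$-contamination. -/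

import Mathlib

open MeasureTheory ProbabilityTheory
open scoped ENNReal Nat

namespace RobustMeanTesting

/-- Euclidean space `ℝ^d`. -/
abbrev E (d : ℕ) : Type := EuclideanSpace ℝ (Fin d)

/-- The Gaussian distribution `N(μ, I)` on `ℝ^d`. -/
noncomputable def gaussian (d : ℕ) (μ : E d) : Measure (E d) :=
  (stdGaussian (E d)).map (fun x => μ + x)

instance isProbabilityMeasure_gaussian (d : ℕ) (μ : E d) :
    IsProbabilityMeasure (gaussian d μ) :=
  Measure.isProbabilityMeasure_map (by fun_prop)

/-- The sequence whose first `k` entries are the adversary's points `y` and whose other entries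
are the clean samples `z` (the entries `y i` with `i ≥ k` play no role). -/
def plant {d n : ℕ} (k : ℕ) (y z : Fin n → E d) : Fin n → E d :=
  fun i => if (i : ℕ) < k then y i else z i

/-- The law of `n` obliviously contaminated samples from `D` with `k` contaminated points: the
adversary fixes `y 1, …, y k`, then the other `n - k` points are drawn i.i.d. from `D`, and
finally the `n` points are permuted uniformly at random. An adversary that picks its points at
random, independently of the clean samples, yields a mixture of these laws. -/
noncomputable def contaminatedLaw {d : ℕ} (n k : ℕ) (D : Measure (E d)) (y : Fin n → E d) :
    Measure (Fin n → E d) :=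
  ((n ! : ℝ≥0∞)⁻¹) • ∑ σ : Equiv.Perm (Fin n),
    (Measure.pi (fun _ : Fin n => D)).map (fun z i => plant k y z (σ i))

instance isProbabilityMeasure_contaminatedLaw {d : ℕ} (n k : ℕ) (D : Measure (E d))
    [IsProbabilityMeasure D] (y : Fin n → E d) :
    IsProbabilityMeasure (contaminatedLaw n k D y) := by
  have hm : ∀ σ : Equiv.Perm (Fin n),
      Measurable (fun (z : Fin n → E d) i => plant k y z (σ i)) := by
    intro σ
    refine measurable_pi_lambda _ fun i => ?_
    unfold plant
    split_ifs
    · exact measurable_const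
    · exact measurable_pi_apply _
  constructor
  have h1 : ∀ σ : Equiv.Perm (Fin n),
      ((Measure.pi (fun _ : Fin n => D)).map (fun z i => plant k y z (σ i))) Set.univ = 1 := by
    intro σ
    rw [Measure.map_apply (hm σ) MeasurableSet.univ]
    simp
  simp only [contaminatedLaw, Measure.smul_apply, Measure.finsetSum_apply, h1, smul_eq_mul]
  simp only [Finset.sum_const, Finset.card_univ, Fintype.card_perm, Fintype.card_fin,
    nsmul_eq_mul, mul_one]
  exact ENNReal.inv_mul_cancel (by exact_mod_cast Nat.factorial_ne_zero n)
    (ENNReal.natCast_ne_top _)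

/-- A dataset `X 1, …, X n` in `ℝ^d` is `κ`-friendly (at contamination rate `ε`). -/
structure IsFriendly {d n : ℕ} (κ ε : ℝ) (X : Fin n → E d) : Prop where
  cross_sum : ∀ S T : Finset (Fin n), Disjoint S T → (S.card : ℝ) ≤ ε * n → (T.card : ℝ) ≤ ε * n →
    |inner ℝ (∑ i ∈ S, X i) (∑ i ∈ T, X i)| ≤
      κ * (√((S.card : ℝ) * T.card) * max (√(ε * n * d)) (ε * n))
  inner_le : ∀ i j : Fin n, i ≠ j → |inner ℝ (X i) (X j)| ≤ κ * √d
  norm_sq : ∀ i : Fin n, |‖X i‖ ^ 2 - d| ≤ κ * √d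

/-- The randomized algorithm `A` (a Markov kernel from datasets to a bit, `false` meaning "accept
the null hypothesis" and `true` meaning "reject") solves robust mean testing with distance
parameter `α` from `n` obliviously `ε`-contaminated samples with success probability `p`, when the
data are promised to satisfy `Promise`: against every oblivious adversary, with probability at
least `p` the output is correct or the dataset violates the promise. The null hypothesis is
`N(0, I)`; the alternatives are all `N(μ, I)` with `‖μ‖ ≥ α`. -/
def IsTesterUnder {d n : ℕ} (Promise : (Fin n → E d) → Prop) (α ε p : ℝ)
    (A : Kernel (Fin n → E d) Bool) : Prop :=
  (∀ y : Fin n → E d,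
    p ≤ (contaminatedLaw n ⌊ε * n⌋₊ (gaussian d 0) y ⊗ₘ A).real
      {xb | Promise xb.1 → xb.2 = false}) ∧
  (∀ μ : E d, α ≤ ‖μ‖ → ∀ y : Fin n → E d,
    p ≤ (contaminatedLaw n ⌊ε * n⌋₊ (gaussian d μ) y ⊗ₘ A).real
      {xb | Promise xb.1 → xb.2 = true})

/-- There is an algorithm for robust mean testing in `ℝ^d` under arbitrary oblivious
`ε`-contamination with `n` samples and success probability `p`. -/
def ObliviousTesterExists (d n : ℕ) (α ε p : ℝ) : Prop :=
  ∃ A : Kernel (Fin n → E d) Bool, IsMarkovKernel A ∧ IsTesterUnder (fun _ => True) α ε p A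

/-- There is an algorithm for robust mean testing in `ℝ^d` under `κ`-friendly oblivious
`ε`-contamination with `n` samples and success probability `p`. -/
def FriendlyTesterExists (d n : ℕ) (κ α ε p : ℝ) : Prop :=
  ∃ A : Kernel (Fin n → E d) Bool, IsMarkovKernel A ∧ IsTesterUnder (IsFriendly κ ε) α ε p A

end RobustMeanTesting

/-! A tester for friendly data may be made to reject whatever is not friendly. Under an alternative
this is correct, so unfriendliness hurts only under `N(0, I)`. It is therefore enough to clean the
data in such a way that (a) under the null hypothesis the cleaned data are friendly, and (b) the
cleaned data still look like the output of an oblivious adversary, that is, the choice of the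
removed points depends essentially on the bad points alone. Removed points are replaced by fresh
Gaussian points; these count as bad points under an alternative and as clean points under the null
hypothesis.

A batch consists of `n` points to be tested, `n` pool points and `1000 n` validation points. Sums of
short tuples of pool points serve as directions. A family of directions is drawn from a Gibbs
measure whose exponent is the total excess of the tested points along their best direction in the
family, and every point with excess along the family is removed, besides the points of untypical
norm or with a large pairwise inner product. The Gibbs measure achieves both aims. If the points not
covered were heavy in some direction, inserting it would raise the weight by far more than its prior
costs, so with high probability no heavy direction is left (`gibbsProb_heavy_le`,
`sum_gibbsProb_heavy_le`). Clean points rarely have excess and have small exponential moments, so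
the measure is dominated, up to a small error, by the one computed from the bad points only
(`gibbsProb_univ_le`, `lintegral_tilt_clean_le`). This stability can fail only if the mean is large
or correlated with a relevant vector. In that case the validation points show it, and the batch
rejects rightly (`detects_of_vulnerable`, `not_detects_of_null`). The comparison with the process
driven by bad points is `lintegral_batchOut_le`.

Absence of heavy directions spanned by the pool gives friendliness of the surviving bad points
through `cross_corr_le`. If `S` and `T` were strongly correlated, then many points of `S` would be
correlated with a sparse sum `w` over `T`. A perceptron run on the pool points correlated with `w`
either produces a short pool sum correlated with `w`, or a pool sum `x` such that no pool point lies
in a certain intersection of two half-spaces given by `w` and `x`. The first contradicts the absence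
of heavy directions. In the second case the bad tested points also mostly avoid the intersection,
because they and the bad pool points are exchangeable and few half-spaces are involved
(`card_perm_not_alikeHalfspaces_le`), and this contradicts the absence of heavy directions along
`x`. Clean points are added by Gaussian concentration (`measure_not_isFriendly_le`).

At contamination `ε/2` a batch at random positions has on average about half of the `ε n` bad points
which the given tester tolerates, so it exceeds that number with probability at most `0.21`, and its
total error is below `0.49` (`sum_perm_batchTest_le`). The batches use only a small share of the
sample, so the bound survives conditioning on other batches, and a majority vote over constantly
many batches errs with probability at most `0.01` (`lintegral_majorityTest_le`). -/

namespace RobustMeanTesting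

/-! ### Deterministic tools: level sets, sparsification, perceptron, cuts. -/

section

section Deterministic

variable {ι F : Type*} [NormedAddCommGroup F] [InnerProductSpace ℝ F]

/-- A large sum of reals has a large level set, up to a harmonic factor. -/
lemma exists_level_subset [DecidableEq ι] (a : ι → ℝ) {A H : ℝ} (hA : 0 < A) (hH : 0 < H)
    (S : Finset ι) (hS : (harmonic S.card : ℝ) ≤ H) (hsum : A ≤ ∑ i ∈ S, a i) :
    ∃ S' ⊆ S, S'.Nonempty ∧ ∀ i ∈ S', A / (S'.card * H) ≤ a i := by
  by_contra hcon
  push Not at hcon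
  -- If every nonempty `U ⊆ S` had a member below `A / (|U| H)`, removing such members one at a time
  -- would bound the sum by `A / H` times a harmonic number.
  have key : ∀ k : ℕ, ∀ U ⊆ S, U.card = k → U.Nonempty →
      ∑ i ∈ U, a i < A / H * (harmonic k : ℝ) := by
    intro k
    induction k with
    | zero =>
      intro U _ hc hne
      simp [Finset.card_eq_zero] at hc
      simp [hc] at hne
    | succ k ih =>
      intro U hU hc hne
      obtain ⟨i, hi, hlt⟩ := hcon U hU hne
      have hsplit := Finset.add_sum_erase U a hi
      have hcard : (U.erase i).card = k := by rw [Finset.card_erase_of_mem hi, hc]; rfl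
      have hle : ∑ j ∈ U.erase i, a j ≤ A / H * (harmonic k : ℝ) := by
        rcases (U.erase i).eq_empty_or_nonempty with h0 | h1
        · rw [h0] at hcard ⊢
          simp at hcard
          simp [← hcard]
        · exact (ih _ ((Finset.erase_subset _ _).trans hU) hcard h1).le
      rw [harmonic_succ, ← hsplit]
      have : A / (U.card * H) = A / H * ((k + 1 : ℕ) : ℝ)⁻¹ := by
        rw [hc]; field_simp
      rw [this] at hlt
      push_cast at hlt ⊢
      rw [mul_add]
      linarith
  rcases S.eq_empty_or_nonempty with h0 | h1
  · rw [h0] at hsum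
    simp at hsum
    linarith
  · have h2 := key S.card S subset_rfl rfl h1
    have h3 : A / H * (harmonic S.card : ℝ) ≤ A / H * H :=
      mul_le_mul_of_nonneg_left hS (by positivity)
    rw [div_mul_cancel₀ _ hH.ne'] at h3
    linarith

/-- Approximate Carathéodory (Maurey): a mean is approximated by sparse averages. -/
lemma exists_sparse_sum (f : ι → F) (T : Finset ι) (hT : T.Nonempty) {B : ℝ}
    (hB : ∑ j ∈ T, ‖f j‖ ^ 2 ≤ T.card * B) (q : ℕ) :
    ∃ Q : Fin q → ι, (∀ a, Q a ∈ T) ∧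
      ‖∑ a, f (Q a) - (q : ℝ) • ((T.card : ℝ)⁻¹ • ∑ j ∈ T, f j)‖ ^ 2 ≤ q * B := by
  set c : F := (T.card : ℝ)⁻¹ • ∑ j ∈ T, f j with hc
  have hTc : (0 : ℝ) < T.card := by exact_mod_cast hT.card_pos
  induction q with
  | zero => exact ⟨Fin.elim0, fun a => a.elim0, by simp⟩
  | succ q ih =>
    obtain ⟨Q, hQ, hle⟩ := ih
    set W := ∑ a, f (Q a) - (q : ℝ) • c with hW
    -- Averaged over the new term, the cross term with the current error `W` vanishes and the
    -- variance is at most `B`; hence some choice raises the squared error by at most `B`.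
    have hsum : ∑ j ∈ T, ‖W + (f j - c)‖ ^ 2 ≤ ∑ _j ∈ T, (‖W‖ ^ 2 + B) := by
      have hfs : ∑ j ∈ T, f j = (T.card : ℝ) • c := by
        rw [hc, smul_smul, mul_inv_cancel₀ hTc.ne', one_smul]
      have h1 : ∀ j, ‖W + (f j - c)‖ ^ 2
          = ‖W‖ ^ 2 + 2 * inner ℝ W (f j) - 2 * inner ℝ W c
            + (‖f j‖ ^ 2 - 2 * inner ℝ (f j) c + ‖c‖ ^ 2) := by
        intro j
        rw [norm_add_sq_real W, norm_sub_sq_real (f j), inner_sub_right]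
        ring
      simp only [h1, Finset.sum_add_distrib, Finset.sum_sub_distrib, ← Finset.mul_sum,
        ← inner_sum, ← sum_inner, hfs, Finset.sum_const, ← Nat.cast_smul_eq_nsmul ℝ, smul_eq_mul,
        real_inner_smul_left, real_inner_smul_right, real_inner_self_eq_norm_sq]
      nlinarith [sq_nonneg ‖c‖]
    obtain ⟨j, hj, hjle⟩ := Finset.exists_le_of_sum_le hT hsum
    refine ⟨Fin.snoc Q j, ?_, ?_⟩
    · intro a
      refine Fin.lastCases ?_ (fun b => ?_) a
      · simpa using hj
      · simpa using hQ b
    · rw [Fin.sum_univ_castSucc]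
      simp only [Fin.snoc_castSucc, Fin.snoc_last]
      have : ∑ a, f (Q a) + f j - ((q + 1 : ℕ) : ℝ) • c = W + (f j - c) := by
        rw [hW]; push_cast; rw [add_smul, one_smul]; abel
      rw [this]
      push_cast
      linarith

/-- The perceptron alternative: either a tuple of `q` vectors with a short sum, or a shorter tuple
whose sum has a large inner product with all vectors. -/
lemma perceptron_alternative (y : ι → F) (V : Finset ι) {D θ : ℝ}
    (hD : ∀ i ∈ V, ‖y i‖ ^ 2 ≤ D) (q : ℕ) :
    (∃ Q : Fin q → ι, (∀ a, Q a ∈ V) ∧ ‖∑ a, y (Q a)‖ ^ 2 ≤ q * (D + 2 * θ)) ∨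
    (∃ k < q, ∃ Q : Fin k → ι, (∀ a, Q a ∈ V) ∧ ‖∑ a, y (Q a)‖ ^ 2 ≤ k * (D + 2 * θ) ∧
      ∀ i ∈ V, θ ≤ inner ℝ (y i) (∑ a, y (Q a))) := by
  induction q with
  | zero => exact Or.inl ⟨Fin.elim0, fun a => a.elim0, by simp⟩
  | succ q ih =>
    rcases ih with ⟨Q, hQ, hle⟩ | ⟨k, hk, Q, h⟩
    -- A perceptron step: a vector whose inner product with the current sum is below `θ` can be
    -- appended, and the squared norm grows by at most `D + 2θ`.
    · by_cases hall : ∀ i ∈ V, θ ≤ inner ℝ (y i) (∑ a, y (Q a))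
      · exact Or.inr ⟨q, Nat.lt_succ_self q, Q, hQ, hle, hall⟩
      · push Not at hall
        obtain ⟨i, hi, hlt⟩ := hall
        refine Or.inl ⟨Fin.snoc Q i, ?_, ?_⟩
        · intro a
          refine Fin.lastCases ?_ (fun b => ?_) a
          · simpa using hi
          · simpa using hQ b
        · rw [Fin.sum_univ_castSucc]
          simp only [Fin.snoc_castSucc, Fin.snoc_last]
          rw [norm_add_sq_real, real_inner_comm]
          push_cast
          nlinarith [hD i hi]
    · exact Or.inr ⟨k, hk.trans (Nat.lt_succ_self q), Q, h⟩

/-- A greedy maximum cut of a family of vectors. -/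
lemma exists_cut [DecidableEq ι] (y : ι → F) (T : Finset ι) :
    ∃ U ⊆ T, ‖∑ i ∈ T, y i‖ ^ 2 - ∑ i ∈ T, ‖y i‖ ^ 2
      ≤ 4 * inner ℝ (∑ i ∈ U, y i) (∑ i ∈ T \ U, y i) := by
  induction T using Finset.induction_on with
  | empty => exact ⟨∅, by simp⟩
  | insert a T ha ih =>
    obtain ⟨U, hU, hle⟩ := ih
    have haU : a ∉ U := fun h => ha (hU h)
    have hsplit : ∑ i ∈ T, y i = ∑ i ∈ U, y i + ∑ i ∈ T \ U, y i := by
      rw [add_comm]; exact (Finset.sum_sdiff hU).symm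
    have hexp : ‖∑ i ∈ insert a T, y i‖ ^ 2 - ∑ i ∈ insert a T, ‖y i‖ ^ 2
        = (‖∑ i ∈ T, y i‖ ^ 2 - ∑ i ∈ T, ‖y i‖ ^ 2) + 2 * inner ℝ (y a) (∑ i ∈ T, y i) := by
      rw [Finset.sum_insert ha, Finset.sum_insert ha, norm_add_sq_real]
      ring
    rw [hexp, hsplit, inner_add_right, ← hsplit]
    -- The new vector joins the side with which it correlates less, so at least half of its
    -- correlation with the whole sum crosses the cut.
    rcases le_total (inner ℝ (y a) (∑ i ∈ U, y i)) (inner ℝ (y a) (∑ i ∈ T \ U, y i)) with h | h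
    · refine ⟨insert a U, Finset.insert_subset_insert _ hU, ?_⟩
      have : insert a T \ insert a U = T \ U := by
        ext i; simp only [Finset.mem_sdiff, Finset.mem_insert]
        constructor
        · rintro ⟨h1 | h1, h2⟩
          · exact absurd (Or.inl h1) h2
          · exact ⟨h1, fun h3 => h2 (Or.inr h3)⟩
        · rintro ⟨h1, h2⟩
          refine ⟨Or.inr h1, ?_⟩
          rintro (h3 | h3)
          · exact ha (h3 ▸ h1)
          · exact h2 h3
      rw [this, Finset.sum_insert haU, inner_add_left]
      linarith
    · refine ⟨U, hU.trans (Finset.subset_insert _ _), ?_⟩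
      have : insert a T \ U = insert a (T \ U) := Finset.insert_sdiff_of_notMem _ haU
      rw [this, Finset.sum_insert (by simp [ha]), inner_add_right,
        real_inner_comm (y a) (∑ i ∈ U, y i)]
      linarith

end Deterministic

end

/-! ### Sparse tuples with controlled multiplicities. -/

section

section SelfFriendly

/-- Maurey's lemma in coordinates. -/
lemma exists_sparse_sum_coord {ι κ : Type*} [Fintype κ] (f : ι → κ → ℝ) (T : Finset ι)
    (hT : T.Nonempty) {B : ℝ} (hB : ∀ j ∈ T, ∑ k, f j k ^ 2 ≤ B) (q : ℕ) :
    ∃ Q : Fin q → ι, (∀ a, Q a ∈ T) ∧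
      ∑ k, (∑ a, f (Q a) k - (q : ℝ) * ((T.card : ℝ)⁻¹ * ∑ j ∈ T, f j k)) ^ 2 ≤ q * B := by
  obtain ⟨Q, hQ, h⟩ := exists_sparse_sum (fun j => (WithLp.toLp 2 (f j) : EuclideanSpace ℝ κ)) T hT
    (B := B) (by
      rw [← nsmul_eq_mul, ← Finset.sum_const]
      refine Finset.sum_le_sum fun j hj => ?_
      rw [EuclideanSpace.real_norm_sq_eq]
      exact hB j hj) q
  refine ⟨Q, hQ, ?_⟩
  rw [EuclideanSpace.real_norm_sq_eq] at h
  simpa using h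

variable {F : Type*} [NormedAddCommGroup F] [InnerProductSpace ℝ F]

/-- Sparsification of the vectors indexed by `T`, preserving the correlations with the vectors
indexed by `S` and without large multiplicities. -/
lemma exists_sparse_tuple {n : ℕ} (y : Fin n → F) (S T : Finset (Fin n)) (hS : S.Nonempty)
    (hT : T.Nonempty) {c : ℝ} (hc : 0 < c)
    (hpair : ∀ i ∈ S, ∀ j ∈ T, |inner ℝ (y i) (y j)| ≤ c) (q : ℕ) :
    ∃ Q : Fin q → Fin n, (∀ a, Q a ∈ T) ∧
      ∑ i ∈ S, (inner ℝ (y i) (∑ a, y (Q a)) - q / T.card * inner ℝ (y i) (∑ j ∈ T, y j)) ^ 2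
        ≤ 2 * q * (S.card * c ^ 2) ∧
      ∑ j ∈ T, (∑ a, if Q a = j then (1 : ℝ) else 0) ^ 2 ≤ 4 * q + 2 * q ^ 2 / T.card := by
  classical
  have hs : (0 : ℝ) < S.card := by exact_mod_cast hS.card_pos
  have ht : (0 : ℝ) < T.card := by exact_mod_cast hT.card_pos
  set e : ℝ := √S.card * c with he
  have he0 : 0 < e := by positivity
  have he2 : e ^ 2 = S.card * c ^ 2 := by rw [he, mul_pow, Real.sq_sqrt hs.le]
  -- Maurey's lemma is applied to vectors with two blocks of norm at most one: the correlations with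
  -- `S`, scaled by `e`, and the indicator of the index. The second block keeps multiplicities
  -- small.
  obtain ⟨Q, hQ, h⟩ := exists_sparse_sum_coord (ι := Fin n) (κ := Fin n ⊕ Fin n)
    (fun j => Sum.elim (fun i => if i ∈ S then inner ℝ (y i) (y j) / e else 0)
      (fun i => if j = i then 1 else 0)) T hT (B := 2) (by
      intro j hj
      rw [Fintype.sum_sum_type]
      simp only [Sum.elim_inl, Sum.elim_inr]
      have h1 : ∑ i, (if i ∈ S then inner ℝ (y i) (y j) / e else 0) ^ 2 ≤ 1 := by
        have : ∑ i, (if i ∈ S then inner ℝ (y i) (y j) / e else 0) ^ 2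
            = ∑ i ∈ S, (inner ℝ (y i) (y j) / e) ^ 2 := by
          simp [ite_pow]
        rw [this]
        calc ∑ i ∈ S, (inner ℝ (y i) (y j) / e) ^ 2 ≤ ∑ i ∈ S, (S.card : ℝ)⁻¹ := by
              refine Finset.sum_le_sum fun i hi => ?_
              rw [div_pow, he2, div_le_iff₀ (by positivity)]
              have := sq_le_sq' (abs_le.mp (hpair i hi j hj)).1 (abs_le.mp (hpair i hi j hj)).2
              rw [← mul_assoc, inv_mul_cancel₀ hs.ne', one_mul]
              exact this
          _ = 1 := by rw [Finset.sum_const, nsmul_eq_mul, mul_inv_cancel₀ hs.ne']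
      have h2 : ∑ i, (if j = i then (1 : ℝ) else 0) ^ 2 = 1 := by simp [ite_pow]
      rw [h2]
      linarith) q
  rw [Fintype.sum_sum_type] at h
  simp only [Sum.elim_inl, Sum.elim_inr] at h
  refine ⟨Q, hQ, ?_, ?_⟩
  · have h1 := (le_add_of_nonneg_right (Finset.sum_nonneg fun i _ => sq_nonneg _)).trans h
    have h2 : ∑ i ∈ S, (inner ℝ (y i) (∑ a, y (Q a))
        - q / T.card * inner ℝ (y i) (∑ j ∈ T, y j)) ^ 2 / e ^ 2 ≤ q * 2 := by
      refine le_trans ?_ h1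
      rw [← Finset.sum_subset (Finset.subset_univ S)]
      · refine Finset.sum_le_sum fun i hi => le_of_eq ?_
        simp only [hi, if_true]
        rw [← Finset.sum_div, ← Finset.sum_div, ← inner_sum, ← inner_sum, ← div_pow]
        congr 1
        field_simp
      · intro i _ hi
        simp [hi]
    rw [← Finset.sum_div, div_le_iff₀ (by positivity), he2] at h2
    linarith
  · have h1 := (le_add_of_nonneg_left (Finset.sum_nonneg fun i _ => sq_nonneg _)).trans h
    have h3 : ∑ j ∈ T, (∑ a, (if Q a = j then (1 : ℝ) else 0) - q / T.card) ^ 2 ≤ q * 2 := by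
      refine le_trans ?_ h1
      refine le_trans (le_of_eq ?_)
        (Finset.sum_le_sum_of_subset_of_nonneg (Finset.subset_univ T) fun i _ _ => sq_nonneg _)
      refine Finset.sum_congr rfl fun i hi => ?_
      have : ∑ j ∈ T, (if j = i then (1 : ℝ) else 0) = 1 := by simp [hi]
      rw [this, mul_one, div_eq_mul_inv]
    calc ∑ j ∈ T, (∑ a, if Q a = j then (1 : ℝ) else 0) ^ 2
        ≤ ∑ j ∈ T, (2 * (∑ a, (if Q a = j then (1 : ℝ) else 0) - q / T.card) ^ 2
            + 2 * ((q : ℝ) / T.card) ^ 2) := by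
          refine Finset.sum_le_sum fun j _ => ?_
          nlinarith [sq_nonneg (∑ a, (if Q a = j then (1 : ℝ) else 0) - 2 * (q / T.card))]
      _ ≤ 2 * (q * 2) + T.card * (2 * ((q : ℝ) / T.card) ^ 2) := by
          rw [Finset.sum_add_distrib, ← Finset.mul_sum, Finset.sum_const, nsmul_eq_mul]
          linarith
      _ = 4 * q + 2 * q ^ 2 / T.card := by field_simp; ring

/-- Correlation of a direction `v` with a tuple drawn from `T`, in terms of the large correlations
of `v` with members of `T`. -/
lemma tuple_correlation_le {n q : ℕ} (y : Fin n → F) (T : Finset (Fin n)) (Q : Fin q → Fin n)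
    (hQ : ∀ a, Q a ∈ T) (v : F) {τ σ M G : ℝ} (hσ : |σ| ≤ 1)
    (hM : ∑ j ∈ T, (∑ a, if Q a = j then (1 : ℝ) else 0) ^ 2 ≤ M)
    (hG : ∑ j ∈ T with τ < |inner ℝ (y j) v|, inner ℝ (y j) v ^ 2 ≤ G) (hτ : 0 ≤ τ) :
    σ * inner ℝ v (∑ a, y (Q a)) ≤ q * τ + √M * √G := by
  classical
  -- Correlations up to `τ` are counted trivially; those beyond are collected in `g` and paired with
  -- the multiplicities by the Cauchy–Schwarz inequality.
  set g : Fin n → ℝ := fun j => if τ < |inner ℝ (y j) v| then |inner ℝ (y j) v| else 0 with hg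
  have h1 : ∀ j, σ * inner ℝ v (y j) ≤ τ + g j := by
    intro j
    have h2 : σ * inner ℝ v (y j) ≤ |inner ℝ (y j) v| := by
      rw [real_inner_comm]
      calc σ * inner ℝ (y j) v ≤ |σ * inner ℝ (y j) v| := le_abs_self _
        _ = |σ| * |inner ℝ (y j) v| := abs_mul _ _
        _ ≤ 1 * |inner ℝ (y j) v| := mul_le_mul_of_nonneg_right hσ (abs_nonneg _)
        _ = _ := one_mul _
    by_cases h : τ < |inner ℝ (y j) v|
    · simp only [hg, h, if_true]; linarith
    · simp only [hg, h, if_false]; push Not at h; linarith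
  have h2 : ∑ a, g (Q a) = ∑ j ∈ T, (∑ a, if Q a = j then (1 : ℝ) else 0) * g j := by
    simp only [Finset.sum_mul]
    rw [Finset.sum_comm]
    refine Finset.sum_congr rfl fun a _ => ?_
    simp [hQ a]
  have h3 : ∑ j ∈ T, g j ^ 2 ≤ G := by
    refine le_trans (le_of_eq ?_) hG
    rw [Finset.sum_filter]
    refine Finset.sum_congr rfl fun j _ => ?_
    simp only [hg]
    split_ifs <;> simp
  calc σ * inner ℝ v (∑ a, y (Q a)) = ∑ a, σ * inner ℝ v (y (Q a)) := by
        rw [inner_sum, Finset.mul_sum]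
    _ ≤ ∑ a : Fin q, (τ + g (Q a)) := Finset.sum_le_sum fun a _ => h1 _
    _ = q * τ + ∑ a, g (Q a) := by simp [Finset.sum_add_distrib]
    _ ≤ q * τ + √M * √G := by
        rw [h2]
        have := Real.sum_mul_le_sqrt_mul_sqrt T
          (fun j => ∑ a, if Q a = j then (1 : ℝ) else 0) g
        have h4 := mul_le_mul (Real.sqrt_le_sqrt hM) (Real.sqrt_le_sqrt h3) (Real.sqrt_nonneg _)
          (Real.sqrt_nonneg _)
        linarith

end SelfFriendly

end

/-! ### Scales and thresholds; half-space likeness and heavy directions. -/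

section

/-- Upper bound for the squared norms of points passing the norm filter. -/
noncomputable def normCap (Λ : ℝ) (d : ℕ) : ℝ := 2 * Λ ^ 8 * d

/-- The scale of admissible correlations in a friendly dataset. -/
noncomputable def corrScale (d m : ℕ) : ℝ := max √((m : ℝ) * d) m

/-- Threshold on the correlation with a sparse tuple. -/
noncomputable def corrLevel (Λ : ℝ) (d m s t q : ℕ) : ℝ :=
  q * (Λ ^ 40 * corrScale d m) / (2 * Λ * √((s : ℝ) * t))

/-- Perceptron threshold for tuples of length `q`. -/
noncomputable def percLevel (Λ : ℝ) (d q : ℕ) : ℝ :=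
  2 * Λ ^ 4 * √(q * normCap Λ d) + 8 * Λ ^ 8 * q

section

variable {F : Type*} [NormedAddCommGroup F] [InnerProductSpace ℝ F]

/-- The points `u i`, `i ∈ U`, and `v i`, `i ∈ V`, look alike with respect to intersections of two
half-spaces spanned by few of the points. -/
def AlikeHalfspaces (Λ : ℝ) (d m C n : ℕ) (U V : Finset (Fin n)) (u v : Fin n → F) : Prop :=
  ∀ s t : ℕ, s ≤ n → t ≤ n → ∀ σ : ℝ, σ = 1 ∨ σ = -1 → ∀ k < s / C,
    ∀ (Q : Fin (s / C) → Fin n) (Q' : Fin k → Fin n), (∀ a, Q a ∈ U) → (∀ a, Q' a ∈ V) →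
    (∀ i ∈ V, corrLevel Λ d m s t (s / C) ≤ σ * inner ℝ (v i) (∑ a, u (Q a)) →
      percLevel Λ d (s / C) ≤ inner ℝ (v i) (∑ a, v (Q' a))) →
    4 * (U.filter fun i => corrLevel Λ d m s t (s / C) ≤ σ * inner ℝ (u i) (∑ a, u (Q a)) ∧
      inner ℝ (u i) (∑ a, v (Q' a)) < percLevel Λ d (s / C)).card < s

/-- No direction spanned by few of the points `v i` is strongly correlated with many of the points
`u i`, `i ∈ J`. -/
def NoHeavyDirection (Λ : ℝ) (n : ℕ) (J : Finset (Fin n)) (u v : Fin n → F) : Prop :=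
  ∀ k ≤ n, ∀ Q : Fin k → Fin n,
    ∑ j ∈ J with Λ ^ 4 * ‖∑ a, v (Q a)‖ < |inner ℝ (u j) (∑ a, v (Q a))|,
      inner ℝ (u j) (∑ a, v (Q a)) ^ 2 ≤ Λ ^ 5 * k * ‖∑ a, v (Q a)‖ ^ 2

lemma corrScale_pos {d m : ℕ} (hm : 0 < m) : 0 < corrScale d m :=
  lt_max_of_lt_right (by exact_mod_cast hm)

lemma le_corrScale_sq (d m : ℕ) : (m : ℝ) * (d + m) ≤ 2 * corrScale d m ^ 2 := by
  have h1 : √((m : ℝ) * d) ≤ corrScale d m := le_max_left _ _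
  have h2 : (m : ℝ) ≤ corrScale d m := le_max_right _ _
  have h3 : (m : ℝ) * d ≤ corrScale d m ^ 2 := by
    rw [← Real.sq_sqrt (show (0 : ℝ) ≤ (m : ℝ) * d by positivity)]
    exact pow_le_pow_left₀ (Real.sqrt_nonneg _) h1 2
  have h4 : (m : ℝ) ^ 2 ≤ corrScale d m ^ 2 := pow_le_pow_left₀ (by positivity) h2 2
  nlinarith

lemma percLevel_pos {Λ : ℝ} (hΛ : 0 < Λ) {d q : ℕ} (hq : 0 < q) : 0 < percLevel Λ d q := by
  unfold percLevel
  have : (0 : ℝ) < q := by exact_mod_cast hq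
  positivity

/-- The two summands of `percLevel` are chosen so that each of the two terms on the left is at most
a quarter of the right side. Consequence: for a sum `x` produced by the perceptron, an inner product
reaching the threshold exceeds `Λ ^ 4 * ‖x‖` and is thus counted by `NoHeavyDirection`. -/
lemma normCap_add_percLevel_lt {Λ : ℝ} (hΛ : 0 < Λ) {d q : ℕ} (hq : 0 < q) :
    (Λ ^ 4) ^ 2 * (q * (normCap Λ d + 2 * percLevel Λ d q)) < percLevel Λ d q ^ 2 := by
  have hq' : (0 : ℝ) < q := by exact_mod_cast hq
  have hD : 0 ≤ normCap Λ d := by unfold normCap; positivity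
  have hθ := percLevel_pos hΛ (d := d) hq
  set θ := percLevel Λ d q with hθd
  set r := √(q * normCap Λ d) with hr
  have hr2 : r ^ 2 = q * normCap Λ d := Real.sq_sqrt (by positivity)
  have hr0 : 0 ≤ r := Real.sqrt_nonneg _
  have h1 : θ = 2 * Λ ^ 4 * r + 8 * Λ ^ 8 * q := rfl
  have h2 : 8 * Λ ^ 8 * q * θ ≤ θ ^ 2 := by
    have : 8 * Λ ^ 8 * q ≤ θ := by rw [h1]; nlinarith [show 0 ≤ 2 * Λ ^ 4 * r by positivity]
    nlinarith
  have h3 : 4 * Λ ^ 8 * r ^ 2 ≤ θ ^ 2 := by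
    have : 2 * Λ ^ 4 * r ≤ θ := by rw [h1]; nlinarith [show 0 ≤ 8 * Λ ^ 8 * q by positivity]
    calc 4 * Λ ^ 8 * r ^ 2 = (2 * Λ ^ 4 * r) ^ 2 := by ring
      _ ≤ θ ^ 2 := pow_le_pow_left₀ (by positivity) this 2
  have h4 : (Λ ^ 4) ^ 2 * (q * (normCap Λ d + 2 * θ)) = Λ ^ 8 * r ^ 2 + 2 * (Λ ^ 8 * q * θ) := by
    rw [hr2]; ring
  rw [h4]
  nlinarith [show 0 < θ ^ 2 by positivity]

lemma normCap_add_percLevel_le {Λ : ℝ} (hΛ : 0 < Λ) {d q m : ℕ} (hqm : q ≤ m) :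
    normCap Λ d + 2 * percLevel Λ d q ≤ 20 * Λ ^ 8 * (d + m) := by
  have hD : 0 ≤ normCap Λ d := by unfold normCap; positivity
  set r := √(q * normCap Λ d) with hr
  have hr2 : r ^ 2 = q * normCap Λ d := Real.sq_sqrt (by positivity)
  have h1 : percLevel Λ d q = 2 * Λ ^ 4 * r + 8 * Λ ^ 8 * q := rfl
  have h2 : 4 * Λ ^ 4 * r ≤ normCap Λ d + 4 * Λ ^ 8 * q := by
    have : r = √q * √(normCap Λ d) := by rw [hr, Real.sqrt_mul (by positivity)]
    have h5 := sq_nonneg (√(normCap Λ d) - 2 * Λ ^ 4 * √q)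
    have h6 : √(normCap Λ d) ^ 2 = normCap Λ d := Real.sq_sqrt hD
    have h7 : √(q : ℝ) ^ 2 = q := Real.sq_sqrt (by positivity)
    calc 4 * Λ ^ 4 * r = 4 * Λ ^ 4 * √q * √(normCap Λ d) := by rw [this]; ring
      _ ≤ √(normCap Λ d) ^ 2 + 4 * Λ ^ 8 * √(q : ℝ) ^ 2 := by nlinarith
      _ = _ := by rw [h6, h7]
  have h3 : (q : ℝ) ≤ m := by exact_mod_cast hqm
  have h4 : Λ ^ 8 * (q : ℝ) ≤ Λ ^ 8 * m := mul_le_mul_of_nonneg_left h3 (by positivity)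
  have h5 : 0 ≤ Λ ^ 8 * (d : ℝ) := by positivity
  rw [h1]
  have h6 : normCap Λ d = 2 * (Λ ^ 8 * d) := by unfold normCap; ring
  nlinarith

/-- Correlated sets inside `J` have a large subset of uniformly correlated points. -/
lemma exists_uniformly_correlated {n : ℕ} {Λ : ℝ} (hΛ : 0 < Λ)
    (hharm : ∀ k ≤ n, (harmonic k : ℝ) ≤ Λ) (u : Fin n → F) (S T : Finset (Fin n))
    {σ R : ℝ} (hR : 0 < R) (hS : S.Nonempty) (hT : T.Nonempty)
    (h : R * √((S.card : ℝ) * T.card) ≤ σ * inner ℝ (∑ i ∈ S, u i) (∑ i ∈ T, u i)) :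
    ∃ S' ⊆ S, S'.Nonempty ∧ ∀ i ∈ S', R * √((S'.card : ℝ) * T.card) / (S'.card * Λ)
      ≤ σ * inner ℝ (u i) (∑ i ∈ T, u i) := by
  have hs : (0 : ℝ) < S.card := by exact_mod_cast hS.card_pos
  have ht : (0 : ℝ) < T.card := by exact_mod_cast hT.card_pos
  obtain ⟨S', hS', hne, hall⟩ := exists_level_subset
    (fun i => σ * inner ℝ (u i) (∑ i ∈ T, u i)) (A := R * √((S.card : ℝ) * T.card)) (H := Λ)
    (by positivity) hΛ S (hharm _ (by simpa using Finset.card_le_univ S))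
    (by rw [← Finset.mul_sum, ← sum_inner]; exact h)
  refine ⟨S', hS', hne, fun i hi => le_trans ?_ (hall i hi)⟩
  have hs' : (0 : ℝ) < S'.card := by exact_mod_cast hne.card_pos
  have : (S'.card : ℝ) ≤ S.card := by exact_mod_cast Finset.card_le_card hS'
  gcongr

end

end

/-! ### Small cross correlations among the surviving bad points. -/

section

section

variable {F : Type*} [NormedAddCommGroup F] [InnerProductSpace ℝ F]

/-- Pairwise bounds limit the correlation of one point with the sum over `T` to `|T| Λ ^ 8 √d`. A
level set with fewer than `C ≤ Λ ^ 6` points would demand more, since it would force `Λ ^ 40 ≤ Λ ^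
12`. The bound guarantees that tuples of length `s / C` are nonempty. -/
lemma level_card_large {n d m C : ℕ} {Λ : ℝ} (hΛ : 6 ≤ Λ) (hC : (C : ℝ) ≤ Λ ^ 6) (hd : 0 < d)
    (u : Fin n → F) (S T : Finset (Fin n)) (hST : Disjoint S T) (hS : S.Nonempty)
    (hT : T.Nonempty) (hTm : T.card ≤ m) {σ : ℝ} (hσ : |σ| ≤ 1)
    (hpair : ∀ i ∈ S, ∀ j ∈ T, i ≠ j → |inner ℝ (u i) (u j)| ≤ Λ ^ 8 * √d)
    (hlev : ∀ i ∈ S, Λ ^ 40 * corrScale d m * √((S.card : ℝ) * T.card) / (S.card * Λ)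
      ≤ σ * inner ℝ (u i) (∑ i ∈ T, u i)) : C ≤ S.card := by
  by_contra hcon
  push Not at hcon
  have hΛ0 : 0 < Λ := by linarith
  obtain ⟨i, hi⟩ := hS
  have hs : (0 : ℝ) < S.card := by exact_mod_cast Finset.card_pos.mpr ⟨i, hi⟩
  have ht : (0 : ℝ) < T.card := by exact_mod_cast hT.card_pos
  have hm : (0 : ℝ) < m := lt_of_lt_of_le ht (by exact_mod_cast hTm)
  have hd' : (0 : ℝ) < d := by exact_mod_cast hd
  have h1 : σ * inner ℝ (u i) (∑ j ∈ T, u j) ≤ T.card * (Λ ^ 8 * √d) := by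
    calc σ * inner ℝ (u i) (∑ j ∈ T, u j) = ∑ j ∈ T, σ * inner ℝ (u i) (u j) := by
          rw [inner_sum, Finset.mul_sum]
      _ ≤ ∑ _j ∈ T, Λ ^ 8 * √d := by
          refine Finset.sum_le_sum fun j hj => ?_
          have hij : i ≠ j := fun h => Finset.disjoint_left.mp hST hi (h ▸ hj)
          calc σ * inner ℝ (u i) (u j) ≤ |σ * inner ℝ (u i) (u j)| := le_abs_self _
            _ = |σ| * |inner ℝ (u i) (u j)| := abs_mul _ _
            _ ≤ 1 * |inner ℝ (u i) (u j)| := mul_le_mul_of_nonneg_right hσ (abs_nonneg _)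
            _ = |inner ℝ (u i) (u j)| := one_mul _
            _ ≤ _ := hpair i hi j hj hij
      _ = T.card * (Λ ^ 8 * √d) := by rw [Finset.sum_const, nsmul_eq_mul]
  have h2 := (hlev i hi).trans h1
  rw [div_le_iff₀ (by positivity)] at h2
  set r := √((S.card : ℝ) * T.card) with hr
  have hr0 : 0 < r := Real.sqrt_pos.mpr (by positivity)
  have hr2 : r ^ 2 = S.card * T.card := Real.sq_sqrt (by positivity)
  have h3 : Λ ^ 40 * corrScale d m ≤ Λ ^ 9 * √d * r := by
    refine le_of_mul_le_mul_right ?_ hr0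
    calc Λ ^ 40 * corrScale d m * r ≤ T.card * (Λ ^ 8 * √d) * (S.card * Λ) := h2
      _ = Λ ^ 9 * √d * (S.card * T.card) := by ring
      _ = Λ ^ 9 * √d * r * r := by rw [← hr2]; ring
  have h4 : √(m : ℝ) * √d ≤ corrScale d m := by
    rw [← Real.sqrt_mul (by positivity)]; exact le_max_left _ _
  have h5 : r ≤ √m * Λ ^ 3 := by
    refine Real.sqrt_le_iff.mpr ⟨by positivity, ?_⟩
    rw [mul_pow, Real.sq_sqrt hm.le]
    have h6 : (S.card : ℝ) ≤ Λ ^ 6 := le_trans (by exact_mod_cast hcon.le) hC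
    calc (S.card : ℝ) * T.card ≤ Λ ^ 6 * m :=
          mul_le_mul h6 (by exact_mod_cast hTm) (by positivity) (by positivity)
      _ = m * (Λ ^ 3) ^ 2 := by ring
  have h7 : Λ ^ 40 * (√(m : ℝ) * √d) ≤ Λ ^ 12 * (√(m : ℝ) * √d) := by
    calc Λ ^ 40 * (√(m : ℝ) * √d) ≤ Λ ^ 40 * corrScale d m := by gcongr
      _ ≤ Λ ^ 9 * √d * r := h3
      _ ≤ Λ ^ 9 * √d * (√m * Λ ^ 3) := by gcongr
      _ = _ := by ring
  have h8 : 0 < √(m : ℝ) * √d := by positivity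
  have h9 : Λ ^ 12 < Λ ^ 40 := pow_lt_pow_right₀ (by linarith) (by norm_num)
  nlinarith

/-- Most points correlated with `∑ T` are correlated with a sparse tuple from `T`. -/
lemma sparse_tuple_correlated {n d m C q : ℕ} {Λ : ℝ} (hΛ : 6 ≤ Λ) (hC : (C : ℝ) ≤ Λ ^ 6)
    (hd : 0 < d) (u : Fin n → F) (S T : Finset (Fin n)) (hS : S.Nonempty) (hT : T.Nonempty)
    (hTm : T.card ≤ m) {σ : ℝ} (hσ : σ ^ 2 = 1) (hq : 0 < q) (hqs : S.card ≤ 2 * C * q)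
    (hlev : ∀ i ∈ S, Λ ^ 40 * corrScale d m * √((S.card : ℝ) * T.card) / (S.card * Λ)
      ≤ σ * inner ℝ (u i) (∑ i ∈ T, u i)) (w : F)
    (hw : ∑ i ∈ S, (inner ℝ (u i) w - q / T.card * inner ℝ (u i) (∑ j ∈ T, u j)) ^ 2
        ≤ 2 * q * (S.card * (Λ ^ 8 * √d) ^ 2)) :
    (S.card : ℝ) ≤
      2 * (S.filter fun i => corrLevel Λ d m S.card T.card q ≤ σ * inner ℝ (u i) w).card := by
  classical
  have hΛ0 : 0 < Λ := by linarith
  have hs : (0 : ℝ) < S.card := by exact_mod_cast hS.card_pos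
  have ht : (0 : ℝ) < T.card := by exact_mod_cast hT.card_pos
  have htm : (T.card : ℝ) ≤ m := by exact_mod_cast hTm
  have hm : (0 : ℝ) < m := lt_of_lt_of_le ht htm
  have hd' : (0 : ℝ) < d := by exact_mod_cast hd
  have hq' : (0 : ℝ) < q := by exact_mod_cast hq
  have hR : 0 < corrScale d m := corrScale_pos (by exact_mod_cast hm)
  set h := corrLevel Λ d m S.card T.card q with hh
  set r := √((S.card : ℝ) * T.card) with hr
  have hr0 : 0 < r := Real.sqrt_pos.mpr (by positivity)
  have hr2 : r ^ 2 = S.card * T.card := Real.sq_sqrt (by positivity)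
  have hhdef : h = q * (Λ ^ 40 * corrScale d m) / (2 * Λ * r) := rfl
  have hh0 : 0 < h := by rw [hhdef]; positivity
  have hcard := Finset.card_filter_add_card_filter_not (s := S) (fun i => h ≤ σ * inner ℝ (u i) w)
  by_contra hcon
  push Not at hcon
  set N := (S.filter fun i => ¬ h ≤ σ * inner ℝ (u i) w).card with hN
  have hNs : (S.card : ℝ) < 2 * N := by
    have : ((S.filter fun i => h ≤ σ * inner ℝ (u i) w).card : ℝ) + N = S.card := by
      exact_mod_cast hcard
    linarith
  -- The rescaled correlation with the full sum is at least `2 h`, so every point below the level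
  -- `h` deviates from it by at least `h`; the second moment bounds the number `N` of such points.
  have h1 : (N : ℝ) * h ^ 2 ≤ 2 * q * (S.card * (Λ ^ 8 * √d) ^ 2) := by
    refine le_trans ?_ hw
    refine le_trans ?_ (Finset.sum_le_sum_of_subset_of_nonneg (Finset.filter_subset
      (fun i => ¬ h ≤ σ * inner ℝ (u i) w) S) fun i _ _ => sq_nonneg _)
    rw [hN, ← nsmul_eq_mul, ← Finset.sum_const]
    refine Finset.sum_le_sum fun i hi => ?_
    rw [Finset.mem_filter] at hi
    have h2 := hlev i hi.1
    have h3 := hi.2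
    push Not at h3
    have h4 : 2 * h ≤ q / T.card * (σ * inner ℝ (u i) (∑ j ∈ T, u j)) := by
      refine le_trans (le_of_eq ?_) (mul_le_mul_of_nonneg_left h2 (by positivity))
      rw [hhdef]
      field_simp
      rw [hr2, mul_comm]
    have h5 : h ≤ -(σ * (inner ℝ (u i) w - q / T.card * inner ℝ (u i) (∑ j ∈ T, u j))) := by
      linarith
    calc h ^ 2 ≤ (-(σ * (inner ℝ (u i) w - q / T.card * inner ℝ (u i) (∑ j ∈ T, u j)))) ^ 2 :=
          pow_le_pow_left₀ hh0.le h5 2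
      _ = σ ^ 2 * (inner ℝ (u i) w - q / T.card * inner ℝ (u i) (∑ j ∈ T, u j)) ^ 2 := by ring
      _ = _ := by rw [hσ, one_mul]
  rw [mul_pow, Real.sq_sqrt hd'.le] at h1
  have h2 : S.card * h ^ 2 < 2 * (2 * q * (S.card * ((Λ ^ 8) ^ 2 * d))) := by
    have : 0 < h ^ 2 := by positivity
    nlinarith
  have h3 : h ^ 2 < 4 * q * (Λ ^ 16 * d) := by
    refine lt_of_mul_lt_mul_left (lt_of_lt_of_eq h2 ?_) hs.le
    ring
  have h4 : h ^ 2 * (4 * Λ ^ 2 * (S.card * T.card)) = q ^ 2 * (Λ ^ 80 * corrScale d m ^ 2) := by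
    rw [hhdef, ← hr2]; field_simp; ring
  have h5 : (q : ℝ) ^ 2 * (Λ ^ 80 * corrScale d m ^ 2)
      < 4 * q * (Λ ^ 16 * d) * (4 * Λ ^ 2 * (S.card * T.card)) := by
    rw [← h4]
    exact mul_lt_mul_of_pos_right h3 (by positivity)
  have h6 : (S.card : ℝ) ≤ 2 * Λ ^ 6 * q := by
    calc (S.card : ℝ) ≤ 2 * C * q := by exact_mod_cast hqs
      _ ≤ 2 * Λ ^ 6 * q := by gcongr
  have h7 : (m : ℝ) * d ≤ corrScale d m ^ 2 := by
    rw [← Real.sq_sqrt (show (0 : ℝ) ≤ (m : ℝ) * d by positivity)]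
    exact pow_le_pow_left₀ (Real.sqrt_nonneg _) (le_max_left _ _) 2
  have h8 : (q : ℝ) ^ 2 * (Λ ^ 80 * (m * d)) < 32 * Λ ^ 24 * ((q : ℝ) ^ 2 * (m * d)) := by
    calc (q : ℝ) ^ 2 * (Λ ^ 80 * (m * d)) ≤ (q : ℝ) ^ 2 * (Λ ^ 80 * corrScale d m ^ 2) := by gcongr
      _ < 4 * q * (Λ ^ 16 * d) * (4 * Λ ^ 2 * (S.card * T.card)) := h5
      _ ≤ 4 * q * (Λ ^ 16 * d) * (4 * Λ ^ 2 * (2 * Λ ^ 6 * q * m)) := by gcongr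
      _ = _ := by ring
  have h9 : 32 * Λ ^ 24 ≤ Λ ^ 80 := by
    calc 32 * Λ ^ 24 ≤ Λ ^ 56 * Λ ^ 24 := by
          gcongr
          calc (32 : ℝ) ≤ 6 ^ 56 := by norm_num
            _ ≤ Λ ^ 56 := by gcongr
      _ = Λ ^ 80 := by ring
  have h10 : 0 < (q : ℝ) ^ 2 * (m * d) := by positivity
  nlinarith

/-- The long-tuple branch of the perceptron alternative contradicts the absence of heavy
directions. -/
lemma not_long_tuple {n d m C q : ℕ} {Λ : ℝ} (hΛ : 6 ≤ Λ) (hC : (C : ℝ) ≤ Λ ^ 6)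
    (hd : 0 < d) (u : Fin n → F) (s : ℕ) (T : Finset (Fin n)) (hs : 0 < s) (hT : T.Nonempty)
    (hTm : T.card ≤ m) {σ : ℝ} (hσ : |σ| ≤ 1) (hq : 0 < q) (hqs : s ≤ 2 * C * q) (hqm : q ≤ m)
    (Q : Fin q → Fin n) (hQ : ∀ a, Q a ∈ T)
    (hM : ∑ j ∈ T, (∑ a, if Q a = j then (1 : ℝ) else 0) ^ 2 ≤ 4 * q + 2 * q ^ 2 / T.card)
    (v : F) (hv : ‖v‖ ^ 2 ≤ q * (normCap Λ d + 2 * percLevel Λ d q))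
    (hG : ∑ j ∈ T with Λ ^ 4 * ‖v‖ < |inner ℝ (u j) v|, inner ℝ (u j) v ^ 2
      ≤ Λ ^ 5 * q * ‖v‖ ^ 2)
    (hcorr : q * corrLevel Λ d m s T.card q ≤ σ * inner ℝ v (∑ a, u (Q a))) : False := by
  have hΛ0 : 0 < Λ := by linarith
  have hs' : (0 : ℝ) < s := by exact_mod_cast hs
  have ht : (0 : ℝ) < T.card := by exact_mod_cast hT.card_pos
  have htm : (T.card : ℝ) ≤ m := by exact_mod_cast hTm
  have hm : (0 : ℝ) < m := lt_of_lt_of_le ht htm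
  have hd' : (0 : ℝ) < d := by exact_mod_cast hd
  have hq' : (0 : ℝ) < q := by exact_mod_cast hq
  have hqm' : (q : ℝ) ≤ m := by exact_mod_cast hqm
  have hR : 0 < corrScale d m := corrScale_pos (by exact_mod_cast hm)
  -- The correlation of `v` with the tuple is bounded below by hypothesis and above through the
  -- absence of heavy correlations. After squaring, the powers of `Λ` clash: `Λ ^ 80` against a
  -- multiple of `Λ ^ 24`.
  have h1 := hcorr.trans (tuple_correlation_le u T Q hQ v hσ hM hG (by positivity))
  set x : ℝ := m / T.card with hx
  have hx1 : 1 ≤ x := (one_le_div ht).mpr htm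
  have h2 : √(4 * q + 2 * q ^ 2 / T.card) * √(Λ ^ 5 * q * ‖v‖ ^ 2)
      ≤ q * (Λ ^ 3 * √x * ‖v‖) := by
    rw [← Real.sqrt_mul (by positivity)]
    refine Real.sqrt_le_iff.mpr ⟨by positivity, ?_⟩
    have h3 : 4 * q + 2 * (q : ℝ) ^ 2 / T.card ≤ 6 * q * x := by
      have : 2 * (q : ℝ) ^ 2 / T.card ≤ 2 * q * x := by
        rw [hx, ← mul_div_assoc]
        refine div_le_div_of_nonneg_right ?_ ht.le
        nlinarith
      nlinarith
    calc (4 * q + 2 * (q : ℝ) ^ 2 / T.card) * (Λ ^ 5 * q * ‖v‖ ^ 2)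
        ≤ (6 * q * x) * (Λ ^ 5 * q * ‖v‖ ^ 2) := by gcongr
      _ = 6 * (Λ ^ 5 * q ^ 2 * x * ‖v‖ ^ 2) := by ring
      _ ≤ Λ * (Λ ^ 5 * q ^ 2 * x * ‖v‖ ^ 2) := by gcongr
      _ = (q * (Λ ^ 3 * √x * ‖v‖)) ^ 2 := by
          rw [mul_pow, mul_pow, mul_pow, Real.sq_sqrt (by positivity)]; ring
  have h3 : corrLevel Λ d m s T.card q ≤ 2 * Λ ^ 4 * √x * ‖v‖ := by
    refine le_of_mul_le_mul_left (le_trans h1 ?_) hq'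
    have h4 : 1 ≤ √x := Real.one_le_sqrt.mpr hx1
    have h5 : (q : ℝ) * (Λ ^ 4 * ‖v‖) ≤ q * (Λ ^ 4 * √x * ‖v‖) := by
      have : Λ ^ 4 ≤ Λ ^ 4 * √x := le_mul_of_one_le_right (by positivity) h4
      gcongr
    have h6 : (q : ℝ) * (Λ ^ 3 * √x * ‖v‖) ≤ q * (Λ ^ 4 * √x * ‖v‖) := by
      have : Λ ^ 3 ≤ Λ ^ 4 := pow_le_pow_right₀ (by linarith) (by norm_num)
      gcongr
    calc _ ≤ (q : ℝ) * (Λ ^ 4 * √x * ‖v‖) + q * (Λ ^ 4 * √x * ‖v‖) := by linarith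
      _ = _ := by ring
  have h4 : ‖v‖ ^ 2 ≤ q * (20 * Λ ^ 8 * (d + m)) :=
    hv.trans (mul_le_mul_of_nonneg_left (normCap_add_percLevel_le hΛ0 hqm) hq'.le)
  have h5 : corrLevel Λ d m s T.card q ^ 2 * (4 * Λ ^ 2 * (s * T.card))
      = q ^ 2 * (Λ ^ 80 * corrScale d m ^ 2) := by
    unfold corrLevel
    rw [div_pow, mul_pow (2 * Λ), Real.sq_sqrt (by positivity)]
    field_simp
    ring
  have h6 : corrLevel Λ d m s T.card q ^ 2 ≤ 4 * Λ ^ 8 * x * (q * (20 * Λ ^ 8 * (d + m))) := by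
    have h0 : 0 ≤ corrLevel Λ d m s T.card q := by unfold corrLevel; positivity
    calc corrLevel Λ d m s T.card q ^ 2 ≤ (2 * Λ ^ 4 * √x * ‖v‖) ^ 2 := pow_le_pow_left₀ h0 h3 2
      _ = 4 * Λ ^ 8 * x * ‖v‖ ^ 2 := by
          rw [mul_pow, mul_pow, Real.sq_sqrt (by positivity)]; ring
      _ ≤ _ := by gcongr
  have h7 : (s : ℝ) ≤ 2 * Λ ^ 6 * q := by
    calc (s : ℝ) ≤ 2 * C * q := by exact_mod_cast hqs
      _ ≤ 2 * Λ ^ 6 * q := by gcongr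
  have h8 : (q : ℝ) ^ 2 * (Λ ^ 80 * corrScale d m ^ 2)
      ≤ 640 * Λ ^ 24 * (q ^ 2 * (m * (d + m))) := by
    rw [← h5]
    calc corrLevel Λ d m s T.card q ^ 2 * (4 * Λ ^ 2 * (s * T.card))
        ≤ (4 * Λ ^ 8 * x * (q * (20 * Λ ^ 8 * (d + m)))) *
          (4 * Λ ^ 2 * ((2 * Λ ^ 6 * q) * T.card)) := by gcongr
      _ = 640 * Λ ^ 24 * (q ^ 2 * ((x * T.card) * (d + m))) := by ring
      _ = _ := by rw [hx, div_mul_cancel₀ _ ht.ne']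
  have h9 : (q : ℝ) ^ 2 * (Λ ^ 80 * corrScale d m ^ 2)
      ≤ 1280 * Λ ^ 24 * (q ^ 2 * corrScale d m ^ 2) := by
    refine h8.trans ?_
    calc 640 * Λ ^ 24 * ((q : ℝ) ^ 2 * (m * (d + m)))
        ≤ 640 * Λ ^ 24 * (q ^ 2 * (2 * corrScale d m ^ 2)) := by
          have := le_corrScale_sq d m
          have h0 : 0 ≤ 640 * Λ ^ 24 * (q : ℝ) ^ 2 := by positivity
          nlinarith
      _ = _ := by ring
  have h10 : 1280 * Λ ^ 24 < Λ ^ 80 := by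
    calc 1280 * Λ ^ 24 < Λ ^ 56 * Λ ^ 24 := by
          gcongr
          calc (1280 : ℝ) < 6 ^ 56 := by norm_num
            _ ≤ Λ ^ 56 := by gcongr
      _ = Λ ^ 80 := by ring
  have h11 : 0 < (q : ℝ) ^ 2 * corrScale d m ^ 2 := by positivity
  nlinarith

/-- Points without heavy directions that look like the pool have small cross correlations. -/
theorem cross_corr_le {n d m C : ℕ} {Λ : ℝ} (hΛ : 6 ≤ Λ) (hC5 : Λ ^ 5 ≤ C) (hC : (C : ℝ) ≤ Λ ^ 6)
    (hd : 0 < d) (hmn : m ≤ n) (hharm : ∀ k ≤ n, (harmonic k : ℝ) ≤ Λ)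
    (u v : Fin n → F) (J U V : Finset (Fin n)) (hJU : J ⊆ U)
    (hV : ∀ i ∈ V, ‖v i‖ ^ 2 ≤ normCap Λ d)
    (hpair : ∀ i ∈ J, ∀ j ∈ J, i ≠ j → |inner ℝ (u i) (u j)| ≤ Λ ^ 8 * √d)
    (hheavy : NoHeavyDirection Λ n J u v) (halike : AlikeHalfspaces Λ d m C n U V u v)
    (S T : Finset (Fin n)) (hSJ : S ⊆ J) (hTJ : T ⊆ J) (hST : Disjoint S T)
    (hSm : S.card ≤ m) (hTm : T.card ≤ m) :
    |inner ℝ (∑ i ∈ S, u i) (∑ i ∈ T, u i)|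
      ≤ Λ ^ 40 * corrScale d m * √((S.card : ℝ) * T.card) := by
  classical
  by_contra hcon
  push Not at hcon
  have hΛ0 : 0 < Λ := by linarith
  have hSne : S.Nonempty := by
    rw [Finset.nonempty_iff_ne_empty]; rintro rfl; simp at hcon
  have hTne : T.Nonempty := by
    rw [Finset.nonempty_iff_ne_empty]; rintro rfl; simp at hcon
  have hm : 0 < m := lt_of_lt_of_le hSne.card_pos hSm
  have hR : 0 < Λ ^ 40 * corrScale d m := mul_pos (by positivity) (corrScale_pos hm)
  obtain ⟨σ, hσ, hσin⟩ : ∃ σ : ℝ, (σ = 1 ∨ σ = -1) ∧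
      Λ ^ 40 * corrScale d m * √((S.card : ℝ) * T.card)
        ≤ σ * inner ℝ (∑ i ∈ S, u i) (∑ i ∈ T, u i) := by
    rcases abs_cases (inner ℝ (∑ i ∈ S, u i) (∑ i ∈ T, u i)) with h | h
    · exact ⟨1, Or.inl rfl, by rw [one_mul, ← h.1]; exact hcon.le⟩
    · exact ⟨-1, Or.inr rfl, by rw [neg_one_mul, ← h.1]; exact hcon.le⟩
  have hσabs : |σ| ≤ 1 := by rcases hσ with rfl | rfl <;> simp
  have hσsq : σ ^ 2 = 1 := by rcases hσ with rfl | rfl <;> simp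
  obtain ⟨S', hS'S, hS'ne, hlev⟩ :=
    exists_uniformly_correlated hΛ0 hharm u S T hR hSne hTne hσin
  have hS'J : S' ⊆ J := hS'S.trans hSJ
  have hS'T : Disjoint S' T := Finset.disjoint_of_subset_left hS'S hST
  have hCs : C ≤ S'.card := level_card_large hΛ hC hd u S' T hS'T hS'ne hTne hTm hσabs
    (fun i hi j hj => hpair i (hS'J hi) j (hTJ hj)) hlev
  have hC4 : 4 < C := by
    have : (4 : ℝ) < C := by
      calc (4 : ℝ) < 6 ^ 5 := by norm_num
        _ ≤ Λ ^ 5 := by gcongr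
        _ ≤ C := hC5
    exact_mod_cast this
  set s := S'.card with hs
  have hsn : s ≤ n := by simpa using Finset.card_le_univ S'
  have hsm : s ≤ m := (Finset.card_le_card hS'S).trans hSm
  set q := s / C with hq
  have hq0 : 0 < q := Nat.div_pos hCs (by omega)
  have hqCs : q * C ≤ s := Nat.div_mul_le_self s C
  have hqs : s ≤ 2 * C * q := by
    have := Nat.lt_div_mul_add (a := s) (b := C) (by omega)
    have h2 : C ≤ C * q := Nat.le_mul_of_pos_right C hq0
    rw [← hq] at this
    nlinarith
  have hqle : q ≤ s := Nat.div_le_self _ _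
  obtain ⟨Q, hQT, hQw, hQM⟩ := exists_sparse_tuple u S' T hS'ne hTne
    (c := Λ ^ 8 * √d) (by have : (0 : ℝ) < d := by exact_mod_cast hd
                          positivity)
    (fun i hi j hj => hpair i (hS'J hi) j (hTJ hj)
      (fun h => Finset.disjoint_left.mp hS'T hi (h ▸ hj))) q
  set w := ∑ a, u (Q a) with hw
  have hhalf := sparse_tuple_correlated hΛ hC hd u S' T hS'ne hTne hTm hσsq hq0 hqs hlev w hQw
  set h := corrLevel Λ d m s T.card q with hh
  set θ := percLevel Λ d q with hθ
  have hθ0 : 0 < θ := percLevel_pos hΛ0 hq0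
  -- The perceptron runs on the pool points correlated with `w`. A full run gives a short pool sum
  -- correlated with `w`, excluded by `not_long_tuple`. An early stop gives `x` such that no point
  -- of `V` is beyond level `h` for `w` and below `θ` for `x`.
  rcases perceptron_alternative v (V.filter fun i => h ≤ σ * inner ℝ (v i) w)
    (D := normCap Λ d) (θ := θ) (fun i hi => hV i (Finset.mem_filter.mp hi).1) q with
    ⟨Q', hQ'V, hQ'n⟩ | ⟨k, hk, Q', hQ'V, hQ'n, hQ'all⟩
  · refine not_long_tuple hΛ hC hd u s T hS'ne.card_pos hTne hTm hσabs hq0 hqs (hqle.trans hsm) Q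
      hQT hQM (∑ a, v (Q' a)) hQ'n ?_ ?_
    · refine le_trans (Finset.sum_le_sum_of_subset_of_nonneg ?_ fun _ _ _ => sq_nonneg _)
        (hheavy q (hqle.trans hsn) Q')
      exact Finset.filter_subset_filter _ hTJ
    · rw [sum_inner, Finset.mul_sum]
      have : (q : ℝ) * h = ∑ _a : Fin q, h := by simp
      rw [this]
      exact Finset.sum_le_sum fun a _ => (Finset.mem_filter.mp (hQ'V a)).2
  · have hlt := halike s T.card hsn (hTm.trans hmn) σ hσ k hk Q Q'
      (fun a => hJU (hTJ (hQT a))) (fun a => (Finset.mem_filter.mp (hQ'V a)).1)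
      (fun i hi hi2 => hQ'all i (Finset.mem_filter.mpr ⟨hi, hi2⟩))
    set x := ∑ a, v (Q' a) with hx
    set X := S'.filter fun i => h ≤ σ * inner ℝ (u i) w with hX
    have hsplit := Finset.card_filter_add_card_filter_not (s := X)
      (fun i => inner ℝ (u i) x < θ)
    have hsub : (X.filter fun i => inner ℝ (u i) x < θ).card
        ≤ (U.filter fun i => h ≤ σ * inner ℝ (u i) w ∧ inner ℝ (u i) x < θ).card := by
      refine Finset.card_le_card fun i hi => ?_
      simp only [hX, Finset.mem_filter] at hi ⊢
      exact ⟨hJU (hS'J hi.1.1), hi.1.2, hi.2⟩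
    -- Points of `J` whose inner product with `x` reaches `θ` are heavy along `x`, and the bound on
    -- heavy directions leaves room for at most `q` of them.
    have hfew : (X.filter fun i => ¬ inner ℝ (u i) x < θ).card ≤ q := by
      have hkq : (k : ℝ) ≤ q := by exact_mod_cast hk.le
      have hxθ : (Λ ^ 4 * ‖x‖) ^ 2 < θ ^ 2 := by
        refine lt_of_le_of_lt ?_ (normCap_add_percLevel_lt hΛ0 (d := d) hq0)
        rw [mul_pow]
        gcongr
        refine hQ'n.trans ?_
        have : 0 ≤ normCap Λ d := by unfold normCap; positivity
        gcongr
      have hxθ' : Λ ^ 4 * ‖x‖ < θ := lt_of_pow_lt_pow_left₀ 2 hθ0.le hxθ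
      have h1 : ((X.filter fun i => ¬ inner ℝ (u i) x < θ).card : ℝ) * θ ^ 2
          ≤ Λ ^ 5 * k * ‖x‖ ^ 2 := by
        refine le_trans ?_ (hheavy k ((hk.le.trans hqle).trans hsn) Q')
        rw [← nsmul_eq_mul, ← Finset.sum_const]
        refine le_trans (Finset.sum_le_sum (g := fun i => inner ℝ (u i) x ^ 2) fun i hi => ?_)
          (Finset.sum_le_sum_of_subset_of_nonneg (fun i hi => ?_) fun _ _ _ => sq_nonneg _)
        · have := (Finset.mem_filter.mp hi).2
          push Not at this
          exact pow_le_pow_left₀ hθ0.le this 2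
        · simp only [hX, Finset.mem_filter, not_lt] at hi ⊢
          exact ⟨hS'J hi.1.1, lt_of_lt_of_le hxθ' (hi.2.trans (le_abs_self _))⟩
      have h2 : Λ ^ 5 * k * ‖x‖ ^ 2 ≤ q * θ ^ 2 := by
        have h3 : Λ ^ 5 * ‖x‖ ^ 2 ≤ θ ^ 2 := by
          refine le_trans ?_ hxθ.le
          rw [mul_pow, ← pow_mul]
          have : Λ ^ 5 ≤ Λ ^ (4 * 2) := pow_le_pow_right₀ (by linarith) (by norm_num)
          gcongr
        calc Λ ^ 5 * k * ‖x‖ ^ 2 = k * (Λ ^ 5 * ‖x‖ ^ 2) := by ring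
          _ ≤ q * θ ^ 2 := by gcongr
      have h3 := le_of_mul_le_mul_right (h1.trans h2) (by positivity)
      exact_mod_cast h3
    -- At least half of `S'` correlates with `w`; fewer than `s / 4` of these points lie below `θ`
    -- for `x`, and at most `q ≤ s / 4` lie above.
    have hhalf' : s ≤ 2 * X.card := by exact_mod_cast hhalf
    have : 4 * q ≤ s := by nlinarith
    change 4 * (U.filter fun i => h ≤ σ * inner ℝ (u i) w ∧ inner ℝ (u i) x < θ).card < s at hlt
    omega

end

end

/-! ### Friendliness of a mixture of structured and generic points. -/

section

section

variable {F : Type*} [NormedAddCommGroup F] [InnerProductSpace ℝ F]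

lemma corrScale_le (d m : ℕ) : corrScale d m ≤ d + m := by
  refine max_le ?_ (by linarith [show (0 : ℝ) ≤ d by positivity])
  refine Real.sqrt_le_iff.mpr ⟨by positivity, ?_⟩
  nlinarith [show (0 : ℝ) ≤ d by positivity, show (0 : ℝ) ≤ m by positivity]

/-- The points outside `J` are split off from `S` and then from `T`. Their sums correlate with a
disjoint sum in proportion to its norm, which `X` controls; only the parts inside `J` need the bound
`b`. -/
lemma mixed_cross_le {n m : ℕ} {a b X : ℝ} (ha : 0 ≤ a) (x : Fin n → F) (J : Finset (Fin n))
    (hlin : ∀ U T : Finset (Fin n), Disjoint U J → Disjoint U T → U.card ≤ m → T.card ≤ m →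
      |inner ℝ (∑ i ∈ U, x i) (∑ i ∈ T, x i)| ≤ a * √U.card * ‖∑ i ∈ T, x i‖)
    (hJ : ∀ S T : Finset (Fin n), S ⊆ J → T ⊆ J → Disjoint S T → S.card ≤ m → T.card ≤ m →
      |inner ℝ (∑ i ∈ S, x i) (∑ i ∈ T, x i)| ≤ b * √((S.card : ℝ) * T.card)) (hb : 0 ≤ b)
    (hX : ∀ T : Finset (Fin n), T.card ≤ m → ‖∑ i ∈ T, x i‖ ≤ X * √T.card)
    (S T : Finset (Fin n)) (hST : Disjoint S T) (hS : S.card ≤ m) (hT : T.card ≤ m) :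
    |inner ℝ (∑ i ∈ S, x i) (∑ i ∈ T, x i)| ≤ (2 * a * X + b) * √((S.card : ℝ) * T.card) := by
  classical
  have hX0 : ∀ U ⊆ S, ‖∑ i ∈ U, x i‖ ≤ X * √U.card := fun U hU =>
    hX U ((Finset.card_le_card hU).trans hS)
  have hX0T : ∀ U ⊆ T, ‖∑ i ∈ U, x i‖ ≤ X * √U.card := fun U hU =>
    hX U ((Finset.card_le_card hU).trans hT)
  rcases S.eq_empty_or_nonempty with rfl | hSne
  · simp
  have hXn : 0 ≤ X := by
    have h1 := (norm_nonneg _).trans (hX S hS)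
    have h2 : 0 < √(S.card : ℝ) := Real.sqrt_pos.mpr (by exact_mod_cast hSne.card_pos)
    exact nonneg_of_mul_nonneg_left h1 h2
  have hSs : ∑ i ∈ S, x i = ∑ i ∈ S \ J, x i + ∑ i ∈ S ∩ J, x i := by
    rw [← Finset.sdiff_inter_self_left]; exact (Finset.sum_sdiff Finset.inter_subset_left).symm
  have hTs : ∑ i ∈ T, x i = ∑ i ∈ T \ J, x i + ∑ i ∈ T ∩ J, x i := by
    rw [← Finset.sdiff_inter_self_left]; exact (Finset.sum_sdiff Finset.inter_subset_left).symm
  have hcS : √((S \ J).card : ℝ) ≤ √S.card :=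
    Real.sqrt_le_sqrt (by exact_mod_cast Finset.card_le_card Finset.sdiff_subset)
  have hcS' : √((S ∩ J).card : ℝ) ≤ √S.card :=
    Real.sqrt_le_sqrt (by exact_mod_cast Finset.card_le_card Finset.inter_subset_left)
  have hcT : √((T \ J).card : ℝ) ≤ √T.card :=
    Real.sqrt_le_sqrt (by exact_mod_cast Finset.card_le_card Finset.sdiff_subset)
  have hcT' : √((T ∩ J).card : ℝ) ≤ √T.card :=
    Real.sqrt_le_sqrt (by exact_mod_cast Finset.card_le_card Finset.inter_subset_left)
  have h1 := hlin (S \ J) T Finset.sdiff_disjoint (Finset.disjoint_of_subset_left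
    Finset.sdiff_subset hST) ((Finset.card_le_card Finset.sdiff_subset).trans hS) hT
  have h2 := hlin (T \ J) (S ∩ J) Finset.sdiff_disjoint (Finset.disjoint_of_subset_left
    Finset.sdiff_subset (Finset.disjoint_of_subset_right Finset.inter_subset_left hST.symm))
    ((Finset.card_le_card Finset.sdiff_subset).trans hT)
    ((Finset.card_le_card Finset.inter_subset_left).trans hS)
  have h3 := hJ (S ∩ J) (T ∩ J) Finset.inter_subset_right Finset.inter_subset_right
    (Finset.disjoint_of_subset_left Finset.inter_subset_left
      (Finset.disjoint_of_subset_right Finset.inter_subset_left hST))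
    ((Finset.card_le_card Finset.inter_subset_left).trans hS)
    ((Finset.card_le_card Finset.inter_subset_left).trans hT)
  have hexp : inner ℝ (∑ i ∈ S, x i) (∑ i ∈ T, x i)
      = inner ℝ (∑ i ∈ S \ J, x i) (∑ i ∈ T, x i)
        + inner ℝ (∑ i ∈ T \ J, x i) (∑ i ∈ S ∩ J, x i)
        + inner ℝ (∑ i ∈ S ∩ J, x i) (∑ i ∈ T ∩ J, x i) := by
    conv_lhs => rw [hSs, inner_add_left]
    conv_lhs => rw [hTs, inner_add_right (∑ i ∈ S ∩ J, x i), ← hTs]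
    rw [real_inner_comm (∑ i ∈ T \ J, x i)]
    ring
  rw [hexp]
  have hmul : √((S.card : ℝ) * T.card) = √S.card * √T.card := Real.sqrt_mul (by positivity) _
  have h3' : b * √(((S ∩ J).card : ℝ) * (T ∩ J).card) ≤ b * (√S.card * √T.card) := by
    rw [Real.sqrt_mul (by positivity)]
    gcongr
  have h1' : a * √(S \ J).card * ‖∑ i ∈ T, x i‖ ≤ a * √S.card * (X * √T.card) := by
    gcongr
    exact hX T hT
  have h2' : a * √(T \ J).card * ‖∑ i ∈ S ∩ J, x i‖ ≤ a * √T.card * (X * √S.card) := by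
    gcongr
    exact (hX0 _ Finset.inter_subset_left).trans (by gcongr)
  calc _ ≤ |inner ℝ (∑ i ∈ S \ J, x i) (∑ i ∈ T, x i)|
        + |inner ℝ (∑ i ∈ T \ J, x i) (∑ i ∈ S ∩ J, x i)|
        + |inner ℝ (∑ i ∈ S ∩ J, x i) (∑ i ∈ T ∩ J, x i)| := abs_add_three _ _ _
    _ ≤ a * √S.card * (X * √T.card) + a * √T.card * (X * √S.card)
        + b * (√S.card * √T.card) := by linarith
    _ = _ := by rw [hmul]; ring

/-- A bootstrap: let `X` be the largest norm of a sum over at most `m` points, divided by the root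
of their number. A cut turns the off-diagonal part of the squared norm into a cross term, which
`mixed_cross_le` bounds in terms of `X` itself. The outcome `X² ≤ c + 4aX + 2b` is solved with `(X -
4a)² ≥ 0`. -/
lemma mixed_sum_norm_le {n m : ℕ} {a b c : ℝ} (ha : 0 ≤ a) (hb : 0 ≤ b)
    (x : Fin n → F) (J : Finset (Fin n)) (hx : ∀ i, ‖x i‖ ^ 2 ≤ c)
    (hlin : ∀ U T : Finset (Fin n), Disjoint U J → Disjoint U T → U.card ≤ m → T.card ≤ m →
      |inner ℝ (∑ i ∈ U, x i) (∑ i ∈ T, x i)| ≤ a * √U.card * ‖∑ i ∈ T, x i‖)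
    (hJ : ∀ S T : Finset (Fin n), S ⊆ J → T ⊆ J → Disjoint S T → S.card ≤ m → T.card ≤ m →
      |inner ℝ (∑ i ∈ S, x i) (∑ i ∈ T, x i)| ≤ b * √((S.card : ℝ) * T.card))
    (T : Finset (Fin n)) (hT : T.card ≤ m) :
    ‖∑ i ∈ T, x i‖ ≤ √(2 * c + 16 * a ^ 2 + 4 * b) * √T.card := by
  classical
  rcases T.eq_empty_or_nonempty with rfl | hTne
  · simp
  set 𝒯 : Finset (Finset (Fin n)) :=
    Finset.univ.filter fun U => U.Nonempty ∧ U.card ≤ m with h𝒯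
  obtain ⟨T₀, hT₀, hmax⟩ := Finset.exists_max_image 𝒯 (fun U => ‖∑ i ∈ U, x i‖ / √U.card)
    ⟨T, by simp [h𝒯, hTne, hT]⟩
  simp only [h𝒯, Finset.mem_filter, Finset.mem_univ, true_and] at hT₀ hmax
  set X := ‖∑ i ∈ T₀, x i‖ / √T₀.card with hXd
  have hX0 : 0 ≤ X := by positivity
  have hXall : ∀ U : Finset (Fin n), U.card ≤ m → ‖∑ i ∈ U, x i‖ ≤ X * √U.card := by
    intro U hU
    rcases U.eq_empty_or_nonempty with rfl | hUne
    · simp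
    have h2 : 0 < √(U.card : ℝ) := Real.sqrt_pos.mpr (by exact_mod_cast hUne.card_pos)
    exact (div_le_iff₀ h2).mp (hmax U ⟨hUne, hU⟩)
  have ht₀ : (0 : ℝ) < T₀.card := by exact_mod_cast hT₀.1.card_pos
  obtain ⟨U, hU, hcut⟩ := exists_cut x T₀
  have h1 := mixed_cross_le ha x J hlin hJ hb hXall U (T₀ \ U) Finset.disjoint_sdiff
    ((Finset.card_le_card hU).trans hT₀.2)
    ((Finset.card_le_card Finset.sdiff_subset).trans hT₀.2)
  have h2 : √((U.card : ℝ) * (T₀ \ U).card) ≤ T₀.card / 2 := by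
    refine Real.sqrt_le_iff.mpr ⟨by positivity, ?_⟩
    have : (T₀.card : ℝ) = (T₀ \ U).card + U.card := by
      exact_mod_cast (Finset.card_sdiff_add_card_eq_card hU).symm
    rw [this]
    nlinarith [sq_nonneg ((U.card : ℝ) - (T₀ \ U).card)]
  have h3 : ‖∑ i ∈ T₀, x i‖ ^ 2 = X ^ 2 * T₀.card := by
    rw [hXd, div_pow, Real.sq_sqrt ht₀.le, div_mul_cancel₀ _ ht₀.ne']
  have h4 : ∑ i ∈ T₀, ‖x i‖ ^ 2 ≤ T₀.card * c := by
    rw [← nsmul_eq_mul, ← Finset.sum_const]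
    exact Finset.sum_le_sum fun i _ => hx i
  have h5 : X ^ 2 * T₀.card ≤ T₀.card * c + 4 * ((2 * a * X + b) * (T₀.card / 2)) := by
    have h6 := (le_abs_self _).trans h1
    have h7 : (2 * a * X + b) * √((U.card : ℝ) * (T₀ \ U).card)
        ≤ (2 * a * X + b) * (T₀.card / 2) := mul_le_mul_of_nonneg_left h2 (by positivity)
    linarith
  have h6 : X ^ 2 ≤ c + 2 * (2 * a * X + b) := by
    refine le_of_mul_le_mul_right ?_ ht₀
    linarith
  have h7 : X ≤ √(2 * c + 16 * a ^ 2 + 4 * b) := by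
    refine Real.le_sqrt_of_sq_le ?_
    nlinarith [sq_nonneg (X - 4 * a)]
  exact (hXall T hT).trans (by gcongr)

end

/-- Deterministic criterion for friendliness of a dataset with structured points (indexed by `J`)
and generic points. -/
theorem isFriendly_of_mixed {n d m : ℕ} {Λ ε : ℝ} (hΛ : 6 ≤ Λ) (hε : ε * n = m) (hd : 0 < d)
    (x : Fin n → E d) (J : Finset (Fin n))
    (hnorm : ∀ i, |‖x i‖ ^ 2 - d| ≤ Λ ^ 8 * √d)
    (hpair : ∀ i j, i ≠ j → |inner ℝ (x i) (x j)| ≤ Λ ^ 8 * √d)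
    (hlin : ∀ U T : Finset (Fin n), Disjoint U J → Disjoint U T → U.card ≤ m → T.card ≤ m →
      |inner ℝ (∑ i ∈ U, x i) (∑ i ∈ T, x i)| ≤ Λ ^ 2 * √m * √U.card * ‖∑ i ∈ T, x i‖)
    (hJ : ∀ S T : Finset (Fin n), S ⊆ J → T ⊆ J → Disjoint S T → S.card ≤ m → T.card ≤ m →
      |inner ℝ (∑ i ∈ S, x i) (∑ i ∈ T, x i)|
        ≤ Λ ^ 40 * corrScale d m * √((S.card : ℝ) * T.card)) :
    IsFriendly (Λ ^ 2000) ε x := by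
  have hΛ0 : 0 < Λ := by linarith
  have hd1 : (1 : ℝ) ≤ d := by exact_mod_cast hd
  have hpow : Λ ^ 8 ≤ Λ ^ 2000 := pow_le_pow_right₀ (by linarith) (by norm_num)
  have hR0 : 0 ≤ corrScale d m := (Nat.cast_nonneg _).trans (le_max_right _ _)
  have hc : ∀ i, ‖x i‖ ^ 2 ≤ 2 * Λ ^ 8 * d := by
    intro i
    have h1 := (abs_le.mp (hnorm i)).2
    have h2 : √(d : ℝ) ≤ d := by
      rw [Real.sqrt_le_iff]; exact ⟨by positivity, by nlinarith⟩
    have h3 : (1 : ℝ) ≤ Λ ^ 8 := one_le_pow₀ (by linarith)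
    nlinarith [mul_le_mul_of_nonneg_left h2 (show 0 ≤ Λ ^ 8 by positivity)]
  refine ⟨fun S T hST hS hT => ?_, fun i j hij => (hpair i j hij).trans (by gcongr),
    fun i => (hnorm i).trans (by gcongr)⟩
  have hSm : S.card ≤ m := by rw [hε] at hS; exact_mod_cast hS
  have hTm : T.card ≤ m := by rw [hε] at hT; exact_mod_cast hT
  have h1 := mixed_cross_le (a := Λ ^ 2 * √m) (by positivity) x J hlin hJ (by positivity)
    (mixed_sum_norm_le (by positivity) (by positivity) x J hc hlin hJ)
    S T hST hSm hTm
  rw [hε]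
  refine h1.trans ?_
  change _ ≤ Λ ^ 2000 * (√((S.card : ℝ) * T.card) * corrScale d m)
  have h2 : √(m : ℝ) * √(2 * (2 * Λ ^ 8 * d) + 16 * (Λ ^ 2 * √m) ^ 2
      + 4 * (Λ ^ 40 * corrScale d m)) ≤ Λ ^ 22 * corrScale d m := by
    rw [← Real.sqrt_mul (by positivity)]
    refine Real.sqrt_le_iff.mpr ⟨by positivity, ?_⟩
    have h3 := le_corrScale_sq d m
    have h4 := corrScale_le d m
    have e1 : Λ ^ 8 ≤ Λ ^ 40 := pow_le_pow_right₀ (by linarith) (by norm_num)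
    have e2 : Λ ^ 4 ≤ Λ ^ 40 := pow_le_pow_right₀ (by linarith) (by norm_num)
    have h5 : 2 * (2 * Λ ^ 8 * d) + 16 * (Λ ^ 2 * √m) ^ 2 + 4 * (Λ ^ 40 * corrScale d m)
        ≤ 20 * Λ ^ 40 * (d + m) := by
      rw [mul_pow, Real.sq_sqrt (by positivity)]
      have f1 : Λ ^ 8 * (d : ℝ) ≤ Λ ^ 40 * d := by gcongr
      have f2 : (Λ ^ 2) ^ 2 * (m : ℝ) ≤ Λ ^ 40 * m := by rw [← pow_mul]; gcongr
      have f3 : Λ ^ 40 * corrScale d m ≤ Λ ^ 40 * (d + m) := by gcongr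
      have f4 : 0 ≤ Λ ^ 40 * (d : ℝ) := by positivity
      linarith
    have e3 : 40 * Λ ^ 40 ≤ Λ ^ 44 := by
      calc 40 * Λ ^ 40 ≤ Λ ^ 4 * Λ ^ 40 := by
            gcongr
            calc (40 : ℝ) ≤ 6 ^ 4 := by norm_num
              _ ≤ Λ ^ 4 := by gcongr
        _ = Λ ^ 44 := by ring
    calc (m : ℝ) * (2 * (2 * Λ ^ 8 * d) + 16 * (Λ ^ 2 * √m) ^ 2 + 4 * (Λ ^ 40 * corrScale d m))
        ≤ m * (20 * Λ ^ 40 * (d + m)) := by gcongr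
      _ = 20 * Λ ^ 40 * (m * (d + m)) := by ring
      _ ≤ 20 * Λ ^ 40 * (2 * corrScale d m ^ 2) := by
          exact mul_le_mul_of_nonneg_left h3 (by positivity)
      _ = 40 * Λ ^ 40 * corrScale d m ^ 2 := by ring
      _ ≤ Λ ^ 44 * corrScale d m ^ 2 := by gcongr
      _ = _ := by ring
  have e4 : 2 * Λ ^ 24 + Λ ^ 40 ≤ Λ ^ 2000 := by
    calc 2 * Λ ^ 24 + Λ ^ 40 ≤ Λ ^ 40 + Λ ^ 40 := by
          have : 2 * Λ ^ 24 ≤ Λ ^ 16 * Λ ^ 24 := by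
            gcongr
            calc (2 : ℝ) ≤ 6 ^ 16 := by norm_num
              _ ≤ Λ ^ 16 := by gcongr
          have e : Λ ^ 16 * Λ ^ 24 = Λ ^ 40 := by ring
          linarith
      _ = 2 * Λ ^ 40 := by ring
      _ ≤ Λ * Λ ^ 40 := by gcongr; linarith
      _ = Λ ^ 41 := by ring
      _ ≤ Λ ^ 2000 := pow_le_pow_right₀ (by linarith) (by norm_num)
  calc _ = (2 * Λ ^ 2 * (√(m : ℝ) * √(2 * (2 * Λ ^ 8 * d) + 16 * (Λ ^ 2 * √m) ^ 2
        + 4 * (Λ ^ 40 * corrScale d m))) + Λ ^ 40 * corrScale d m)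
        * √((S.card : ℝ) * T.card) := by ring
    _ ≤ (2 * Λ ^ 2 * (Λ ^ 22 * corrScale d m) + Λ ^ 40 * corrScale d m)
        * √((S.card : ℝ) * T.card) := by gcongr
    _ = (2 * Λ ^ 24 + Λ ^ 40) * (√((S.card : ℝ) * T.card) * corrScale d m) := by ring
    _ ≤ _ := by gcongr

end

/-! ### Product measures and Gaussian tail bounds. -/

section

section Product

variable {ι X : Type*} [Fintype ι] [MeasurableSpace X]

lemma lintegral_pi_prod (ν : Measure X) [IsProbabilityMeasure ν] (f : ι → X → ℝ≥0∞)
    (hf : ∀ i, Measurable (f i)) :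
    ∫⁻ z : ι → X, ∏ i, f i (z i) ∂Measure.pi (fun _ => ν) = ∏ i, ∫⁻ x, f i x ∂ν := by
  have hind : iIndepFun (fun i (z : ι → X) => f i (z i)) (Measure.pi fun _ : ι => ν) :=
    iIndepFun_pi fun i => (hf i).aemeasurable
  rw [lintegral_prod_eq_prod_lintegral_of_indepFun Finset.univ _ hind
    fun i => (hf i).comp (measurable_pi_apply i)]
  refine Finset.prod_congr rfl fun i _ => ?_
  exact (measurePreserving_eval (fun _ : ι => ν) i).lintegral_comp (hf i)

/-- Combining two independent samples coordinatewise. -/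
lemma measurePreserving_mix (ν : Measure X) [IsProbabilityMeasure ν] (p : ι → Prop)
    [DecidablePred p] :
    MeasurePreserving (fun z : (ι → X) × (ι → X) => fun i => if p i then z.1 i else z.2 i)
      ((Measure.pi fun _ => ν).prod (Measure.pi fun _ => ν)) (Measure.pi fun _ => ν) := by
  have hm : Measurable (fun z : (ι → X) × (ι → X) => fun i => if p i then z.1 i else z.2 i) := by
    refine measurable_pi_lambda _ fun i => ?_
    split_ifs
    · exact (measurable_pi_apply i).comp measurable_fst
    · exact (measurable_pi_apply i).comp measurable_snd
  refine ⟨hm, (Measure.pi_eq fun s hs => ?_).symm⟩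
  rw [Measure.map_apply hm (MeasurableSet.univ_pi hs)]
  have : (fun z : (ι → X) × (ι → X) => fun i => if p i then z.1 i else z.2 i) ⁻¹'
      (Set.univ.pi s) = (Set.univ.pi fun i => if p i then s i else Set.univ) ×ˢ
        (Set.univ.pi fun i => if p i then Set.univ else s i) := by
    ext z
    simp only [Set.mem_preimage, Set.mem_pi, Set.mem_univ, true_implies, Set.mem_prod]
    constructor
    · intro h
      refine ⟨fun i => ?_, fun i => ?_⟩ <;> have := h i <;> split_ifs at this ⊢ <;> simp_all
    · rintro ⟨h1, h2⟩ i
      have h1 := h1 i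
      have h2 := h2 i
      split_ifs at h1 h2 ⊢ <;> assumption
  rw [this, Measure.prod_prod, Measure.pi_pi, Measure.pi_pi, ← Finset.prod_mul_distrib]
  refine Finset.prod_congr rfl fun i _ => ?_
  split_ifs <;> simp

end Product

section Gaussian

variable {d : ℕ}

lemma map_inner_stdGaussian (v : E d) :
    (stdGaussian (E d)).map (fun x => inner ℝ x v) = gaussianReal 0 (‖v‖₊ ^ 2) := by
  have h := IsGaussian.map_eq_gaussianReal (μ := stdGaussian (E d)) (innerSL ℝ v)
  rw [variance_dual_stdGaussian] at h
  rw [integral_strongDual_stdGaussian, innerSL_apply_norm] at h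
  have h2 : (‖v‖ ^ 2).toNNReal = ‖v‖₊ ^ 2 := by
    rw [Real.toNNReal_pow (norm_nonneg _), norm_toNNReal]
  rw [h2] at h
  rw [← h]
  congr 1
  ext x
  simp [real_inner_comm]

lemma lintegral_exp_inner (v : E d) (s : ℝ) :
    ∫⁻ x, ENNReal.ofReal (Real.exp (s * inner ℝ x v)) ∂(stdGaussian (E d))
      = ENNReal.ofReal (Real.exp (‖v‖ ^ 2 * s ^ 2 / 2)) := by
  have hmap := map_inner_stdGaussian v
  have hm : Measurable fun x : E d => inner ℝ x v := by fun_prop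
  have h1 : ∫⁻ x, ENNReal.ofReal (Real.exp (s * inner ℝ x v)) ∂(stdGaussian (E d))
      = ∫⁻ r, ENNReal.ofReal (Real.exp (s * r)) ∂(gaussianReal 0 (‖v‖₊ ^ 2)) := by
    rw [← hmap, lintegral_map (by fun_prop) hm]
  rw [h1, ← ofReal_integral_eq_lintegral_ofReal]
  · have := congrFun (mgf_id_gaussianReal (μ := 0) (v := ‖v‖₊ ^ 2)) s
    simp only [mgf, id] at this
    rw [this]
    congr 2
    push_cast
    simp
  · exact integrable_exp_mul_gaussianReal s
  · exact Filter.Eventually.of_forall fun _ => (Real.exp_pos _).le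

lemma lintegral_exp_sq_gaussianReal {s : ℝ} (hs : s < 1 / 2) :
    ∫⁻ x, ENNReal.ofReal (Real.exp (s * x ^ 2)) ∂(gaussianReal 0 1)
      = ENNReal.ofReal (√(1 / (1 - 2 * s))) := by
  have hb : 0 < 1 / 2 - s := by linarith
  rw [gaussianReal_of_var_ne_zero _ one_ne_zero,
    lintegral_withDensity_eq_lintegral_mul _ (measurable_gaussianPDF _ _) (by fun_prop)]
  have h1 : ∀ x : ℝ, (gaussianPDF 0 1 * fun x => ENNReal.ofReal (Real.exp (s * x ^ 2))) x
      = ENNReal.ofReal ((√(2 * Real.pi))⁻¹ * Real.exp (-(1 / 2 - s) * x ^ 2)) := by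
    intro x
    simp only [Pi.mul_apply, gaussianPDF, gaussianPDFReal]
    rw [← ENNReal.ofReal_mul (by positivity)]
    congr 1
    simp only [NNReal.coe_one, mul_one, sub_zero]
    rw [mul_assoc, ← Real.exp_add]
    congr 2
    ring
  rw [lintegral_congr h1, ← ofReal_integral_eq_lintegral_ofReal]
  · rw [integral_const_mul, integral_gaussian, ← Real.sqrt_inv, ← Real.sqrt_mul (by positivity)]
    congr 2
    have := Real.pi_pos
    have h2 : 1 - 2 * s ≠ 0 := by linarith
    field_simp
  · exact (integrable_exp_neg_mul_sq hb).const_mul _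
  · exact Filter.Eventually.of_forall fun _ => by positivity

/-- At `s = 3/8` the moment `1 / √(1 - 2s)` of a squared standard Gaussian equals `2`. The room
between this exponent and the tilt `1/64` is what `lintegral_tilt_excess_le` uses. -/
lemma lintegral_exp_sq_inner {v : E d} (hv : v ≠ 0) :
    ∫⁻ x, ENNReal.ofReal (Real.exp (3 / 8 * (inner ℝ x v / ‖v‖) ^ 2)) ∂(stdGaussian (E d)) = 2 := by
  have hv0 : ‖v‖ ≠ 0 := norm_ne_zero_iff.mpr hv
  have hmap := map_inner_stdGaussian (‖v‖⁻¹ • v)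
  have hm : Measurable fun x : E d => inner ℝ x (‖v‖⁻¹ • v) := by fun_prop
  have h0 : ‖‖v‖⁻¹ • v‖₊ ^ 2 = 1 := by
    rw [nnnorm_smul, nnnorm_inv, nnnorm_norm, inv_mul_cancel₀ (by simpa using hv), one_pow]
  rw [h0] at hmap
  have h1 : ∫⁻ x, ENNReal.ofReal (Real.exp (3 / 8 * (inner ℝ x v / ‖v‖) ^ 2)) ∂(stdGaussian (E d))
      = ∫⁻ r, ENNReal.ofReal (Real.exp (3 / 8 * r ^ 2)) ∂(gaussianReal 0 1) := by
    rw [← hmap, lintegral_map (by fun_prop) hm]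
    refine lintegral_congr fun x => ?_
    rw [real_inner_smul_right, div_eq_inv_mul (inner ℝ x v)]
  rw [h1, lintegral_exp_sq_gaussianReal (by norm_num)]
  have : √(1 / (1 - 2 * (3 / 8 : ℝ))) = 2 := by
    rw [show (1 / (1 - 2 * (3 / 8 : ℝ))) = 2 ^ 2 by norm_num]
    exact Real.sqrt_sq (by norm_num)
  rw [this]; simp

lemma lintegral_exp_sum_inner {ι : Type*} [Fintype ι] [DecidableEq ι] (U : Finset ι) (v : E d)
    (s : ℝ) :
    ∫⁻ z, ENNReal.ofReal (Real.exp (s * inner ℝ (∑ i ∈ U, z i) v))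
      ∂(Measure.pi fun _ : ι => stdGaussian (E d))
      = ENNReal.ofReal (Real.exp (U.card * (‖v‖ ^ 2 * s ^ 2 / 2))) := by
  have h1 : ∀ z : ι → E d, ENNReal.ofReal (Real.exp (s * inner ℝ (∑ i ∈ U, z i) v))
      = ∏ i, (if i ∈ U then ENNReal.ofReal (Real.exp (s * inner ℝ (z i) v)) else 1) := by
    intro z
    rw [sum_inner, Finset.mul_sum, Real.exp_sum, ENNReal.ofReal_prod_of_nonneg
      fun i _ => (Real.exp_pos _).le, Finset.prod_ite_mem, Finset.univ_inter]
  rw [lintegral_congr h1, lintegral_pi_prod (stdGaussian (E d))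
    (fun i x => if i ∈ U then ENNReal.ofReal (Real.exp (s * inner ℝ x v)) else 1)
    (fun i => by split_ifs <;> fun_prop)]
  have h2 : ∀ i, ∫⁻ x, (if i ∈ U then ENNReal.ofReal (Real.exp (s * inner ℝ x v)) else 1)
      ∂(stdGaussian (E d))
      = if i ∈ U then ENNReal.ofReal (Real.exp (‖v‖ ^ 2 * s ^ 2 / 2)) else 1 := by
    intro i
    split_ifs
    · exact lintegral_exp_inner v s
    · simp
  simp only [h2]
  rw [Finset.prod_ite_mem, Finset.univ_inter, Finset.prod_const,
    ← ENNReal.ofReal_pow (Real.exp_pos _).le, ← Real.exp_nat_mul]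

/-- Gaussian tail bound for a sum of independent Gaussian vectors in a fixed direction. -/
lemma measure_sum_inner_gt {ι : Type*} [Fintype ι] (U : Finset ι) (v : E d) {r : ℝ} (hr : 0 ≤ r) :
    (Measure.pi fun _ : ι => stdGaussian (E d))
      {z | r * √U.card * ‖v‖ < |inner ℝ (∑ i ∈ U, z i) v|}
      ≤ ENNReal.ofReal (2 * Real.exp (-r ^ 2 / 2)) := by
  classical
  rcases U.eq_empty_or_nonempty with rfl | hU
  · simp
  rcases eq_or_ne v 0 with rfl | hv
  · simp
  have hu : (0 : ℝ) < U.card := by exact_mod_cast hU.card_pos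
  have hv0 : 0 < ‖v‖ := norm_pos_iff.mpr hv
  set P := Measure.pi fun _ : ι => stdGaussian (E d) with hP
  set c := √(U.card : ℝ) * ‖v‖ with hc
  have hc0 : 0 < c := by positivity
  have hone : ∀ σ : ℝ, σ ^ 2 = 1 →
      P {z | r * c ≤ σ * inner ℝ (∑ i ∈ U, z i) v} ≤ ENNReal.ofReal (Real.exp (-r ^ 2 / 2)) := by
    intro σ hσ
    -- Chernoff's bound: the inner product is Gaussian with standard deviation `c`, so `r / c` is
    -- the optimal parameter.
    have h1 := lintegral_exp_sum_inner U v (σ * (r / c))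
    have h2 : ∀ z ∈ {z : ι → E d | r * c ≤ σ * inner ℝ (∑ i ∈ U, z i) v},
        ENNReal.ofReal (Real.exp (r ^ 2)) ≤
          ENNReal.ofReal (Real.exp (σ * (r / c) * inner ℝ (∑ i ∈ U, z i) v)) := by
      intro z hz
      refine ENNReal.ofReal_le_ofReal (Real.exp_le_exp.mpr ?_)
      have : r / c * (r * c) ≤ r / c * (σ * inner ℝ (∑ i ∈ U, z i) v) :=
        mul_le_mul_of_nonneg_left hz (by positivity)
      calc r ^ 2 = r / c * (r * c) := by field_simp
        _ ≤ _ := this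
        _ = _ := by ring
    have hmeas : MeasurableSet {z : ι → E d | r * c ≤ σ * inner ℝ (∑ i ∈ U, z i) v} :=
      measurableSet_le measurable_const (by fun_prop)
    have h3 : ENNReal.ofReal (Real.exp (r ^ 2)) *
        P {z | r * c ≤ σ * inner ℝ (∑ i ∈ U, z i) v}
        ≤ ENNReal.ofReal (Real.exp (r ^ 2 / 2)) := by
      calc _ = ∫⁻ z in {z | r * c ≤ σ * inner ℝ (∑ i ∈ U, z i) v},
            ENNReal.ofReal (Real.exp (r ^ 2)) ∂P := by rw [setLIntegral_const]
        _ ≤ ∫⁻ z in {z | r * c ≤ σ * inner ℝ (∑ i ∈ U, z i) v},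
            ENNReal.ofReal (Real.exp (σ * (r / c) * inner ℝ (∑ i ∈ U, z i) v)) ∂P :=
          setLIntegral_mono' hmeas h2
        _ ≤ _ := setLIntegral_le_lintegral _ _
        _ = _ := by
          rw [h1]
          congr 2
          rw [hc]
          have : √(U.card : ℝ) ^ 2 = U.card := Real.sq_sqrt hu.le
          rw [mul_pow, hσ, div_pow, mul_pow, this]
          field_simp
    have h4 : ENNReal.ofReal (Real.exp (-r ^ 2 / 2))
        = ENNReal.ofReal (Real.exp (r ^ 2 / 2)) / ENNReal.ofReal (Real.exp (r ^ 2)) := by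
      rw [← ENNReal.ofReal_div_of_pos (Real.exp_pos _), ← Real.exp_sub]
      congr 2; ring
    rw [h4, ENNReal.le_div_iff_mul_le (Or.inl (by simp [Real.exp_pos]))
      (Or.inl ENNReal.ofReal_ne_top), mul_comm]
    exact h3
  calc P {z | r * √U.card * ‖v‖ < |inner ℝ (∑ i ∈ U, z i) v|}
      ≤ P ({z | r * c ≤ 1 * inner ℝ (∑ i ∈ U, z i) v} ∪
          {z | r * c ≤ -1 * inner ℝ (∑ i ∈ U, z i) v}) := by
        refine measure_mono fun z hz => ?_
        simp only [Set.mem_ofPred_eq, Set.mem_union] at hz ⊢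
        rw [mul_assoc, ← hc] at hz
        rcases abs_cases (inner ℝ (∑ i ∈ U, z i) v) with h | h
        · left; linarith
        · right; linarith
    _ ≤ _ := measure_union_le _ _
    _ ≤ ENNReal.ofReal (Real.exp (-r ^ 2 / 2)) + ENNReal.ofReal (Real.exp (-r ^ 2 / 2)) :=
        add_le_add (hone 1 (by norm_num)) (hone (-1) (by norm_num))
    _ = _ := by
        rw [← ENNReal.ofReal_add (Real.exp_pos _).le (Real.exp_pos _).le, two_mul]

/-- The direction may depend on the other coordinates. -/
lemma measure_sum_inner_gt_of_indep {ι : Type*} [Fintype ι] (U : Finset ι)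
    (v : (ι → E d) → E d) (hv : Measurable v)
    (hdep : ∀ z z' : ι → E d, (∀ i ∉ U, z i = z' i) → v z = v z') {r : ℝ} (hr : 0 ≤ r) :
    (Measure.pi fun _ : ι => stdGaussian (E d))
      {z | r * √U.card * ‖v z‖ < |inner ℝ (∑ i ∈ U, z i) (v z)|}
      ≤ ENNReal.ofReal (2 * Real.exp (-r ^ 2 / 2)) := by
  classical
  -- Coordinates in `U` and outside `U` are taken from two independent samples. With the outer
  -- sample fixed, the direction is constant.
  have hmp := measurePreserving_mix (ι := ι) (stdGaussian (E d)) (fun i => i ∈ U)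
  have hmeas : MeasurableSet
      {z : ι → E d | r * √U.card * ‖v z‖ < |inner ℝ (∑ i ∈ U, z i) (v z)|} := by
    have h1 : Measurable fun z : ι → E d => ∑ i ∈ U, z i := by fun_prop
    have h2 : Measurable fun z : ι → E d => inner ℝ (∑ i ∈ U, z i) (v z) := h1.inner hv
    exact measurableSet_lt (hv.norm.const_mul _) h2.abs
  rw [← hmp.measure_preimage hmeas.nullMeasurableSet,
    Measure.prod_apply_symm (hmp.measurable hmeas)]
  refine (lintegral_mono (g := fun _ => ENNReal.ofReal (2 * Real.exp (-r ^ 2 / 2)))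
    fun z' => ?_).trans (by simp)
  refine le_trans (measure_mono fun z hz => ?_) (measure_sum_inner_gt U (v z') hr)
  simp only [Set.mem_preimage, Set.mem_ofPred_eq] at hz ⊢
  have h1 : v (fun i => if i ∈ U then z i else z' i) = v z' :=
    hdep _ _ fun i hi => by simp [hi]
  have h2 : ∑ i ∈ U, (if i ∈ U then z i else z' i) = ∑ i ∈ U, z i :=
    Finset.sum_congr rfl fun i hi => by simp [hi]
  rw [h1, h2] at hz
  exact hz

/-- This is `log (1 - x) ≥ -x - x²`. It turns the moment of a centred squared Gaussian into the
subgaussian bound `exp (2s²)`. -/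
lemma one_sub_mul_exp_ge {x : ℝ} (hx : |x| ≤ 1 / 2) : 1 ≤ (1 - x) * Real.exp (x + x ^ 2) := by
  obtain ⟨h1, h2⟩ := abs_le.mp hx
  rcases le_total 0 x with h | h
  · have h3 := Real.quadratic_le_exp_of_nonneg (show 0 ≤ x + x ^ 2 by positivity)
    have h4 : (1 - x) * (1 + (x + x ^ 2) + (x + x ^ 2) ^ 2 / 2) ≤ (1 - x) * Real.exp (x + x ^ 2) :=
      mul_le_mul_of_nonneg_left h3 (by linarith)
    refine le_trans ?_ h4
    have h5 : (1 - x) * (1 + (x + x ^ 2) + (x + x ^ 2) ^ 2 / 2) - 1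
        = x ^ 2 / 2 * (1 - x - x ^ 2 - x ^ 3) := by ring
    have h6 : x ^ 2 ≤ 1 / 4 := by nlinarith
    have h7 : x ^ 3 ≤ 1 / 8 := by nlinarith
    have : 0 ≤ x ^ 2 / 2 * (1 - x - x ^ 2 - x ^ 3) := by
      have : 0 ≤ 1 - x - x ^ 2 - x ^ 3 := by linarith
      positivity
    linarith
  · have h3 := Real.add_one_le_exp (x + x ^ 2)
    have h4 : (1 - x) * (x + x ^ 2 + 1) ≤ (1 - x) * Real.exp (x + x ^ 2) :=
      mul_le_mul_of_nonneg_left h3 (by linarith)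
    refine le_trans ?_ h4
    nlinarith [show x ^ 3 ≤ 0 from by nlinarith [sq_nonneg x]]

lemma lintegral_exp_norm_sq {s : ℝ} (hs : |s| ≤ 1 / 4) :
    ∫⁻ x, ENNReal.ofReal (Real.exp (s * (‖x‖ ^ 2 - d))) ∂(stdGaussian (E d))
      ≤ ENNReal.ofReal (Real.exp (2 * s ^ 2 * d)) := by
  have hs2 : s < 1 / 2 := by have := (abs_le.mp hs).2; linarith
  rw [← map_pi_eq_stdGaussian, lintegral_map (by fun_prop) (by fun_prop)]
  have h1 : ∀ x : Fin d → ℝ, ENNReal.ofReal (Real.exp (s * (‖WithLp.toLp 2 x‖ ^ 2 - d)))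
      = ∏ i, (ENNReal.ofReal (Real.exp (-s)) * ENNReal.ofReal (Real.exp (s * x i ^ 2))) := by
    intro x
    have e1 : ∀ i, ENNReal.ofReal (Real.exp (-s)) * ENNReal.ofReal (Real.exp (s * x i ^ 2))
        = ENNReal.ofReal (Real.exp (s * (x i ^ 2 - 1))) := fun i => by
      rw [← ENNReal.ofReal_mul (Real.exp_pos _).le, ← Real.exp_add]; congr 2; ring
    simp only [e1]
    rw [← ENNReal.ofReal_prod_of_nonneg (fun i _ => (Real.exp_pos _).le), ← Real.exp_sum,
      EuclideanSpace.real_norm_sq_eq, ← Finset.mul_sum, Finset.sum_sub_distrib]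
    simp
  rw [lintegral_congr h1, lintegral_pi_prod (gaussianReal 0 1)
    (fun _ x => ENNReal.ofReal (Real.exp (-s)) * ENNReal.ofReal (Real.exp (s * x ^ 2)))
    (fun i => by fun_prop)]
  rw [Finset.prod_const, lintegral_const_mul _ (by fun_prop), lintegral_exp_sq_gaussianReal hs2,
    ← ENNReal.ofReal_mul (Real.exp_pos _).le, Finset.card_univ, Fintype.card_fin,
    ← ENNReal.ofReal_pow (by positivity)]
  refine ENNReal.ofReal_le_ofReal ?_
  have h2 : Real.exp (-s) * √(1 / (1 - 2 * s)) ≤ Real.exp (2 * s ^ 2) := by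
    have h3 := one_sub_mul_exp_ge (x := 2 * s) (by rw [abs_mul]; norm_num; linarith)
    have hpos : 0 < 1 - 2 * s := by linarith
    have h4 : √(1 / (1 - 2 * s)) ≤ Real.exp (s + 2 * s ^ 2) := by
      refine Real.sqrt_le_iff.mpr ⟨(Real.exp_pos _).le, ?_⟩
      rw [div_le_iff₀ hpos, ← Real.exp_nat_mul]
      calc 1 ≤ (1 - 2 * s) * Real.exp (2 * s + (2 * s) ^ 2) := h3
        _ = _ := by rw [mul_comm]; congr 2; push_cast; ring
    calc Real.exp (-s) * √(1 / (1 - 2 * s)) ≤ Real.exp (-s) * Real.exp (s + 2 * s ^ 2) := by gcongr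
      _ = Real.exp (2 * s ^ 2) := by rw [← Real.exp_add]; congr 1; ring
  calc (Real.exp (-s) * √(1 / (1 - 2 * s))) ^ d ≤ Real.exp (2 * s ^ 2) ^ d := by gcongr
    _ = _ := by rw [← Real.exp_nat_mul]; congr 1; ring

/-- Concentration of the norm of a Gaussian vector. -/
lemma measure_norm_sq_gt (hd : 0 < d) (t : ℝ) :
    stdGaussian (E d) {x | t * √d < |‖x‖ ^ 2 - d|} ≤ ENNReal.ofReal (3 * Real.exp (-t / 4)) := by
  have hd' : (1 : ℝ) ≤ d := by exact_mod_cast hd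
  have hsd : 1 ≤ √(d : ℝ) := Real.one_le_sqrt.mpr hd'
  have hsq : √(d : ℝ) ^ 2 = d := Real.sq_sqrt (by positivity)
  have hone : ∀ σ : ℝ, |σ| = 1 →
      stdGaussian (E d) {x | t * √d ≤ σ * (‖x‖ ^ 2 - d)}
        ≤ ENNReal.ofReal (Real.exp (1 / 8 - t / 4)) := by
    intro σ hσ
    have hσ2 : σ ^ 2 = 1 := by rw [← sq_abs, hσ, one_pow]
    -- The moment bound holds only for `|s| ≤ 1/4`, so `|s| = 1 / (4√d)` is used, where its exponent
    -- `2 s² d` is `1/8`. This gives an exponential tail.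
    have h1 := lintegral_exp_norm_sq (d := d) (s := σ * (1 / (4 * √d))) (by
      rw [abs_mul, hσ, one_mul, abs_of_nonneg (by positivity)]
      exact one_div_le_one_div_of_le (by norm_num) (by linarith))
    have hmeas : MeasurableSet {x : E d | t * √d ≤ σ * (‖x‖ ^ 2 - d)} :=
      measurableSet_le measurable_const (by fun_prop)
    have h3 : ENNReal.ofReal (Real.exp (t / 4)) *
        stdGaussian (E d) {x | t * √d ≤ σ * (‖x‖ ^ 2 - d)}
        ≤ ENNReal.ofReal (Real.exp (1 / 8)) := by
      calc _ = ∫⁻ x in {x : E d | t * √d ≤ σ * (‖x‖ ^ 2 - d)},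
            ENNReal.ofReal (Real.exp (t / 4)) ∂(stdGaussian (E d)) := by rw [setLIntegral_const]
        _ ≤ ∫⁻ x in {x : E d | t * √d ≤ σ * (‖x‖ ^ 2 - d)},
            ENNReal.ofReal (Real.exp (σ * (1 / (4 * √d)) * (‖x‖ ^ 2 - d))) ∂(stdGaussian (E d)) := by
          refine setLIntegral_mono' hmeas fun x hx => ?_
          refine ENNReal.ofReal_le_ofReal (Real.exp_le_exp.mpr ?_)
          have : 1 / (4 * √(d : ℝ)) * (t * √d) ≤ 1 / (4 * √(d : ℝ)) * (σ * (‖x‖ ^ 2 - d)) :=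
            mul_le_mul_of_nonneg_left hx (by positivity)
          calc t / 4 = 1 / (4 * √(d : ℝ)) * (t * √d) := by field_simp
            _ ≤ _ := this
            _ = _ := by ring
        _ ≤ _ := setLIntegral_le_lintegral _ _
        _ ≤ _ := h1
        _ = _ := by
          congr 2
          rw [mul_pow, hσ2, div_pow, mul_pow, hsq]
          field_simp
          norm_num
    have h4 : ENNReal.ofReal (Real.exp (1 / 8 - t / 4))
        = ENNReal.ofReal (Real.exp (1 / 8)) / ENNReal.ofReal (Real.exp (t / 4)) := by
      rw [← ENNReal.ofReal_div_of_pos (Real.exp_pos _), ← Real.exp_sub]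
    rw [h4, ENNReal.le_div_iff_mul_le (Or.inl (by simp [Real.exp_pos]))
      (Or.inl ENNReal.ofReal_ne_top), mul_comm]
    exact h3
  calc stdGaussian (E d) {x | t * √d < |‖x‖ ^ 2 - d|}
      ≤ stdGaussian (E d) ({x | t * √d ≤ 1 * (‖x‖ ^ 2 - d)} ∪
          {x | t * √d ≤ -1 * (‖x‖ ^ 2 - d)}) := by
        refine measure_mono fun x hx => ?_
        simp only [Set.mem_ofPred_eq, Set.mem_union] at hx ⊢
        rcases abs_cases (‖x‖ ^ 2 - (d : ℝ)) with h | h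
        · left; linarith
        · right; linarith
    _ ≤ _ := measure_union_le _ _
    _ ≤ ENNReal.ofReal (Real.exp (1 / 8 - t / 4)) + ENNReal.ofReal (Real.exp (1 / 8 - t / 4)) :=
        add_le_add (hone 1 (by norm_num)) (hone (-1) (by norm_num))
    _ ≤ _ := by
        rw [← ENNReal.ofReal_add (Real.exp_pos _).le (Real.exp_pos _).le]
        refine ENNReal.ofReal_le_ofReal ?_
        have h5 : Real.exp (1 / 8 - t / 4) = Real.exp (1 / 8) * Real.exp (-t / 4) := by
          rw [← Real.exp_add]; congr 1; ring
        have h6 : Real.exp (1 / 8 : ℝ) ≤ 3 / 2 := by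
          have := Real.exp_bound_div_one_sub_of_interval (x := 1 / 8) (by norm_num) (by norm_num)
          norm_num at this
          linarith
        rw [h5]
        nlinarith [Real.exp_pos (-t / 4)]

end Gaussian

end

/-! ### Structured points with independent Gaussian points are friendly. -/

section

/-- The members of a set are written into `m` slots, and the unused slots hold `none`. -/
lemma card_filter_card_le (n m : ℕ) :
    ((Finset.univ : Finset (Finset (Fin n))).filter fun U => U.card ≤ m).card ≤ (n + 1) ^ m := by
  classical
  have h : ((Finset.univ : Finset (Finset (Fin n))).filter fun U => U.card ≤ m) ⊆
      (Finset.univ : Finset (Fin m → Option (Fin n))).image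
        (fun f => Finset.univ.filter fun i => ∃ a, f a = some i) := by
    intro U hU
    simp only [Finset.mem_filter, Finset.mem_univ, true_and] at hU
    rw [Finset.mem_image]
    refine ⟨fun a => if h : (a : ℕ) < U.card then some (U.equivFin.symm ⟨a, h⟩ : Fin n) else none,
      Finset.mem_univ _, ?_⟩
    ext i
    simp only [Finset.mem_filter, Finset.mem_univ, true_and]
    constructor
    · rintro ⟨a, ha⟩
      split_ifs at ha with h
      simp only [Option.some.injEq] at ha
      rw [← ha]
      exact (U.equivFin.symm ⟨a, h⟩).2
    · intro hi
      have hlt := (U.equivFin ⟨i, hi⟩).2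
      refine ⟨⟨U.equivFin ⟨i, hi⟩, hlt.trans_le hU⟩, ?_⟩
      simp
  calc _ ≤ _ := Finset.card_le_card h
    _ ≤ (Finset.univ : Finset (Fin m → Option (Fin n))).card := Finset.card_image_le
    _ = (n + 1) ^ m := by simp

/-- Means of norm at most one contribute at most `|U| ‖v‖`. For `|U| ≤ m` this is of the order `√m
√|U| ‖v‖`, which the union bound over small sets costs anyway. -/
lemma inner_sum_shift_le {F : Type*} [NormedAddCommGroup F] [InnerProductSpace ℝ F] {ι : Type*}
    (U : Finset ι) (c z : ι → F) (hc : ∀ i, ‖c i‖ ≤ 1) (v : F) {r : ℝ}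
    (h : |inner ℝ (∑ i ∈ U, z i) v| ≤ r * √U.card * ‖v‖) :
    |inner ℝ (∑ i ∈ U, (c i + z i)) v| ≤ (r + √U.card) * √U.card * ‖v‖ := by
  rw [Finset.sum_add_distrib, inner_add_left]
  have h1 : |inner ℝ (∑ i ∈ U, c i) v| ≤ U.card * ‖v‖ := by
    refine (abs_real_inner_le_norm _ _).trans ?_
    gcongr
    refine (norm_sum_le _ _).trans ?_
    calc ∑ i ∈ U, ‖c i‖ ≤ ∑ _i ∈ U, (1 : ℝ) := Finset.sum_le_sum fun i _ => hc i
      _ = U.card := by simp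
  have h2 : √(U.card : ℝ) * √U.card = U.card := Real.mul_self_sqrt (by positivity)
  calc _ ≤ |inner ℝ (∑ i ∈ U, c i) v| + |inner ℝ (∑ i ∈ U, z i) v| := abs_add_le _ _
    _ ≤ U.card * ‖v‖ + r * √U.card * ‖v‖ := add_le_add h1 h
    _ = (√U.card * √U.card) * ‖v‖ + r * √U.card * ‖v‖ := by rw [h2]
    _ = _ := by ring

/-- The dataset with points `y i` for `i ∈ J` and points `c i + z i` otherwise. -/
def mixPts {d n : ℕ} (J : Finset (Fin n)) (y c z : Fin n → E d) : Fin n → E d :=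
  fun i => if i ∈ J then y i else c i + z i

lemma measurable_mixPts {d n : ℕ} (J : Finset (Fin n)) (y c : Fin n → E d) :
    Measurable fun z => mixPts J y c z := by
  refine measurable_pi_lambda _ fun i => ?_
  unfold mixPts
  split_ifs <;> fun_prop

/-- The points `z i` have typical norms, and are nearly orthogonal to the means `c i` and to the
other points `x j`. -/
def Regular {d n : ℕ} (Λ : ℝ) (c x z : Fin n → E d) : Prop :=
  (∀ i, |‖z i‖ ^ 2 - d| ≤ Λ ^ 3 * √d) ∧ (∀ i, |inner ℝ (z i) (c i)| ≤ Λ * ‖c i‖) ∧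
    ∀ i j, i ≠ j → |inner ℝ (z i) (x j)| ≤ Λ * ‖x j‖

/-- A union bound over points and pairs. For `i ≠ j` the point `x j` does not depend on `z i`, so it
acts as a fixed direction. -/
lemma measure_not_regular_le {n d : ℕ} {Λ : ℝ} (hΛ : 6 ≤ Λ) (hd : 0 < d)
    (hn : (n : ℝ) + 1 ≤ Real.exp (Λ / 2)) (J : Finset (Fin n)) (y c : Fin n → E d) :
    (Measure.pi fun _ : Fin n => stdGaussian (E d)) {z | ¬ Regular Λ c (mixPts J y c z) z}
      ≤ ENNReal.ofReal (7 * Real.exp (-2 * Λ)) := by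
  classical
  have hΛ0 : 0 < Λ := by linarith
  set P := Measure.pi fun _ : Fin n => stdGaussian (E d) with hP
  set x := fun z => mixPts J y c z with hx
  have hxm : Measurable x := measurable_mixPts J y c
  set A1 : Fin n → Set (Fin n → E d) := fun i => {z | Λ ^ 3 * √d < |‖z i‖ ^ 2 - d|} with hA1
  set A2 : Fin n → Set (Fin n → E d) :=
    fun i => {z | Λ * √({i} : Finset (Fin n)).card * ‖c i‖ < |inner ℝ (∑ k ∈ {i}, z k) (c i)|} with hA2
  set A3 : Fin n × Fin n → Set (Fin n → E d) :=
    fun p => if p.1 = p.2 then ∅ else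
      {z | Λ * √({p.1} : Finset (Fin n)).card * ‖x z p.2‖
        < |inner ℝ (∑ k ∈ {p.1}, z k) (x z p.2)|} with hA3
  have hsub : {z | ¬ Regular Λ c (x z) z} ⊆
      ((⋃ i ∈ (Finset.univ : Finset (Fin n)), A1 i) ∪ (⋃ i ∈ (Finset.univ : Finset (Fin n)), A2 i)) ∪
      (⋃ p ∈ (Finset.univ : Finset (Fin n × Fin n)), A3 p) := by
    intro z hz
    by_contra hcon
    simp only [Set.mem_union, Set.mem_iUnion, Finset.mem_univ, exists_prop, true_and, not_or,
      not_exists] at hcon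
    obtain ⟨⟨h1, h2⟩, h3⟩ := hcon
    refine hz ⟨fun i => not_lt.mp (h1 i), fun i => by simpa [hA2] using h2 i, fun i j hij => ?_⟩
    have := h3 (i, j)
    simpa [hA3, hij] using this
  have hn0 : (n : ℝ) ≤ Real.exp (Λ / 2) := by linarith
  have b1 : P (⋃ i ∈ (Finset.univ : Finset (Fin n)), A1 i)
      ≤ ENNReal.ofReal (3 * Real.exp (-2 * Λ)) := by
    refine (measure_biUnion_finset_le _ _).trans ?_
    have e1 : ∀ i, P (A1 i) ≤ ENNReal.ofReal (3 * Real.exp (-Λ ^ 3 / 4)) := fun i => by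
      have hmeas : MeasurableSet {v : E d | Λ ^ 3 * √d < |‖v‖ ^ 2 - d|} :=
        measurableSet_lt measurable_const (by fun_prop)
      have := (measurePreserving_eval (fun _ : Fin n => stdGaussian (E d)) i).measure_preimage
        hmeas.nullMeasurableSet
      exact (le_of_eq this).trans (measure_norm_sq_gt hd _)
    refine (Finset.sum_le_sum fun i _ => e1 i).trans ?_
    rw [Finset.sum_const, Finset.card_univ, Fintype.card_fin, nsmul_eq_mul,
      ← ENNReal.ofReal_natCast, ← ENNReal.ofReal_mul (by positivity)]
    refine ENNReal.ofReal_le_ofReal ?_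
    calc (n : ℝ) * (3 * Real.exp (-Λ ^ 3 / 4)) ≤ Real.exp (Λ / 2) * (3 * Real.exp (-Λ ^ 3 / 4)) := by
          gcongr
      _ = 3 * Real.exp (Λ / 2 + -Λ ^ 3 / 4) := by rw [Real.exp_add]; ring
      _ ≤ _ := by
          gcongr
          nlinarith [mul_nonneg hΛ0.le (show 0 ≤ Λ ^ 2 - 36 by nlinarith)]
  have b2 : P (⋃ i ∈ (Finset.univ : Finset (Fin n)), A2 i)
      ≤ ENNReal.ofReal (2 * Real.exp (-2 * Λ)) := by
    refine (measure_biUnion_finset_le _ _).trans ?_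
    refine (Finset.sum_le_sum fun i _ => measure_sum_inner_gt {i} (c i) hΛ0.le).trans ?_
    rw [Finset.sum_const, Finset.card_univ, Fintype.card_fin, nsmul_eq_mul,
      ← ENNReal.ofReal_natCast, ← ENNReal.ofReal_mul (by positivity)]
    refine ENNReal.ofReal_le_ofReal ?_
    calc (n : ℝ) * (2 * Real.exp (-Λ ^ 2 / 2)) ≤ Real.exp (Λ / 2) * (2 * Real.exp (-Λ ^ 2 / 2)) := by
          gcongr
      _ = 2 * Real.exp (Λ / 2 + -Λ ^ 2 / 2) := by rw [Real.exp_add]; ring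
      _ ≤ _ := by gcongr; nlinarith
  have b3 : P (⋃ p ∈ (Finset.univ : Finset (Fin n × Fin n)), A3 p)
      ≤ ENNReal.ofReal (2 * Real.exp (-2 * Λ)) := by
    refine (measure_biUnion_finset_le _ _).trans ?_
    have e1 : ∀ p, P (A3 p) ≤ ENNReal.ofReal (2 * Real.exp (-Λ ^ 2 / 2)) := fun p => by
      by_cases hp : p.1 = p.2
      · simp [hA3, hp]
      · simp only [hA3, hp, if_false]
        refine measure_sum_inner_gt_of_indep {p.1} (fun z => x z p.2)
          (measurable_pi_iff.mp hxm p.2) (fun z z' h => ?_) hΛ0.le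
        have := h p.2 (by simp; exact fun h => hp h.symm)
        simp [hx, mixPts, this]
    refine (Finset.sum_le_sum fun p _ => e1 p).trans ?_
    rw [Finset.sum_const, Finset.card_univ, Fintype.card_prod, Fintype.card_fin, nsmul_eq_mul,
      ← ENNReal.ofReal_natCast, ← ENNReal.ofReal_mul (by positivity)]
    refine ENNReal.ofReal_le_ofReal ?_
    push_cast
    calc (n : ℝ) * n * (2 * Real.exp (-Λ ^ 2 / 2))
        ≤ Real.exp (Λ / 2) * Real.exp (Λ / 2) * (2 * Real.exp (-Λ ^ 2 / 2)) := by
          gcongr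
      _ = 2 * Real.exp (Λ / 2 + Λ / 2 + -Λ ^ 2 / 2) := by rw [Real.exp_add, Real.exp_add]; ring
      _ ≤ _ := by gcongr; nlinarith
  have := (measure_mono hsub).trans ((measure_union_le _ _).trans (add_le_add
    ((measure_union_le _ _).trans (add_le_add b1 b2)) b3))
  refine this.trans (le_of_eq ?_)
  rw [← ENNReal.ofReal_add (by positivity) (by positivity),
    ← ENNReal.ofReal_add (by positivity) (by positivity)]
  congr 1
  ring

/-- Structured points together with independent Gaussian points are friendly with high
probability. -/
theorem measure_not_isFriendly_le {n d m : ℕ} {Λ ε : ℝ} (hΛ : 6 ≤ Λ) (hε : ε * n = m) (hd : 0 < d)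
    (hn : (n : ℝ) + 1 ≤ Real.exp (Λ / 2)) (J : Finset (Fin n)) (y c : Fin n → E d)
    (hc : ∀ i, ‖c i‖ ≤ 1)
    (hnorm : ∀ i ∈ J, |‖y i‖ ^ 2 - d| ≤ Λ ^ 8 * √d)
    (hpair : ∀ i ∈ J, ∀ j ∈ J, i ≠ j → |inner ℝ (y i) (y j)| ≤ Λ ^ 8 * √d)
    (hJ : ∀ S T : Finset (Fin n), S ⊆ J → T ⊆ J → Disjoint S T → S.card ≤ m → T.card ≤ m →
      |inner ℝ (∑ i ∈ S, y i) (∑ i ∈ T, y i)|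
        ≤ Λ ^ 40 * corrScale d m * √((S.card : ℝ) * T.card)) :
    (Measure.pi fun _ : Fin n => stdGaussian (E d))
      {z | ¬ IsFriendly (Λ ^ 2000) ε (mixPts J y c z)} ≤ ENNReal.ofReal (9 * Real.exp (-2 * Λ)) := by
  classical
  have hΛ0 : 0 < Λ := by linarith
  have hd1 : (1 : ℝ) ≤ d := by exact_mod_cast hd
  set P := Measure.pi fun _ : Fin n => stdGaussian (E d) with hP
  set x := fun z => mixPts J y c z with hx
  have hxm : Measurable x := measurable_mixPts J y c
  set sm := (Finset.univ : Finset (Finset (Fin n))).filter fun U => U.card ≤ m with hsm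
  -- For disjoint index sets the second sum does not depend on the Gaussians of the first. The level
  -- `Λ² √m / 2` gives a tail that beats the at most `(n + 1) ^ (2m)` pairs of small sets.
  set A4 : Finset (Fin n) × Finset (Fin n) → Set (Fin n → E d) :=
    fun p => if Disjoint p.1 p.2 ∧ 0 < m then
      {z | Λ ^ 2 * √m / 2 * √p.1.card * ‖∑ k ∈ p.2, x z k‖
        < |inner ℝ (∑ k ∈ p.1, z k) (∑ k ∈ p.2, x z k)|} else ∅ with hA4
  have hsub : {z | ¬ IsFriendly (Λ ^ 2000) ε (x z)} ⊆
      {z | ¬ Regular Λ c (x z) z} ∪ (⋃ p ∈ sm ×ˢ sm, A4 p) := by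
    intro z hz
    by_contra hcon
    simp only [Set.mem_union, Set.mem_iUnion, exists_prop, not_or, not_exists] at hcon
    obtain ⟨hreg, h4⟩ := hcon
    obtain ⟨h1, h2, h3⟩ := not_not.mp hreg
    refine hz ?_
    have hnormx : ∀ i, |‖x z i‖ ^ 2 - d| ≤ Λ ^ 8 * √d := by
      intro i
      by_cases hi : i ∈ J
      · simpa [hx, mixPts, hi] using hnorm i hi
      · have e1 : |‖z i‖ ^ 2 - d| ≤ Λ ^ 3 * √d := h1 i
        have e2 : |inner ℝ (z i) (c i)| ≤ Λ * ‖c i‖ := h2 i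
        have e3 : ‖x z i‖ ^ 2 - d = (‖z i‖ ^ 2 - d) + 2 * inner ℝ (z i) (c i) + ‖c i‖ ^ 2 := by
          simp only [hx, mixPts, hi, if_false]
          rw [add_comm (c i), norm_add_sq_real]; ring
        have hci := hc i
        have e4 : ‖c i‖ ^ 2 ≤ 1 := by nlinarith [norm_nonneg (c i)]
        have e5 : Λ * ‖c i‖ ≤ Λ := by nlinarith
        have hsd : 1 ≤ √(d : ℝ) := Real.one_le_sqrt.mpr hd1
        have e6 : Λ ^ 3 + 2 * Λ + 1 ≤ Λ ^ 8 := by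
          have f1 : Λ ≤ Λ ^ 3 := le_self_pow₀ (by linarith) (by norm_num)
          have f2 : 1 ≤ Λ ^ 3 := one_le_pow₀ (by linarith)
          calc Λ ^ 3 + 2 * Λ + 1 ≤ Λ ^ 3 + 2 * Λ ^ 3 + Λ ^ 3 := by linarith
            _ = 4 * Λ ^ 3 := by ring
            _ ≤ Λ ^ 5 * Λ ^ 3 := by
                gcongr
                calc (4 : ℝ) ≤ 6 ^ 5 := by norm_num
                  _ ≤ Λ ^ 5 := by gcongr
            _ = Λ ^ 8 := by ring
        rw [e3]
        calc _ ≤ |‖z i‖ ^ 2 - d| + |2 * inner ℝ (z i) (c i)| + |‖c i‖ ^ 2| := abs_add_three _ _ _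
          _ ≤ Λ ^ 3 * √d + 2 * Λ + 1 := by
              rw [abs_mul, abs_two, abs_of_nonneg (sq_nonneg ‖c i‖)]; linarith
          _ ≤ (Λ ^ 3 + 2 * Λ + 1) * √d := by nlinarith
          _ ≤ _ := by gcongr
    have hpair' : ∀ i j, i ∉ J → i ≠ j → |inner ℝ (x z i) (x z j)| ≤ Λ ^ 8 * √d := by
      intro i j hi hij
      have e1 : |inner ℝ (∑ k ∈ ({i} : Finset (Fin n)), z k) (x z j)|
          ≤ Λ * √({i} : Finset (Fin n)).card * ‖x z j‖ := by
        simpa using h3 i j hij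
      have e2 := inner_sum_shift_le {i} c z hc (x z j) e1
      have e3 : x z i = c i + z i := by simp [hx, mixPts, hi]
      simp only [Finset.sum_singleton, Finset.card_singleton, Nat.cast_one, Real.sqrt_one,
        mul_one] at e2
      rw [e3]
      refine e2.trans ?_
      have e4 := (abs_le.mp (hnormx j)).2
      have hd2 : √(d : ℝ) ^ 2 = d := Real.sq_sqrt (by positivity)
      have e5 : √(d : ℝ) ≤ d := by
        rw [Real.sqrt_le_iff]; exact ⟨by positivity, by nlinarith⟩
      have e7 : (1 : ℝ) ≤ Λ ^ 8 := one_le_pow₀ (by linarith)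
      have e6 : ‖x z j‖ ^ 2 ≤ (2 * Λ ^ 4 * √d) ^ 2 := by
        have g1 := mul_le_mul_of_nonneg_left e5 (show 0 ≤ Λ ^ 8 by positivity)
        have g2 : (d : ℝ) ≤ Λ ^ 8 * d := le_mul_of_one_le_left (by positivity) e7
        have g3 : (2 * Λ ^ 4 * √(d : ℝ)) ^ 2 = 4 * (Λ ^ 8 * d) := by
          rw [mul_pow, mul_pow, hd2]; ring
        rw [g3]
        nlinarith
      have e8 := le_of_sq_le_sq e6 (by positivity)
      calc (Λ + 1) * ‖x z j‖ ≤ (2 * Λ) * (2 * Λ ^ 4 * √d) := by gcongr; linarith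
        _ = 4 * Λ ^ 5 * √d := by ring
        _ ≤ Λ ^ 3 * Λ ^ 5 * √d := by
            gcongr
            calc (4 : ℝ) ≤ 6 ^ 3 := by norm_num
              _ ≤ Λ ^ 3 := by gcongr
        _ = Λ ^ 8 * √d := by ring
    refine isFriendly_of_mixed hΛ hε hd (x z) J hnormx ?_ ?_ ?_
    · intro i j hij
      by_cases hi : i ∈ J
      · by_cases hj : j ∈ J
        · simpa [hx, mixPts, hi, hj] using hpair i hi j hj hij
        · rw [real_inner_comm]
          exact hpair' j i hj hij.symm
      · exact hpair' i j hi hij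
    · intro U T hUJ hUT hU hT
      rcases U.eq_empty_or_nonempty with rfl | hUne
      · simp
      have hm0 : 0 < m := hUne.card_pos.trans_le hU
      have e1 : |inner ℝ (∑ k ∈ U, z k) (∑ k ∈ T, x z k)|
          ≤ Λ ^ 2 * √m / 2 * √U.card * ‖∑ k ∈ T, x z k‖ := by
        have := h4 (U, T)
        simpa only [hA4, hsm, hUT, hm0, and_self, if_true, Set.mem_ofPred_eq, not_and, not_lt,
          Finset.mem_product, Finset.mem_filter, Finset.mem_univ, true_and, hU, hT,
          true_implies] using this
      have e2 := inner_sum_shift_le U c z hc _ e1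
      have e3 : ∑ i ∈ U, x z i = ∑ i ∈ U, (c i + z i) := by
        refine Finset.sum_congr rfl fun i hi => ?_
        simp [hx, mixPts, Finset.disjoint_left.mp hUJ hi]
      rw [e3]
      refine e2.trans ?_
      have e4 : √(U.card : ℝ) ≤ √m := Real.sqrt_le_sqrt (by exact_mod_cast hU)
      have e5 : Λ ^ 2 * √m / 2 + √(U.card : ℝ) ≤ Λ ^ 2 * √m := by
        have : 2 ≤ Λ ^ 2 := by nlinarith
        nlinarith [Real.sqrt_nonneg (m : ℝ)]
      gcongr
    · intro S T hS hT hST hSm hTm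
      have e1 : ∀ U ⊆ J, ∑ i ∈ U, x z i = ∑ i ∈ U, y i := fun U hU =>
        Finset.sum_congr rfl fun i hi => by simp [hx, mixPts, hU hi]
      rw [e1 S hS, e1 T hT]
      exact hJ S T hS hT hST hSm hTm
  have hn0 : (n : ℝ) ≤ Real.exp (Λ / 2) := by linarith
  have b4 : P (⋃ p ∈ sm ×ˢ sm, A4 p) ≤ ENNReal.ofReal (2 * Real.exp (-2 * Λ)) := by
    rcases Nat.eq_zero_or_pos m with hm0 | hm0
    · simp [hA4, hm0]
    have hm1 : (1 : ℝ) ≤ m := by exact_mod_cast hm0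
    refine (measure_biUnion_finset_le _ _).trans ?_
    have e1 : ∀ p ∈ sm ×ˢ sm, P (A4 p) ≤ ENNReal.ofReal (2 * Real.exp (-(Λ ^ 2 * √m / 2) ^ 2 / 2)) := by
      intro p _
      by_cases hp : Disjoint p.1 p.2
      · simp only [hA4, hp, hm0, and_self, if_true]
        refine measure_sum_inner_gt_of_indep p.1 (fun z => ∑ k ∈ p.2, x z k) ?_
          (fun z z' h => ?_) (by positivity)
        · exact Finset.measurable_fun_sum _ fun k _ => measurable_pi_iff.mp hxm k
        · refine Finset.sum_congr rfl fun k hk => ?_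
          have := h k (fun h => Finset.disjoint_left.mp hp h hk)
          simp [hx, mixPts, this]
      · simp [hA4, hp]
    refine (Finset.sum_le_sum e1).trans ?_
    rw [Finset.sum_const, Finset.card_product, nsmul_eq_mul,
      ← ENNReal.ofReal_natCast, ← ENNReal.ofReal_mul (by positivity)]
    refine ENNReal.ofReal_le_ofReal ?_
    have hcard : ((sm.card * sm.card : ℕ) : ℝ) ≤ Real.exp (m * Λ) := by
      have : ((sm.card : ℕ) : ℝ) ≤ ((n : ℝ) + 1) ^ m := by exact_mod_cast card_filter_card_le n m
      push_cast
      calc (sm.card : ℝ) * sm.card ≤ ((n : ℝ) + 1) ^ m * ((n : ℝ) + 1) ^ m := by gcongr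
        _ ≤ Real.exp (Λ / 2) ^ m * Real.exp (Λ / 2) ^ m := by gcongr
        _ = Real.exp (m * Λ) := by
            rw [← Real.exp_nat_mul, ← Real.exp_add]; congr 1; ring
    calc ((sm.card * sm.card : ℕ) : ℝ) * (2 * Real.exp (-(Λ ^ 2 * √m / 2) ^ 2 / 2))
        ≤ Real.exp (m * Λ) * (2 * Real.exp (-(Λ ^ 2 * √m / 2) ^ 2 / 2)) := by gcongr
      _ = 2 * Real.exp (m * Λ + -(Λ ^ 2 * √m / 2) ^ 2 / 2) := by rw [Real.exp_add]; ring
      _ ≤ _ := by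
          gcongr
          rw [div_pow, mul_pow, Real.sq_sqrt (by positivity)]
          have e3 : 216 ≤ Λ ^ 3 := by
            calc (216 : ℝ) = 6 ^ 3 := by norm_num
              _ ≤ Λ ^ 3 := by gcongr
          have e2 : 216 * Λ ≤ Λ ^ 4 := by nlinarith
          have e4 : 216 * Λ * m ≤ Λ ^ 4 * m := by gcongr
          have e5 : Λ ≤ Λ * m := by nlinarith
          nlinarith
  refine (measure_mono hsub).trans ((measure_union_le _ _).trans
    ((add_le_add (measure_not_regular_le hΛ hd hn J y c) b4).trans (le_of_eq ?_)))
  rw [← ENNReal.ofReal_add (by positivity) (by positivity)]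
  congr 1
  ring

end

/-! ### The Gibbs measure on families of directions. -/

section

section Gibbs

variable {𝒯 ι : Type*}

/-- The largest of the values `f Q j`, `Q ∈ 𝒬`. -/
noncomputable def cover (f : 𝒯 → ι → NNReal) (𝒬 : Finset 𝒯) (j : ι) : NNReal := 𝒬.sup fun Q => f Q j

/-- The unnormalised Gibbs weight of a family `𝒬` of directions. -/
noncomputable def gibbsWeight (π : 𝒯 → ℝ) (η : ℝ) (f : 𝒯 → ι → NNReal) (J : Finset ι)
    (𝒬 : Finset 𝒯) : ℝ :=
  (∏ Q ∈ 𝒬, π Q) * Real.exp (η * ∑ j ∈ J, (cover f 𝒬 j : ℝ))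

/-- The families of at most `n` directions. -/
def gibbsStates (𝒯 : Type*) [Fintype 𝒯] (n : ℕ) : Finset (Finset 𝒯) :=
  Finset.univ.filter fun 𝒬 => 𝒬.card ≤ n

noncomputable def gibbsTotal [Fintype 𝒯] (n : ℕ) (π : 𝒯 → ℝ) (η : ℝ) (f : 𝒯 → ι → NNReal)
    (J : Finset ι) : ℝ :=
  ∑ 𝒬 ∈ gibbsStates 𝒯 n, gibbsWeight π η f J 𝒬

/-- The Gibbs probability of a family of at most `n` directions. -/
noncomputable def gibbsProb [Fintype 𝒯] (n : ℕ) (π : 𝒯 → ℝ) (η : ℝ) (f : 𝒯 → ι → NNReal)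
    (J : Finset ι) (𝒬 : Finset 𝒯) : ℝ :=
  gibbsWeight π η f J 𝒬 / gibbsTotal n π η f J

variable {π : 𝒯 → ℝ} {η : ℝ} {f : 𝒯 → ι → NNReal} {J : Finset ι} {n : ℕ}

lemma gibbsWeight_pos (hπ : ∀ Q, 0 < π Q) (𝒬 : Finset 𝒯) : 0 < gibbsWeight π η f J 𝒬 :=
  mul_pos (Finset.prod_pos fun Q _ => hπ Q) (Real.exp_pos _)

lemma gibbsTotal_pos [Fintype 𝒯] (hπ : ∀ Q, 0 < π Q) : 0 < gibbsTotal n π η f J :=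
  Finset.sum_pos (fun 𝒬 _ => gibbsWeight_pos hπ 𝒬) ⟨∅, by simp [gibbsStates]⟩

lemma gibbsProb_nonneg [Fintype 𝒯] (hπ : ∀ Q, 0 < π Q) (𝒬 : Finset 𝒯) :
    0 ≤ gibbsProb n π η f J 𝒬 :=
  div_nonneg (gibbsWeight_pos hπ 𝒬).le (gibbsTotal_pos hπ).le

lemma sum_gibbsProb [Fintype 𝒯] (hπ : ∀ Q, 0 < π Q) :
    ∑ 𝒬 ∈ gibbsStates 𝒯 n, gibbsProb n π η f J 𝒬 = 1 := by
  unfold gibbsProb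
  rw [← Finset.sum_div]
  exact div_self (gibbsTotal_pos hπ).ne'

lemma cover_congr {f' : 𝒯 → ι → NNReal} {j : ι} {𝒬 : Finset 𝒯} (h : ∀ Q, f Q j = f' Q j) :
    cover f 𝒬 j = cover f' 𝒬 j := by
  simp [cover, h]

lemma gibbsProb_congr [Fintype 𝒯] {f' : 𝒯 → ι → NNReal} (h : ∀ Q, ∀ j ∈ J, f Q j = f' Q j)
    (𝒬 : Finset 𝒯) : gibbsProb n π η f J 𝒬 = gibbsProb n π η f' J 𝒬 := by
  have e : ∀ 𝒬, gibbsWeight π η f J 𝒬 = gibbsWeight π η f' J 𝒬 := fun 𝒬 => by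
    unfold gibbsWeight
    rw [Finset.sum_congr rfl fun j hj => ?_]
    rw [cover_congr fun Q => h Q j hj]
  simp [gibbsProb, gibbsTotal, e]

/-- Counting more points changes the Gibbs probability at most by the tilt of these points. -/
lemma gibbsProb_univ_le [Fintype 𝒯] [Fintype ι] [DecidableEq ι] (hπ : ∀ Q, 0 < π Q) (hη : 0 ≤ η)
    (𝒬 : Finset 𝒯) :
    gibbsProb n π η f Finset.univ 𝒬
      ≤ gibbsProb n π η f J 𝒬 * Real.exp (η * ∑ j ∈ Jᶜ, (cover f 𝒬 j : ℝ)) := by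
  have e : ∀ 𝒬, gibbsWeight π η f Finset.univ 𝒬
      = gibbsWeight π η f J 𝒬 * Real.exp (η * ∑ j ∈ Jᶜ, (cover f 𝒬 j : ℝ)) := fun 𝒬 => by
    unfold gibbsWeight
    rw [mul_assoc, ← Real.exp_add, ← mul_add, Finset.sum_add_sum_compl]
  -- Extra points only increase the normalising constant, so for an upper bound it can be replaced
  -- by the one for `J`.
  have hle : gibbsTotal n π η f J ≤ gibbsTotal n π η f Finset.univ := by
    refine Finset.sum_le_sum fun 𝒬 _ => ?_
    rw [e]
    refine le_mul_of_one_le_right (gibbsWeight_pos hπ 𝒬).le (Real.one_le_exp ?_)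
    exact mul_nonneg hη (Finset.sum_nonneg fun j _ => NNReal.coe_nonneg _)
  unfold gibbsProb
  rw [e, div_mul_eq_mul_div]
  exact div_le_div_of_nonneg_left
    (mul_nonneg (gibbsWeight_pos hπ 𝒬).le (Real.exp_pos _).le) (gibbsTotal_pos hπ) hle

/-- A family with more members than there are points has a member that is of no use. -/
lemma exists_cover_erase [DecidableEq 𝒯] (f : 𝒯 → ι → NNReal) {𝒬 : Finset 𝒯}
    (h : J.card < 𝒬.card) : ∃ Q ∈ 𝒬, ∀ j ∈ J, cover f (𝒬.erase Q) j = cover f 𝒬 j := by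
  classical
  by_contra! hcon
  -- If every member were needed, it would be the strict maximum at some point of `J`; these points
  -- would be distinct, too many for `J`.
  have h1 : ∀ Q ∈ 𝒬, ∃ j ∈ J, cover f (𝒬.erase Q) j < f Q j := by
    intro Q hQ
    obtain ⟨j, hj, hne⟩ := hcon Q hQ
    refine ⟨j, hj, ?_⟩
    by_contra! hle
    apply hne
    have : cover f 𝒬 j = max (f Q j) (cover f (𝒬.erase Q) j) := by
      unfold cover
      rw [← Finset.insert_erase hQ, Finset.sup_insert, Finset.erase_insert (Finset.notMem_erase _ _)]
    rw [this, max_eq_right hle]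
  obtain ⟨Q₀, hQ₀⟩ : 𝒬.Nonempty := Finset.card_pos.mp (by omega)
  have : Nonempty ι := ⟨(h1 Q₀ hQ₀).choose⟩
  choose! g hg hlt using h1
  obtain ⟨Q, hQ, Q', hQ', hne, heq⟩ := Finset.exists_ne_map_eq_of_card_lt_of_maps_to h hg
  have a1 : f Q' (g Q) < f Q (g Q) := lt_of_le_of_lt
    (Finset.le_sup (f := fun R => f R (g Q)) (Finset.mem_erase.mpr ⟨hne.symm, hQ'⟩)) (hlt Q hQ)
  have a2 : f Q (g Q') < f Q' (g Q') := lt_of_le_of_lt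
    (Finset.le_sup (f := fun R => f R (g Q')) (Finset.mem_erase.mpr ⟨hne, hQ⟩)) (hlt Q' hQ')
  rw [heq] at a1
  exact lt_asymm a1 a2

lemma sum_comp_le_sum {α β : Type*} {s : Finset α} {t : Finset β} {g : α → β} {F : β → ℝ}
    (hg : ∀ a ∈ s, g a ∈ t) (hinj : ∀ a ∈ s, ∀ b ∈ s, g a = g b → a = b) (hF : ∀ b ∈ t, 0 ≤ F b) :
    ∑ a ∈ s, F (g a) ≤ ∑ b ∈ t, F b := by
  classical
  rw [← Finset.sum_image (f := F) (g := g) fun a ha b hb h => hinj a ha b hb h]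
  refine Finset.sum_le_sum_of_subset_of_nonneg ?_ fun b hb _ => hF b hb
  intro b hb
  obtain ⟨a, ha, rfl⟩ := Finset.mem_image.mp hb
  exact hg a ha

/-- A family of full size `n > |J|` has a useless member `Q`. Erasing it keeps the exponent and only
removes the factor `π Q`, and erasure of a fixed `Q` is injective. Full families must be excluded
because the insertion argument of `gibbsProb_heavy_le` needs room for one more direction. -/
lemma gibbsProb_card_eq_le [Fintype 𝒯] [DecidableEq 𝒯] (hπ : ∀ Q, 0 < π Q) (hJ : J.card < n) :
    ∑ 𝒬 ∈ (gibbsStates 𝒯 n).filter (fun 𝒬 => 𝒬.card = n), gibbsProb n π η f J 𝒬 ≤ ∑ Q, π Q := by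
  classical
  have h1 : ∀ 𝒬 ∈ (gibbsStates 𝒯 n).filter (fun 𝒬 => 𝒬.card = n),
      gibbsProb n π η f J 𝒬 ≤ ∑ Q, if Q ∈ 𝒬 then π Q * gibbsProb n π η f J (𝒬.erase Q) else 0 := by
    intro 𝒬 h𝒬
    rw [Finset.mem_filter] at h𝒬
    obtain ⟨Q, hQ, hcov⟩ := exists_cover_erase (J := J) f (𝒬 := 𝒬) (by omega)
    have e : gibbsProb n π η f J 𝒬 = π Q * gibbsProb n π η f J (𝒬.erase Q) := by
      unfold gibbsProb gibbsWeight
      have e1 : ∑ j ∈ J, (cover f (𝒬.erase Q) j : ℝ) = ∑ j ∈ J, (cover f 𝒬 j : ℝ) :=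
        Finset.sum_congr rfl fun j hj => by rw [hcov j hj]
      rw [e1, ← Finset.mul_prod_erase _ _ hQ]
      ring
    rw [e]
    refine le_trans (le_of_eq ?_) (Finset.single_le_sum
      (f := fun Q => if Q ∈ 𝒬 then π Q * gibbsProb n π η f J (𝒬.erase Q) else 0)
      (fun Q' _ => ?_) (Finset.mem_univ Q))
    · simp [hQ]
    · split_ifs
      · exact mul_nonneg (hπ _).le (gibbsProb_nonneg hπ _)
      · exact le_rfl
  refine (Finset.sum_le_sum h1).trans ?_
  rw [Finset.sum_comm]
  refine Finset.sum_le_sum fun Q _ => ?_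
  rw [← Finset.sum_filter, ← Finset.mul_sum]
  refine mul_le_of_le_one_right (hπ Q).le ?_
  rw [← sum_gibbsProb (n := n) (η := η) (f := f) (J := J) hπ]
  refine sum_comp_le_sum (g := fun 𝒬 : Finset 𝒯 => 𝒬.erase Q) (fun 𝒬 h𝒬 => ?_) (fun 𝒬 h𝒬 𝒬' h𝒬' heq => ?_)
    (fun 𝒬 _ => gibbsProb_nonneg hπ 𝒬)
  · simp only [gibbsStates, Finset.mem_filter, Finset.mem_univ, true_and] at h𝒬 ⊢
    exact (Finset.card_erase_le).trans h𝒬.1.1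
  · rw [← Finset.insert_erase (Finset.mem_filter.mp h𝒬).2, heq,
      Finset.insert_erase (Finset.mem_filter.mp h𝒬').2]

/-- It is unlikely that the uncovered points are heavy in some direction. -/
lemma gibbsProb_heavy_le [Fintype 𝒯] [DecidableEq 𝒯] (hη : 0 ≤ η) (hπ : ∀ Q, 0 < π Q) (c : 𝒯 → ℝ)
    (hc : ∀ Q, 0 < c Q) :
    ∑ 𝒬 ∈ (gibbsStates 𝒯 n).filter (fun 𝒬 => 𝒬.card < n ∧
        ∃ Q, c Q ≤ η * ∑ j ∈ J with cover f 𝒬 j = 0, (f Q j : ℝ)), gibbsProb n π η f J 𝒬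
      ≤ ∑ Q, Real.exp (-c Q) / π Q := by
  classical
  have h1 : ∀ 𝒬 ∈ (gibbsStates 𝒯 n).filter (fun 𝒬 => 𝒬.card < n ∧
        ∃ Q, c Q ≤ η * ∑ j ∈ J with cover f 𝒬 j = 0, (f Q j : ℝ)),
      gibbsProb n π η f J 𝒬
        ≤ ∑ Q, if Q ∉ 𝒬 then Real.exp (-c Q) / π Q * gibbsProb n π η f J (insert Q 𝒬) else 0 := by
    intro 𝒬 h𝒬
    obtain ⟨-, -, Q, hQ⟩ := Finset.mem_filter.mp h𝒬
    have hQn : Q ∉ 𝒬 := by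
      intro hmem
      have : ∑ j ∈ J with cover f 𝒬 j = 0, (f Q j : ℝ) = 0 := by
        refine Finset.sum_eq_zero fun j hj => ?_
        have hj0 := (Finset.mem_filter.mp hj).2
        have : f Q j ≤ cover f 𝒬 j := Finset.le_sup (f := fun R => f R j) hmem
        rw [hj0] at this
        simp [le_antisymm this zero_le]
      rw [this, mul_zero] at hQ
      exact absurd (hc Q) (not_lt.mpr hQ)
    -- Points not yet covered gain their whole excess along `Q` when `Q` is inserted, so the weight
    -- grows at least by the factor `π Q * exp (c Q)`.
    have hcov : ∑ j ∈ J, (cover f 𝒬 j : ℝ) + ∑ j ∈ J with cover f 𝒬 j = 0, (f Q j : ℝ)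
        ≤ ∑ j ∈ J, (cover f (insert Q 𝒬) j : ℝ) := by
      rw [Finset.sum_filter, ← Finset.sum_add_distrib]
      refine Finset.sum_le_sum fun j _ => ?_
      have : cover f (insert Q 𝒬) j = max (f Q j) (cover f 𝒬 j) := by
        unfold cover; rw [Finset.sup_insert]
      rw [this]
      split_ifs with h
      · rw [h]; simp
      · simp
    have e : gibbsProb n π η f J 𝒬
        ≤ Real.exp (-c Q) / π Q * gibbsProb n π η f J (insert Q 𝒬) := by
      have hw : gibbsWeight π η f J 𝒬
          ≤ Real.exp (-c Q) / π Q * gibbsWeight π η f J (insert Q 𝒬) := by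
        unfold gibbsWeight
        rw [Finset.prod_insert hQn]
        have e1 : Real.exp (-c Q) / π Q * ((π Q * ∏ R ∈ 𝒬, π R)
              * Real.exp (η * ∑ j ∈ J, (cover f (insert Q 𝒬) j : ℝ)))
            = (∏ R ∈ 𝒬, π R)
              * Real.exp (-c Q + η * ∑ j ∈ J, (cover f (insert Q 𝒬) j : ℝ)) := by
          rw [Real.exp_add]
          field_simp [(hπ Q).ne']
        rw [e1]
        have := mul_le_mul_of_nonneg_left hcov hη
        refine mul_le_mul_of_nonneg_left (Real.exp_le_exp.mpr ?_)
          (Finset.prod_nonneg fun R _ => (hπ R).le)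
        linarith [mul_add η (∑ j ∈ J, (cover f 𝒬 j : ℝ))
          (∑ j ∈ J with cover f 𝒬 j = 0, (f Q j : ℝ))]
      unfold gibbsProb
      rw [← mul_div_assoc]
      exact div_le_div_of_nonneg_right hw (gibbsTotal_pos hπ).le
    refine e.trans (le_trans (le_of_eq ?_) (Finset.single_le_sum
      (f := fun Q => if Q ∉ 𝒬 then Real.exp (-c Q) / π Q * gibbsProb n π η f J (insert Q 𝒬) else 0)
      (fun Q' _ => ?_) (Finset.mem_univ Q)))
    · simp [hQn]
    · split_ifs
      · exact le_rfl
      · exact mul_nonneg (div_nonneg (Real.exp_pos _).le (hπ _).le) (gibbsProb_nonneg hπ _)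
  refine (Finset.sum_le_sum h1).trans ?_
  rw [Finset.sum_comm]
  refine Finset.sum_le_sum fun Q _ => ?_
  rw [← Finset.sum_filter, ← Finset.mul_sum]
  refine mul_le_of_le_one_right (div_nonneg (Real.exp_pos _).le (hπ Q).le) ?_
  rw [← sum_gibbsProb (n := n) (η := η) (f := f) (J := J) hπ]
  refine sum_comp_le_sum (g := fun 𝒬 : Finset 𝒯 => insert Q 𝒬) (fun 𝒬 h𝒬 => ?_)
    (fun 𝒬 h𝒬 𝒬' h𝒬' heq => ?_) (fun 𝒬 _ => gibbsProb_nonneg hπ 𝒬)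
  · simp only [gibbsStates, Finset.mem_filter, Finset.mem_univ, true_and] at h𝒬 ⊢
    exact (Finset.card_insert_le _ _).trans h𝒬.1.2.1
  · rw [← Finset.erase_insert (Finset.mem_filter.mp h𝒬).2, heq,
      Finset.erase_insert (Finset.mem_filter.mp h𝒬').2]

end Gibbs

end

/-! ### Excess and typicality of clean points. -/

section

variable {d n : ℕ} {Λ : ℝ}

/-- The squared normalised correlation of `x` with the direction `v`, if it is untypically large. -/
noncomputable def excess (Λ : ℝ) (v x : E d) : NNReal :=
  if Λ ^ 4 * ‖v‖ < |inner ℝ x v| then (inner ℝ x v ^ 2 / ‖v‖ ^ 2).toNNReal else 0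

lemma measurable_excess (Λ : ℝ) {X : Type*} [MeasurableSpace X] {v x : X → E d}
    (hv : Measurable v) (hx : Measurable x) : Measurable fun a => excess Λ (v a) (x a) := by
  unfold excess
  exact Measurable.ite (measurableSet_lt (by fun_prop) (by fun_prop)) (by fun_prop) (by fun_prop)

/-- The tilt of a point with excess `t`, counted only when the excess is nonzero. -/
noncomputable def tilt (t : NNReal) : ℝ≥0∞ :=
  if t = 0 then 0 else ENNReal.ofReal (Real.exp (1 / 64 * t))

lemma measurable_finset_sup {ι X : Type*} [MeasurableSpace X] (s : Finset ι) {f : ι → X → NNReal}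
    (hf : ∀ i, Measurable (f i)) : Measurable fun a => s.sup fun i => f i a := by
  classical
  induction s using Finset.induction_on with
  | empty => simp
  | insert i s _ ih => simpa only [Finset.sup_insert] using (hf i).max ih

lemma measurable_tilt : Measurable tilt :=
  Measurable.ite (measurableSet_singleton 0) measurable_const (by fun_prop)

lemma exp_le_one_add_tilt (t : NNReal) : ENNReal.ofReal (Real.exp (1 / 64 * t)) ≤ 1 + tilt t := by
  unfold tilt
  split_ifs with h
  · simp [h]
  · exact le_add_self

/-- The mean accounts for at most three quarters of the threshold, so an excess `t²` forces a
Gaussian part `ξ ≥ t / 4`. Then `ξ² / 4` pays for the tilt `t² / 64`, and the remaining `ξ² / 8 ≥ t²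
/ 128 ≥ Λ ^ 8 / 128` is the gain. -/
lemma lintegral_tilt_excess_le (hΛ : 1 ≤ Λ) {μ v : E d}
    (h : |inner ℝ μ v| ≤ 3 / 4 * Λ ^ 4 * ‖v‖) :
    ∫⁻ z, tilt (excess Λ v (μ + z)) ∂(stdGaussian (E d))
      ≤ ENNReal.ofReal (2 * Real.exp (-Λ ^ 8 / 128)) := by
  rcases eq_or_ne v 0 with rfl | hv
  · simp [excess, tilt]
  have hv0 : 0 < ‖v‖ := norm_pos_iff.mpr hv
  have key : ∀ z, tilt (excess Λ v (μ + z)) ≤ ENNReal.ofReal (Real.exp (-Λ ^ 8 / 128))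
      * ENNReal.ofReal (Real.exp (3 / 8 * (inner ℝ z v / ‖v‖) ^ 2)) := by
    intro z
    unfold tilt
    split_ifs with h0
    · exact zero_le
    have h1 : Λ ^ 4 * ‖v‖ < |inner ℝ (μ + z) v| := by
      by_contra hcon
      exact h0 (by simp [excess, hcon])
    rw [← ENNReal.ofReal_mul (Real.exp_pos _).le, ← Real.exp_add]
    refine ENNReal.ofReal_le_ofReal (Real.exp_le_exp.mpr ?_)
    simp only [excess, h1, if_true]
    rw [Real.coe_toNNReal _ (by positivity)]
    set t := |inner ℝ (μ + z) v| / ‖v‖ with ht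
    set ξ := |inner ℝ z v| / ‖v‖ with hξ
    have e1 : inner ℝ (μ + z) v ^ 2 / ‖v‖ ^ 2 = t ^ 2 := by rw [ht, div_pow, sq_abs]
    have e2 : (inner ℝ z v / ‖v‖) ^ 2 = ξ ^ 2 := by rw [hξ, div_pow, div_pow, sq_abs]
    have ht1 : Λ ^ 4 < t := by rw [ht, lt_div_iff₀ hv0]; exact h1
    have hξt : t ≤ 4 * ξ := by
      have a1 : |inner ℝ (μ + z) v| ≤ |inner ℝ μ v| + |inner ℝ z v| := by
        rw [inner_add_left]; exact abs_add_le _ _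
      have a2 : t * ‖v‖ ≤ 3 / 4 * Λ ^ 4 * ‖v‖ + ξ * ‖v‖ := by
        rw [ht, hξ, div_mul_cancel₀ _ hv0.ne', div_mul_cancel₀ _ hv0.ne']; linarith
      have a3 : t ≤ 3 / 4 * Λ ^ 4 + ξ := le_of_mul_le_mul_right (by linarith) hv0
      linarith
    rw [e1, e2]
    have hΛ4 : 0 < Λ ^ 4 := by positivity
    have b1 : t ^ 2 ≤ 16 * ξ ^ 2 := by nlinarith
    have b2 : Λ ^ 8 ≤ t ^ 2 := by
      calc Λ ^ 8 = Λ ^ 4 * Λ ^ 4 := by ring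
        _ ≤ t * t := by gcongr
        _ = t ^ 2 := by ring
    nlinarith
  calc _ ≤ ∫⁻ z, ENNReal.ofReal (Real.exp (-Λ ^ 8 / 128))
        * ENNReal.ofReal (Real.exp (3 / 8 * (inner ℝ z v / ‖v‖) ^ 2)) ∂(stdGaussian (E d)) :=
        lintegral_mono key
    _ = _ := by
        rw [lintegral_const_mul _ (by fun_prop), lintegral_exp_sq_inner hv,
          ENNReal.ofReal_mul (by norm_num), mul_comm]
        simp

lemma tilt_sup_le {𝒯 : Type*} (𝒬 : Finset 𝒯) (g : 𝒯 → NNReal) :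
    tilt (𝒬.sup g) ≤ ∑ Q ∈ 𝒬, tilt (g Q) := by
  rcases eq_or_ne (𝒬.sup g) 0 with h | h
  · simp [h, tilt]
  have hne : 𝒬.Nonempty := by
    by_contra hcon
    rw [Finset.not_nonempty_iff_eq_empty] at hcon
    simp [hcon] at h
  obtain ⟨Q, hQ, hsup⟩ := Finset.exists_mem_eq_sup 𝒬 hne g
  rw [hsup]
  exact Finset.single_le_sum (f := fun Q => tilt (g Q)) (fun _ _ => zero_le) hQ

/-- If no direction of `𝒬` correlates much with the mean, then clean points rarely have excess. -/
lemma lintegral_tilt_clean_le {𝒯 : Type*} (hΛ : 6 ≤ Λ) (hn : (n : ℝ) ≤ Real.exp (Λ / 2))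
    (J : Finset (Fin n)) (y : Fin n → E d) (μ : E d) (v : 𝒯 → E d) (𝒬 : Finset 𝒯)
    (hcard : 𝒬.card ≤ n) (h : ∀ Q ∈ 𝒬, |inner ℝ μ (v Q)| ≤ 3 / 4 * Λ ^ 4 * ‖v Q‖) :
    ∫⁻ z, (if ∀ j ∉ J, cover (fun Q j => excess Λ (v Q) (mixPts J y (fun _ => μ) z j)) 𝒬 j = 0 then 0
        else ENNReal.ofReal (Real.exp (1 / 64 * ∑ j ∈ Jᶜ,
          (cover (fun Q j => excess Λ (v Q) (mixPts J y (fun _ => μ) z j)) 𝒬 j : ℝ))))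
        ∂(Measure.pi fun _ : Fin n => stdGaussian (E d))
      ≤ ENNReal.ofReal (Real.exp (-2 * Λ)) := by
  classical
  set g : E d → NNReal := fun z => 𝒬.sup fun Q => excess Λ (v Q) (μ + z) with hg
  have hgm : Measurable g := by
    exact measurable_finset_sup _ fun Q => measurable_excess Λ measurable_const (by fun_prop)
  have htm : Measurable fun z => tilt (g z) := measurable_tilt.comp hgm
  obtain ⟨δ, hδ⟩ : ∃ δ : ℝ, δ = n * (2 * Real.exp (-Λ ^ 8 / 128)) := ⟨_, rfl⟩
  have hδ0 : 0 ≤ δ := by rw [hδ]; positivity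
  have hD : ∫⁻ z, tilt (g z) ∂(stdGaussian (E d)) ≤ ENNReal.ofReal δ := by
    calc _ ≤ ∫⁻ z, ∑ Q ∈ 𝒬, tilt (excess Λ (v Q) (μ + z)) ∂(stdGaussian (E d)) :=
          lintegral_mono fun z => tilt_sup_le _ _
      _ = ∑ Q ∈ 𝒬, ∫⁻ z, tilt (excess Λ (v Q) (μ + z)) ∂(stdGaussian (E d)) :=
          lintegral_finsetSum _ fun Q _ => measurable_tilt.comp
            (measurable_excess Λ measurable_const (by fun_prop))
      _ ≤ ∑ _Q ∈ 𝒬, ENNReal.ofReal (2 * Real.exp (-Λ ^ 8 / 128)) :=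
          Finset.sum_le_sum fun Q hQ => lintegral_tilt_excess_le (by linarith) (h Q hQ)
      _ = 𝒬.card * ENNReal.ofReal (2 * Real.exp (-Λ ^ 8 / 128)) := by simp
      _ ≤ n * ENNReal.ofReal (2 * Real.exp (-Λ ^ 8 / 128)) := by gcongr
      _ = ENNReal.ofReal δ := by
          rw [hδ, ENNReal.ofReal_mul (Nat.cast_nonneg n), ENNReal.ofReal_natCast]
  have hcov : ∀ z : Fin n → E d, ∀ j ∉ J,
      cover (fun Q j => excess Λ (v Q) (mixPts J y (fun _ => μ) z j)) 𝒬 j = g (z j) := by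
    intro z j hj
    simp [cover, hg, mixPts, hj]
  -- Some clean point `i` has excess and contributes its tilt; any other clean point contributes at
  -- most `1 + tilt`. Summing over `i` gives products over independent points.
  set G : Fin n → Fin n → E d → ℝ≥0∞ := fun i j z =>
    if j ∈ J then 1 else if j = i then tilt (g z) else 1 + tilt (g z) with hG
  have hGm : ∀ i j, Measurable (G i j) := by
    intro i j
    simp only [hG]
    split_ifs
    · exact measurable_const
    · exact htm
    · exact measurable_const.add htm
  have hpt : ∀ z : Fin n → E d,
      (if ∀ j ∉ J, cover (fun Q j => excess Λ (v Q) (mixPts J y (fun _ => μ) z j)) 𝒬 j = 0 then 0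
        else ENNReal.ofReal (Real.exp (1 / 64 * ∑ j ∈ Jᶜ,
          (cover (fun Q j => excess Λ (v Q) (mixPts J y (fun _ => μ) z j)) 𝒬 j : ℝ))))
      ≤ ∑ i ∈ Jᶜ, ∏ j, G i j (z j) := by
    intro z
    split_ifs with h0
    · exact zero_le
    push Not at h0
    obtain ⟨i, hi, hne⟩ := h0
    rw [hcov z i hi] at hne
    refine le_trans ?_ (Finset.single_le_sum (f := fun i => ∏ j, G i j (z j)) (fun _ _ => zero_le)
      (Finset.mem_compl.mpr hi))
    rw [Finset.mul_sum, Real.exp_sum, ENNReal.ofReal_prod_of_nonneg fun _ _ => (Real.exp_pos _).le,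
      ← Finset.prod_subset (Finset.subset_univ Jᶜ) fun j _ hj => by
        simp only [hG]; rw [if_pos (by simpa using hj)]]
    refine Finset.prod_le_prod' fun j hj => ?_
    have hj' : j ∉ J := by simpa using hj
    rw [hcov z j hj']
    simp only [hG, hj', if_false]
    split_ifs with hji
    · subst hji; simp [tilt, hne]
    · exact exp_le_one_add_tilt _
  calc _ ≤ ∫⁻ z, ∑ i ∈ Jᶜ, ∏ j, G i j (z j) ∂(Measure.pi fun _ : Fin n => stdGaussian (E d)) :=
        lintegral_mono hpt
    _ = ∑ i ∈ Jᶜ, ∏ j, ∫⁻ z, G i j z ∂(stdGaussian (E d)) := by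
        rw [lintegral_finsetSum _ fun i _ => Finset.measurable_fun_prod _ fun j _ =>
          show Measurable fun z : Fin n → E d => G i j (z j) from
            (hGm i j).comp (measurable_pi_apply j)]
        exact Finset.sum_congr rfl fun i _ => lintegral_pi_prod _ _ (hGm i)
    _ ≤ ∑ _i ∈ Jᶜ, ENNReal.ofReal δ * (1 + ENNReal.ofReal δ) ^ n := by
        refine Finset.sum_le_sum fun i hi => ?_
        have hi' : i ∉ J := by simpa using hi
        rw [← Finset.mul_prod_erase _ _ (Finset.mem_univ i)]
        refine mul_le_mul' ?_ ?_
        · simpa only [hG, hi', if_false, if_true] using hD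
        · have hle : ∀ j ∈ Finset.univ.erase i, ∫⁻ z, G i j z ∂(stdGaussian (E d))
              ≤ 1 + ENNReal.ofReal δ := by
            intro j hj
            have hji : j ≠ i := (Finset.mem_erase.mp hj).1
            by_cases hjJ : j ∈ J
            · simp [hG, hjJ]
            · simp only [hG, hjJ, hji, if_false]
              rw [lintegral_add_left measurable_const]
              simpa using hD
          refine (Finset.prod_le_prod' hle).trans ?_
          rw [Finset.prod_const]
          refine pow_le_pow_right₀ le_self_add ?_
          exact (Finset.card_le_univ _).trans (by simp)
    _ ≤ n * (ENNReal.ofReal δ * (1 + ENNReal.ofReal δ) ^ n) := by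
        rw [Finset.sum_const, nsmul_eq_mul]
        gcongr
        exact_mod_cast (Finset.card_le_univ _).trans (by simp)
    _ = ENNReal.ofReal (n * (δ * (1 + δ) ^ n)) := by
        rw [ENNReal.ofReal_mul (Nat.cast_nonneg n), ENNReal.ofReal_mul hδ0, ENNReal.ofReal_natCast,
          ENNReal.ofReal_pow (by positivity), ENNReal.ofReal_add (by norm_num) hδ0]
        simp
    _ ≤ _ := by
        refine ENNReal.ofReal_le_ofReal ?_
        have hΛ8 : 2000 * Λ ≤ Λ ^ 8 / 128 := by
          have : (6 : ℝ) ^ 7 ≤ Λ ^ 7 := by gcongr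
          have : 256000 * Λ ≤ Λ ^ 7 * Λ := by
            refine mul_le_mul_of_nonneg_right ?_ (by linarith)
            refine le_trans ?_ this
            norm_num
          nlinarith
        have hδ1 : n * δ ≤ 2 * Real.exp (-1999 * Λ) := by
          calc n * δ = n * n * (2 * Real.exp (-Λ ^ 8 / 128)) := by rw [hδ]; ring
            _ ≤ Real.exp (Λ / 2) * Real.exp (Λ / 2) * (2 * Real.exp (-2000 * Λ)) := by
                gcongr; linarith
            _ = 2 * Real.exp (Λ / 2 + Λ / 2 + -2000 * Λ) := by
                rw [Real.exp_add, Real.exp_add]; ring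
            _ = _ := by congr 2; ring
        have hexp : ∀ t : ℝ, t ≤ -1 → 2 * Real.exp t ≤ 1 := by
          intro t ht
          have : Real.exp t ≤ Real.exp (-1) := Real.exp_le_exp.mpr ht
          have h2 : Real.exp (-1) ≤ 1 / 2 := by
            rw [Real.exp_neg, inv_le_comm₀ (Real.exp_pos _) (by norm_num)]
            have := Real.add_one_le_exp (1 : ℝ)
            norm_num; linarith
          linarith
        have hle1 : n * δ ≤ 1 := hδ1.trans (hexp _ (by linarith))
        have hpow : (1 + δ) ^ n ≤ Real.exp 1 := by
          calc (1 + δ) ^ n ≤ Real.exp δ ^ n := by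
                gcongr; rw [add_comm]; exact Real.add_one_le_exp δ
            _ = Real.exp (n * δ) := by rw [← Real.exp_nat_mul]
            _ ≤ _ := Real.exp_le_exp.mpr hle1
        calc n * (δ * (1 + δ) ^ n) = (n * δ) * (1 + δ) ^ n := by ring
          _ ≤ (2 * Real.exp (-1999 * Λ)) * Real.exp 1 := by gcongr
          _ = (2 * Real.exp (-1997 * Λ + 1)) * Real.exp (-2 * Λ) := by
              rw [mul_assoc, mul_assoc, ← Real.exp_add, ← Real.exp_add]; congr 2; ring
          _ ≤ 1 * Real.exp (-2 * Λ) := by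
              gcongr
              exact hexp _ (by linarith)
          _ = _ := one_mul _

lemma measure_inner_gt (v : E d) {r : ℝ} (hr : 0 ≤ r) :
    stdGaussian (E d) {z | r * ‖v‖ < |inner ℝ z v|} ≤ ENNReal.ofReal (2 * Real.exp (-r ^ 2 / 2)) := by
  have h := measure_sum_inner_gt (Finset.univ : Finset (Fin 1)) v hr
  have hmeas : MeasurableSet {z : E d | r * ‖v‖ < |inner ℝ z v|} :=
    measurableSet_lt measurable_const (by fun_prop)
  rw [← (measurePreserving_eval (fun _ : Fin 1 => stdGaussian (E d)) 0).measure_preimage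
    hmeas.nullMeasurableSet]
  refine le_trans (le_of_eq ?_) h
  congr 1
  ext z
  simp

/-- The point `z` has a typical norm and is nearly orthogonal to the vectors of `𝒰`. -/
def Typical (Λ : ℝ) (𝒰 : Finset (E d)) (z : E d) : Prop :=
  |‖z‖ ^ 2 - d| ≤ Λ ^ 3 * √d ∧ ∀ u ∈ 𝒰, |inner ℝ z u| ≤ Λ * ‖u‖

lemma measurableSet_typical (Λ : ℝ) (𝒰 : Finset (E d)) : MeasurableSet {z | Typical Λ 𝒰 z} := by
  have : {z : E d | Typical Λ 𝒰 z} = {z | |‖z‖ ^ 2 - d| ≤ Λ ^ 3 * √d} ∩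
      ⋂ u ∈ 𝒰, {z | |inner ℝ z u| ≤ Λ * ‖u‖} := by
    ext; simp [Typical]
  rw [this]
  exact (measurableSet_le (by fun_prop) measurable_const).inter
    (Finset.measurableSet_biInter _ fun u _ => measurableSet_le (by fun_prop) measurable_const)

lemma measure_not_typical_le (hΛ : 6 ≤ Λ) (hd : 0 < d) (𝒰 : Finset (E d)) :
    stdGaussian (E d) {z | ¬ Typical Λ 𝒰 z}
      ≤ ENNReal.ofReal ((3 + 2 * 𝒰.card) * Real.exp (-3 * Λ)) := by
  have hsub : {z : E d | ¬ Typical Λ 𝒰 z} ⊆ {z | Λ ^ 3 * √d < |‖z‖ ^ 2 - d|} ∪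
      ⋃ u ∈ 𝒰, {z | Λ * ‖u‖ < |inner ℝ z u|} := by
    intro z hz
    by_contra hcon
    simp only [Set.mem_union, Set.mem_iUnion, exists_prop, not_or, not_exists, not_and] at hcon
    exact hz ⟨not_lt.mp hcon.1, fun u hu => not_lt.mp (hcon.2 u hu)⟩
  refine (measure_mono hsub).trans ((measure_union_le _ _).trans ?_)
  refine (add_le_add (measure_norm_sq_gt hd _) ((measure_biUnion_finset_le _ _).trans
    (Finset.sum_le_sum fun u _ => measure_inner_gt u (by linarith)))).trans ?_
  rw [Finset.sum_const, nsmul_eq_mul, ← ENNReal.ofReal_natCast, ← ENNReal.ofReal_mul (by positivity),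
    ← ENNReal.ofReal_add (by positivity) (by positivity)]
  refine ENNReal.ofReal_le_ofReal ?_
  have e1 : Real.exp (-Λ ^ 3 / 4) ≤ Real.exp (-3 * Λ) := by
    apply Real.exp_le_exp.mpr
    nlinarith [mul_nonneg (show 0 ≤ Λ by linarith) (show 0 ≤ Λ ^ 2 - 36 by nlinarith)]
  have e2 : Real.exp (-Λ ^ 2 / 2) ≤ Real.exp (-3 * Λ) := by
    apply Real.exp_le_exp.mpr
    nlinarith
  have : (0 : ℝ) ≤ 𝒰.card := by positivity
  nlinarith

open Classical in
/-- Untypical points are rare among the clean validation points. -/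
lemma measure_many_untypical_le (hΛ : 6 ≤ Λ) (hd : 0 < d) {W : ℕ} (hW : 0 < W) (V : Finset (Fin W))
    (𝒰 : Finset (E d)) :
    (Measure.pi fun _ : Fin W => stdGaussian (E d))
      {z | W ≤ 20 * (V.filter fun i => ¬ Typical Λ 𝒰 (z i)).card}
      ≤ ENNReal.ofReal (20 * ((3 + 2 * 𝒰.card) * Real.exp (-3 * Λ))) := by
  set P := Measure.pi fun _ : Fin W => stdGaussian (E d) with hP
  set F : (Fin W → E d) → ℝ≥0∞ := fun z =>
    ∑ i ∈ V, Set.indicator {z : E d | ¬ Typical Λ 𝒰 z} 1 (z i) with hF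
  have hms : MeasurableSet {z : E d | ¬ Typical Λ 𝒰 z} := (measurableSet_typical Λ 𝒰).compl
  have hmi : Measurable (Set.indicator {z : E d | ¬ Typical Λ 𝒰 z} (1 : E d → ℝ≥0∞)) :=
    measurable_one.indicator hms
  have hFm : Measurable F := Finset.measurable_fun_sum _ fun i _ => hmi.comp (measurable_pi_apply i)
  have hint : ∫⁻ z, F z ∂P ≤ W * ENNReal.ofReal ((3 + 2 * 𝒰.card) * Real.exp (-3 * Λ)) := by
    rw [lintegral_finsetSum _ fun i _ => show Measurable fun z : Fin W → E d =>
      Set.indicator {z : E d | ¬ Typical Λ 𝒰 z} (1 : E d → ℝ≥0∞) (z i) from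
        hmi.comp (measurable_pi_apply i)]
    calc _ ≤ ∑ _i ∈ V, ENNReal.ofReal ((3 + 2 * 𝒰.card) * Real.exp (-3 * Λ)) := by
          refine Finset.sum_le_sum fun i _ => ?_
          rw [hP, (measurePreserving_eval (fun _ : Fin W => stdGaussian (E d)) i).lintegral_comp hmi,
            lintegral_indicator_one hms]
          exact measure_not_typical_le hΛ hd 𝒰
      _ ≤ _ := by
          rw [Finset.sum_const, nsmul_eq_mul]
          gcongr
          exact_mod_cast (Finset.card_le_univ _).trans (by simp)
  have hFcard : ∀ z, F z = ((V.filter fun i => ¬ Typical Λ 𝒰 (z i)).card : ℝ≥0∞) := by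
    intro z
    simp only [hF, Set.indicator_apply, Set.mem_ofPred_eq, Pi.one_apply]
    rw [← Finset.sum_filter]
    simp
  have hmarkov := mul_meas_ge_le_lintegral (μ := P) (hFm.const_mul 20) (W : ℝ≥0∞)
  rw [lintegral_const_mul _ hFm] at hmarkov
  have hW0 : (W : ℝ≥0∞) ≠ 0 := by exact_mod_cast hW.ne'
  have hset : {z : Fin W → E d | W ≤ 20 * (V.filter fun i => ¬ Typical Λ 𝒰 (z i)).card}
      = {z | (W : ℝ≥0∞) ≤ 20 * F z} := by
    ext z
    simp only [Set.mem_ofPred_eq, hFcard]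
    exact_mod_cast Iff.rfl
  rw [hset]
  rw [← ENNReal.mul_le_mul_iff_right hW0 (ENNReal.natCast_ne_top W)]
  refine hmarkov.trans ?_
  calc 20 * ∫⁻ z, F z ∂P ≤ 20 * (W * ENNReal.ofReal ((3 + 2 * 𝒰.card) * Real.exp (-3 * Λ))) := by
        gcongr
    _ = _ := by
        rw [ENNReal.ofReal_mul (p := 20) (by norm_num)]
        simp
        ring

end

/-! ### One batch: detection by validation points and removal of points. -/

section

variable {d n W : ℕ} {Λ : ℝ} {𝒯 : Type*}

/-- The squared norm of `x` is close to `d`. -/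
def NormTypical (Λ : ℝ) (x : E d) : Prop := |‖x‖ ^ 2 - d| ≤ Λ ^ 8 * √d

open Classical in
/-- More than half of the points satisfy `P`. -/
def Majority (x : Fin W → E d) (P : E d → Prop) : Prop :=
  W < 2 * (Finset.univ.filter fun i => P (x i)).card

/-- The validation points `xV` show a mean that is correlated with one of the relevant vectors. -/
def Detects (Λ : ℝ) (v : 𝒯 → E d) (𝒬 : Finset 𝒯) (xA : Fin n → E d) (xV : Fin W → E d) : Prop :=
  Majority xV (fun x => Λ ^ 8 * √d / 8 < |‖x‖ ^ 2 - d|) ∨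
  (∃ j, NormTypical Λ (xA j) ∧ Majority xV (fun x => Λ ^ 8 * √d / 2 < |inner ℝ x (xA j)|)) ∨
  ∃ Q ∈ 𝒬, Majority xV (fun x => Λ ^ 4 / 2 * ‖v Q‖ < |inner ℝ x (v Q)|)

/-- The points which are replaced by fresh Gaussian points. -/
def Removed (Λ : ℝ) (v : 𝒯 → E d) (𝒬 : Finset 𝒯) (xA : Fin n → E d) (i : Fin n) : Prop :=
  ¬ NormTypical Λ (xA i) ∨
  (∃ j, j ≠ i ∧ NormTypical Λ (xA i) ∧ NormTypical Λ (xA j) ∧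
    Λ ^ 8 * √d < |inner ℝ (xA i) (xA j)|) ∨
  cover (fun Q j => excess Λ (v Q) (xA j)) 𝒬 i ≠ 0

/-- The bad points that are removed on account of the bad points `J` alone. -/
def RemovedBy (Λ : ℝ) (v : 𝒯 → E d) (𝒬 : Finset 𝒯) (J : Finset (Fin n)) (y : Fin n → E d)
    (i : Fin n) : Prop :=
  ¬ NormTypical Λ (y i) ∨
  (∃ j ∈ J, j ≠ i ∧ NormTypical Λ (y i) ∧ NormTypical Λ (y j) ∧
    Λ ^ 8 * √d < |inner ℝ (y i) (y j)|) ∨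
  cover (fun Q j => excess Λ (v Q) (y j)) 𝒬 i ≠ 0

open Classical in
noncomputable def cleaned (Λ : ℝ) (v : 𝒯 → E d) (𝒬 : Finset 𝒯) (xA g : Fin n → E d) : Fin n → E d :=
  fun i => if Removed Λ v 𝒬 xA i then g i else xA i

-- This process sees only the bad points and the independent points `g`, so an oblivious adversary
-- could carry it out. `cleaned` agrees with it outside rare events (`cleaned_mixPts_eq`).
open Classical in
noncomputable def cleanedBad (Λ : ℝ) (v : 𝒯 → E d) (𝒬 : Finset 𝒯) (J : Finset (Fin n))
    (y g : Fin n → E d) : Fin n → E d :=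
  fun i => if RemovedBy Λ v 𝒬 J y i then g i else y i

/-- The mean `μ` is so large or so correlated with one of the relevant vectors that clean points
might be removed. -/
def Vulnerable (Λ : ℝ) (v : 𝒯 → E d) (𝒬 : Finset 𝒯) (J : Finset (Fin n)) (y : Fin n → E d)
    (μ : E d) : Prop :=
  Λ ^ 8 * √d / 4 < ‖μ‖ ^ 2 ∨
  (∃ j ∈ J, NormTypical Λ (y j) ∧ 3 / 4 * (Λ ^ 8 * √d) < |inner ℝ μ (y j)|) ∨
  ∃ Q ∈ 𝒬, 3 / 4 * Λ ^ 4 * ‖v Q‖ < |inner ℝ μ (v Q)|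

lemma NormTypical.norm_le (hΛ : 6 ≤ Λ) (hd : 0 < d) {x : E d} (h : NormTypical Λ x) :
    ‖x‖ ≤ 2 * Λ ^ 4 * √d := by
  have hd1 : (1 : ℝ) ≤ d := by exact_mod_cast hd
  have hd2 : √(d : ℝ) ^ 2 = d := Real.sq_sqrt (by positivity)
  have hs : 1 ≤ √(d : ℝ) := Real.one_le_sqrt.mpr hd1
  have h1 := (abs_le.mp h).2
  have e7 : (1 : ℝ) ≤ Λ ^ 8 := one_le_pow₀ (by linarith)
  have e1 : Λ ^ 8 * √d ≤ Λ ^ 8 * d := by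
    refine mul_le_mul_of_nonneg_left ?_ (by positivity)
    nlinarith
  have e2 : (d : ℝ) ≤ Λ ^ 8 * d := le_mul_of_one_le_left (by positivity) e7
  refine le_of_sq_le_sq ?_ (by positivity)
  have : (2 * Λ ^ 4 * √(d : ℝ)) ^ 2 = 4 * (Λ ^ 8 * d) := by rw [mul_pow, mul_pow, hd2]; ring
  rw [this]
  nlinarith

lemma scale_bounds (hΛ : 6 ≤ Λ) : 7776 * Λ ^ 3 ≤ Λ ^ 8 ∧ 216 * Λ ^ 5 ≤ Λ ^ 8 ∧ 216 * Λ ≤ Λ ^ 4 := by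
  have h0 : 0 ≤ Λ := by linarith
  have h3 : (216 : ℝ) ≤ Λ ^ 3 := by
    calc (216 : ℝ) = 6 ^ 3 := by norm_num
      _ ≤ Λ ^ 3 := by gcongr
  have h5 : (7776 : ℝ) ≤ Λ ^ 5 := by
    calc (7776 : ℝ) = 6 ^ 5 := by norm_num
      _ ≤ Λ ^ 5 := by gcongr
  refine ⟨?_, ?_, ?_⟩
  · calc 7776 * Λ ^ 3 ≤ Λ ^ 5 * Λ ^ 3 := by gcongr
      _ = Λ ^ 8 := by ring
  · calc 216 * Λ ^ 5 ≤ Λ ^ 3 * Λ ^ 5 := by gcongr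
      _ = Λ ^ 8 := by ring
  · calc 216 * Λ ≤ Λ ^ 3 * Λ := by gcongr
      _ = Λ ^ 4 := by ring

lemma NormTypical.mul_norm_le (hΛ : 6 ≤ Λ) (hd : 0 < d) {x : E d} (h : NormTypical Λ x) :
    Λ * ‖x‖ ≤ Λ ^ 8 * √d / 108 := by
  have := h.norm_le hΛ hd
  calc Λ * ‖x‖ ≤ Λ * (2 * Λ ^ 4 * √d) := mul_le_mul_of_nonneg_left this (by linarith)
    _ = (216 * Λ ^ 5) * √d / 108 := by ring
    _ ≤ _ := by
        have := (scale_bounds hΛ).2.1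
        gcongr

/-- The hypothesis forces `‖μ‖ ≥ 108 Λ`, so in the expansion of `‖μ + z‖²` the cross term is at most
`‖μ‖² / 54` and `‖μ‖²` dominates. -/
lemma norm_deviation_of_large_mean (hΛ : 6 ≤ Λ) (hd : 0 < d) {μ z : E d}
    (hμ : Λ ^ 8 * √d / 4 < ‖μ‖ ^ 2) (hz : |‖z‖ ^ 2 - d| ≤ Λ ^ 3 * √d)
    (hzμ : |inner ℝ z μ| ≤ Λ * ‖μ‖) : Λ ^ 8 * √d / 8 < |‖μ + z‖ ^ 2 - d| := by
  have hs : 1 ≤ √(d : ℝ) := Real.one_le_sqrt.mpr (by exact_mod_cast hd)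
  obtain ⟨b1, b2, b3⟩ := scale_bounds hΛ
  have hM : 108 * Λ ≤ ‖μ‖ := by
    by_contra! hlt
    have e1 : ‖μ‖ ^ 2 ≤ (108 * Λ) ^ 2 := by gcongr
    have e2 : (108 * Λ) ^ 2 * 4 ≤ Λ ^ 8 := by
      calc (108 * Λ) ^ 2 * 4 = (216 * Λ) ^ 2 := by ring
        _ ≤ (Λ ^ 4) ^ 2 := by gcongr
        _ = Λ ^ 8 := by ring
    have e3 : Λ ^ 8 ≤ Λ ^ 8 * √d := le_mul_of_one_le_right (by positivity) hs
    linarith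
  have e1 : 2 * (Λ * ‖μ‖) ≤ ‖μ‖ ^ 2 / 54 := by nlinarith [norm_nonneg μ]
  have e2 : 7776 * (Λ ^ 3 * √d) ≤ Λ ^ 8 * √d := by
    rw [← mul_assoc]; gcongr
  refine lt_of_lt_of_le ?_ (le_abs_self _)
  rw [norm_add_sq_real, real_inner_comm]
  have h1 := (abs_le.mp hz).1
  have h2 := (abs_le.mp hzμ).1
  have h3 : 0 < Λ ^ 8 * √d := by positivity
  linarith

/-- At most `9/20` of the validation points are bad and less than `1/20` of them are clean and
untypical, so more than half are clean and typical. -/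
lemma majority_of_typical {𝒰 : Finset (E d)} {V : Finset (Fin W)} {yV zV : Fin W → E d} {μ : E d}
    {P : E d → Prop} (hV : 20 * V.card ≤ 9 * W)
    (hfew : ∀ [DecidablePred fun i => ¬ Typical Λ 𝒰 (zV i)],
      20 * (Vᶜ.filter fun i => ¬ Typical Λ 𝒰 (zV i)).card < W)
    (hP : ∀ z, Typical Λ 𝒰 z → P (μ + z)) : Majority (mixPts V yV (fun _ => μ) zV) P := by
  classical
  unfold Majority
  have h1 : (Vᶜ.filter fun i => Typical Λ 𝒰 (zV i)).card
      ≤ (Finset.univ.filter fun i => P (mixPts V yV (fun _ => μ) zV i)).card := by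
    refine Finset.card_le_card fun i hi => ?_
    simp only [Finset.mem_filter, Finset.mem_compl, Finset.mem_univ, true_and] at hi ⊢
    simpa [mixPts, hi.1] using hP _ hi.2
  have h2 := Finset.card_filter_add_card_filter_not (s := Vᶜ) (fun i => Typical Λ 𝒰 (zV i))
  have h3 := Finset.card_add_card_compl V
  have h4 := @hfew _
  rw [Fintype.card_fin] at h3
  omega

lemma not_majority_of_typical {𝒰 : Finset (E d)} {V : Finset (Fin W)} {yV zV : Fin W → E d}
    {P : E d → Prop} (hV : 20 * V.card ≤ 9 * W)
    (hfew : ∀ [DecidablePred fun i => ¬ Typical Λ 𝒰 (zV i)],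
      20 * (Vᶜ.filter fun i => ¬ Typical Λ 𝒰 (zV i)).card < W)
    (hP : ∀ z, Typical Λ 𝒰 z → ¬ P z) : ¬ Majority (mixPts V yV (fun _ => 0) zV) P := by
  classical
  unfold Majority
  have h1 : (Finset.univ.filter fun i => P (mixPts V yV (fun _ => 0) zV i)).card
      ≤ (V ∪ (Vᶜ.filter fun i => ¬ Typical Λ 𝒰 (zV i))).card := by
    refine Finset.card_le_card fun i hi => ?_
    simp only [Finset.mem_filter, Finset.mem_compl, Finset.mem_univ, true_and,
      Finset.mem_union] at hi ⊢
    by_cases hiV : i ∈ V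
    · exact Or.inl hiV
    · refine Or.inr ⟨hiV, fun h => hP _ h ?_⟩
      simpa [mixPts, hiV] using hi
  have h2 := Finset.card_union_le V (Vᶜ.filter fun i => ¬ Typical Λ 𝒰 (zV i))
  have h4 := @hfew _
  omega

/-- The vectors to which the validation points are compared. -/
noncomputable def relevantVectors (μ : E d) (v : 𝒯 → E d) (𝒬 : Finset 𝒯) (xA : Fin n → E d) :
    Finset (E d) := by
  classical exact insert μ (Finset.univ.image xA ∪ 𝒬.image v)

lemma card_relevantVectors_le (μ : E d) (v : 𝒯 → E d) (𝒬 : Finset 𝒯) (xA : Fin n → E d)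
    (h : 𝒬.card ≤ n) : (relevantVectors μ v 𝒬 xA).card ≤ 2 * n + 1 := by
  classical
  unfold relevantVectors
  refine (Finset.card_insert_le _ _).trans ?_
  have h1 := Finset.card_union_le (Finset.univ.image xA) (𝒬.image v)
  have h2 : (Finset.univ.image xA).card ≤ n := Finset.card_image_le.trans (by simp)
  have h3 : (𝒬.image v).card ≤ 𝒬.card := Finset.card_image_le
  convert (show (Finset.univ.image xA ∪ 𝒬.image v).card + 1 ≤ 2 * n + 1 by omega) using 1

/-- The thresholds leave a gap. For inner products, vulnerability starts at `3/4` and detection at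
`1/2` of the removal threshold; for norms, at `1/4` and `1/8`. The fluctuation of a typical point is
far smaller than the gap, so every clean typical validation point reports the mean. -/
lemma detects_of_vulnerable (hΛ : 6 ≤ Λ) (hd : 0 < d) {v : 𝒯 → E d} {𝒬 : Finset 𝒯}
    {J : Finset (Fin n)} {y zA : Fin n → E d} {V : Finset (Fin W)} {yV zV : Fin W → E d} {μ : E d}
    (hV : 20 * V.card ≤ 9 * W)
    (hfew : ∀ [DecidablePred fun i =>
        ¬ Typical Λ (relevantVectors μ v 𝒬 (mixPts J y (fun _ => μ) zA)) (zV i)],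
      20 * (Vᶜ.filter fun i =>
        ¬ Typical Λ (relevantVectors μ v 𝒬 (mixPts J y (fun _ => μ) zA)) (zV i)).card < W)
    (h : Vulnerable Λ v 𝒬 J y μ) :
    Detects Λ v 𝒬 (mixPts J y (fun _ => μ) zA) (mixPts V yV (fun _ => μ) zV) := by
  classical
  have hmulΛ := scale_bounds hΛ
  rcases h with h | ⟨j, hj, hjn, h⟩ | ⟨Q, hQ, h⟩
  · refine Or.inl (majority_of_typical hV hfew fun z hz => ?_)
    exact norm_deviation_of_large_mean hΛ hd h hz.1 (hz.2 μ (by simp [relevantVectors]))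
  · have hx : mixPts J y (fun _ => μ) zA j = y j := by simp [mixPts, hj]
    refine Or.inr (Or.inl ⟨j, by rwa [hx], majority_of_typical hV hfew fun z hz => ?_⟩)
    have h1 := hz.2 (mixPts J y (fun _ => μ) zA j) (by simp [relevantVectors])
    rw [hx] at h1 ⊢
    have h2 := hjn.mul_norm_le hΛ hd
    have h3 := abs_sub_abs_le_abs_sub (inner ℝ μ (y j)) (-inner ℝ z (y j))
    rw [abs_neg, sub_neg_eq_add, ← inner_add_left] at h3
    have h4 : 0 < Λ ^ 8 * √d := by positivity
    linarith
  · refine Or.inr (Or.inr ⟨Q, hQ, majority_of_typical hV hfew fun z hz => ?_⟩)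
    have h1 := hz.2 (v Q) (by
      simp only [relevantVectors, Finset.mem_insert, Finset.mem_union, Finset.mem_image]
      exact Or.inr (Or.inr ⟨Q, hQ, rfl⟩))
    have h3 := abs_sub_abs_le_abs_sub (inner ℝ μ (v Q)) (-inner ℝ z (v Q))
    rw [abs_neg, sub_neg_eq_add, ← inner_add_left] at h3
    have h5 := mul_le_mul_of_nonneg_right hmulΛ.2.2 (norm_nonneg (v Q))
    have h6 : 0 ≤ Λ * ‖v Q‖ := mul_nonneg (by linarith) (norm_nonneg _)
    linarith

/-- With mean zero a typical point shows only its fluctuation, far below the detection thresholds,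
so only bad and untypical points could report anything, and these are no majority. -/
lemma not_detects_of_null (hΛ : 6 ≤ Λ) (hd : 0 < d) {v : 𝒯 → E d} {𝒬 : Finset 𝒯}
    {xA : Fin n → E d} {V : Finset (Fin W)} {yV zV : Fin W → E d} (hV : 20 * V.card ≤ 9 * W)
    (hfew : ∀ [DecidablePred fun i => ¬ Typical Λ (relevantVectors 0 v 𝒬 xA) (zV i)],
      20 * (Vᶜ.filter fun i => ¬ Typical Λ (relevantVectors 0 v 𝒬 xA) (zV i)).card < W) :
    ¬ Detects Λ v 𝒬 xA (mixPts V yV (fun _ => 0) zV) := by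
  classical
  obtain ⟨b1, b2, b3⟩ := scale_bounds hΛ
  have hpos : 0 < Λ ^ 8 * √d := by positivity
  rintro (h | ⟨j, hjn, h⟩ | ⟨Q, hQ, h⟩)
  · refine not_majority_of_typical hV hfew (fun z hz => ?_) h
    rw [not_lt]
    have := hz.1
    have e2 : 7776 * (Λ ^ 3 * √d) ≤ Λ ^ 8 * √d := by rw [← mul_assoc]; gcongr
    linarith
  · refine not_majority_of_typical hV hfew (fun z hz => ?_) h
    rw [not_lt]
    have h1 := hz.2 (xA j) (by simp [relevantVectors])
    have h2 := hjn.mul_norm_le hΛ hd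
    linarith
  · refine not_majority_of_typical hV hfew (fun z hz => ?_) h
    rw [not_lt]
    have h1 := hz.2 (v Q) (by
      simp only [relevantVectors, Finset.mem_insert, Finset.mem_union, Finset.mem_image]
      exact Or.inr (Or.inr ⟨Q, hQ, rfl⟩))
    have h5 := mul_le_mul_of_nonneg_right b3 (norm_nonneg (v Q))
    have h6 : 0 ≤ Λ * ‖v Q‖ := mul_nonneg (by linarith) (norm_nonneg _)
    linarith

/-- If the mean is not detectable and the clean points are regular and without excess, then only
bad points are removed, and on account of bad points alone. -/
lemma cleaned_mixPts_eq (hΛ : 6 ≤ Λ) (hd : 0 < d) {v : 𝒯 → E d} {𝒬 : Finset 𝒯}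
    {J : Finset (Fin n)} {y z : Fin n → E d} {μ : E d} (h : ¬ Vulnerable Λ v 𝒬 J y μ)
    (hreg : Regular Λ (fun _ => μ) (mixPts J y (fun _ => μ) z) z)
    (hcov : ∀ j ∉ J, cover (fun Q j => excess Λ (v Q) (mixPts J y (fun _ => μ) z j)) 𝒬 j = 0)
    (g : Fin n → E d) :
    cleaned Λ v 𝒬 (mixPts J y (fun _ => μ) z) g
      = mixPts J (cleanedBad Λ v 𝒬 J y g) (fun _ => μ) z := by
  classical
  obtain ⟨b1, b2, b3⟩ := scale_bounds hΛ
  have hpos : 0 < Λ ^ 8 * √d := by positivity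
  have hs : 1 ≤ √(d : ℝ) := Real.one_le_sqrt.mpr (by exact_mod_cast hd)
  have hd2 : √(d : ℝ) ^ 2 = d := Real.sq_sqrt (by positivity)
  simp only [Vulnerable, not_or, not_exists, not_and, not_lt] at h
  obtain ⟨hμ, hμy, -⟩ := h
  obtain ⟨h1, h2, h3⟩ := hreg
  have e2 : 7776 * (Λ ^ 3 * √d) ≤ Λ ^ 8 * √d := by rw [← mul_assoc]; gcongr
  have hμn : ‖μ‖ ≤ Λ ^ 4 / 2 * √d := by
    refine le_of_sq_le_sq (hμ.trans ?_) (by positivity)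
    rw [mul_pow, div_pow, ← pow_mul]
    nlinarith [mul_nonneg hpos.le (sub_nonneg.mpr hs)]
  have hμΛ : Λ * ‖μ‖ ≤ Λ ^ 8 * √d / 432 := by
    calc Λ * ‖μ‖ ≤ Λ * (Λ ^ 4 / 2 * √d) := mul_le_mul_of_nonneg_left hμn (by linarith)
      _ = (216 * Λ ^ 5) * √d / 432 := by ring
      _ ≤ _ := by gcongr
  have hx : ∀ i ∉ J, mixPts J y (fun _ => μ) z i = μ + z i := fun i hi => by simp [mixPts, hi]
  have hxJ : ∀ i ∈ J, mixPts J y (fun _ => μ) z i = y i := fun i hi => by simp [mixPts, hi]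
  have hnorm : ∀ i ∉ J, NormTypical Λ (mixPts J y (fun _ => μ) z i) := by
    intro i hi
    unfold NormTypical
    rw [hx i hi, norm_add_sq_real, real_inner_comm]
    have a1 := h1 i
    have a2 := h2 i
    calc |‖μ‖ ^ 2 + 2 * inner ℝ (z i) μ + ‖z i‖ ^ 2 - d|
        = |‖μ‖ ^ 2 + 2 * inner ℝ (z i) μ + (‖z i‖ ^ 2 - d)| := by congr 1; ring
      _ ≤ |‖μ‖ ^ 2| + |2 * inner ℝ (z i) μ| + |‖z i‖ ^ 2 - d| := abs_add_three _ _ _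
      _ ≤ _ := by
          rw [abs_mul, abs_two, abs_of_nonneg (sq_nonneg ‖μ‖)]
          linarith
  -- Clean points have typical norms and, by this bound, clash with no point of typical norm. Hence
  -- no clean point is removed, and no bad point is removed on account of a clean one.
  have hpair : ∀ i ∉ J, ∀ j, i ≠ j → NormTypical Λ (mixPts J y (fun _ => μ) z j) →
      |inner ℝ (mixPts J y (fun _ => μ) z i) (mixPts J y (fun _ => μ) z j)| ≤ Λ ^ 8 * √d := by
    intro i hi j hij hj
    have a1 := h3 i j hij
    have a2 := hj.mul_norm_le hΛ hd
    rw [hx i hi, inner_add_left]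
    refine (abs_add_le _ _).trans ?_
    by_cases hjJ : j ∈ J
    · rw [hxJ j hjJ] at hj
      have a3 := hμy j hjJ hj
      rw [← hxJ j hjJ] at a3
      linarith
    · have a4 := h2 j
      have a3 : |inner ℝ μ (mixPts J y (fun _ => μ) z j)| ≤ ‖μ‖ ^ 2 + Λ * ‖μ‖ := by
        rw [hx j hjJ, inner_add_right, real_inner_self_eq_norm_sq, real_inner_comm]
        refine (abs_add_le _ _).trans ?_
        rw [abs_of_nonneg (sq_nonneg ‖μ‖)]
        linarith
      linarith
  funext i
  by_cases hi : i ∈ J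
  · have hcc : cover (fun Q j => excess Λ (v Q) (mixPts J y (fun _ => μ) z j)) 𝒬 i
        = cover (fun Q j => excess Λ (v Q) (y j)) 𝒬 i := cover_congr fun Q => by rw [hxJ i hi]
    have hiff : Removed Λ v 𝒬 (mixPts J y (fun _ => μ) z) i ↔ RemovedBy Λ v 𝒬 J y i := by
      unfold Removed RemovedBy
      rw [hxJ i hi, hcc]
      refine or_congr Iff.rfl (or_congr ?_ Iff.rfl)
      constructor
      · rintro ⟨j, hji, hni, hnj, hlt⟩
        by_cases hjJ : j ∈ J
        · rw [hxJ j hjJ] at hnj hlt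
          exact ⟨j, hjJ, hji, hni, hnj, hlt⟩
        · have := hpair j hjJ i hji (by rwa [hxJ i hi])
          rw [real_inner_comm, hxJ i hi] at this
          exact absurd hlt (not_lt.mpr this)
      · rintro ⟨j, hjJ, hji, hni, hnj, hlt⟩
        exact ⟨j, hji, hni, by rwa [hxJ j hjJ], by rwa [hxJ j hjJ]⟩
    simp only [cleaned, hiff, mixPts, hi, if_true, cleanedBad]
  · have hnot : ¬ Removed Λ v 𝒬 (mixPts J y (fun _ => μ) z) i := by
      unfold Removed
      push Not
      refine ⟨hnorm i hi, fun j hji _ hj => hpair i hi j hji.symm hj, hcov i hi⟩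
    simp only [cleaned, hnot, if_false]
    simp [mixPts, hi]

end

/-! ### The output probabilities of a batch and their measurability. -/

section

variable {d n W : ℕ} {Λ : ℝ} {𝒯 X : Type*} [MeasurableSpace X]

lemma measurable_cover [Fintype 𝒯] {ι : Type*} {f : X → 𝒯 → ι → NNReal}
    (hf : ∀ Q j, Measurable fun a => f a Q j) (𝒬 : Finset 𝒯) (j : ι) :
    Measurable fun a => cover (f a) 𝒬 j :=
  measurable_finset_sup 𝒬 fun Q => hf Q j

lemma measurable_gibbsProb [Fintype 𝒯] {ι : Type*} {f : X → 𝒯 → ι → NNReal} (n : ℕ) (π : 𝒯 → ℝ)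
    (η : ℝ) (hf : ∀ Q j, Measurable fun a => f a Q j) (J : Finset ι) (𝒬 : Finset 𝒯) :
    Measurable fun a => gibbsProb n π η (f a) J 𝒬 := by
  have h1 : ∀ 𝒬, Measurable fun a => gibbsWeight π η (f a) J 𝒬 := fun 𝒬 => by
    unfold gibbsWeight
    refine measurable_const.mul (Real.measurable_exp.comp (measurable_const.mul ?_))
    exact Finset.measurable_fun_sum _ fun j _ =>
      (measurable_cover hf 𝒬 j).coe_nnreal_real
  unfold gibbsProb gibbsTotal
  exact (h1 𝒬).div (Finset.measurable_fun_sum _ fun 𝒬 _ => h1 𝒬)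

lemma measurable_majority {x : X → Fin W → E d} {P : X → E d → Prop}
    (h : ∀ i, Measurable fun a => P a (x a i)) : Measurable fun a => Majority (x a) (P a) := by
  classical
  unfold Majority
  have : Measurable fun a => (Finset.univ.filter fun i => P a (x a i)).card := by
    simp only [Finset.card_filter]
    exact Finset.measurable_fun_sum _ fun i _ =>
      Measurable.ite (measurableSet_setOfPred.mpr (h i)) measurable_const measurable_const
  exact measurableSet_setOfPred.mp (measurableSet_lt measurable_const (measurable_const.mul this))

lemma measurable_lt_prop {f g : X → ℝ} (hf : Measurable f) (hg : Measurable g) :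
    Measurable fun a => f a < g a :=
  measurableSet_setOfPred.mp (measurableSet_lt hf hg)

lemma measurable_normTypical {x : X → E d} (hx : Measurable x) :
    Measurable fun a => NormTypical Λ (x a) :=
  measurableSet_setOfPred.mp (measurableSet_le (by fun_prop) measurable_const)

section

variable [Fintype 𝒯] {v : X → 𝒯 → E d} {xA : X → Fin n → E d} {xV : X → Fin W → E d}
  (hv : ∀ Q, Measurable fun a => v a Q) (hA : ∀ i, Measurable fun a => xA a i)
  (hV : ∀ i, Measurable fun a => xV a i)

include hv hA hV in
lemma measurable_detects (𝒬 : Finset 𝒯) :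
    Measurable fun a => Detects Λ (v a) 𝒬 (xA a) (xV a) := by
  classical
  unfold Detects
  refine Measurable.or (measurable_majority fun i => ?_) (Measurable.or
    (Measurable.exists fun j => (measurable_normTypical (hA j)).and (measurable_majority fun i => ?_))
    (Measurable.exists fun Q => measurable_const.and (measurable_majority fun i => ?_)))
  · exact measurable_lt_prop measurable_const (by have := hV i; fun_prop)
  · exact measurable_lt_prop measurable_const (by have := hV i; have := hA j; fun_prop)
  · exact measurable_lt_prop (by have := hv Q; fun_prop) (by have := hV i; have := hv Q; fun_prop)

include hv hA in
lemma measurable_removed (𝒬 : Finset 𝒯) (i : Fin n) :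
    Measurable fun a => Removed Λ (v a) 𝒬 (xA a) i := by
  unfold Removed
  refine (measurable_normTypical (hA i)).not.or (Measurable.or (Measurable.exists fun j =>
    measurable_const.and ((measurable_normTypical (hA i)).and ((measurable_normTypical (hA j)).and
      (measurable_lt_prop measurable_const ?_)))) (Measurable.not ?_))
  · have := hA i
    have := hA j
    fun_prop
  · exact measurableSet_setOfPred.mp ((measurableSet_singleton 0).preimage (measurable_cover
      (f := fun a Q j => excess Λ (v a Q) (xA a j))
      (fun Q j => measurable_excess Λ (hv Q) (hA j)) 𝒬 i))

include hv hA in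
lemma measurable_cleaned {g : X → Fin n → E d} (hg : ∀ i, Measurable fun a => g a i)
    (𝒬 : Finset 𝒯) : Measurable fun a => cleaned Λ (v a) 𝒬 (xA a) (g a) := by
  classical
  refine measurable_pi_lambda _ fun i => ?_
  unfold cleaned
  convert Measurable.ite (measurableSet_setOfPred.mpr (measurable_removed (Λ := Λ) hv hA 𝒬 i))
    (hg i) (hA i)

/-- The probability that a single batch, consisting of the points `xA` and the validation points
`xV`, yields the output `b`, when the directions are `v` and cleaned datasets are processed by the
randomised test `T`. -/
noncomputable def batchOut (T : Bool → (Fin n → E d) → ℝ≥0∞) (Λ : ℝ) (π : 𝒯 → ℝ) (v : 𝒯 → E d)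
    (xA : Fin n → E d) (xV : Fin W → E d) (b : Bool) : ℝ≥0∞ := by
  classical exact
  ∑ 𝒬 ∈ gibbsStates 𝒯 n,
    ENNReal.ofReal (gibbsProb n π (1 / 64) (fun Q j => excess Λ (v Q) (xA j)) Finset.univ 𝒬) *
    if Detects Λ v 𝒬 xA xV then (if b then 1 else 0)
    else ∫⁻ g, T b (cleaned Λ v 𝒬 xA g) ∂(Measure.pi fun _ : Fin n => stdGaussian (E d))

include hv hA in
lemma measurable_lintegral_cleaned {T : (Fin n → E d) → ℝ≥0∞} (hT : Measurable T)
    (𝒬 : Finset 𝒯) : Measurable fun a =>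
      ∫⁻ g, T (cleaned Λ (v a) 𝒬 (xA a) g) ∂(Measure.pi fun _ : Fin n => stdGaussian (E d)) := by
  refine Measurable.lintegral_prod_right' (f := fun p : X × (Fin n → E d) =>
    T (cleaned Λ (v p.1) 𝒬 (xA p.1) p.2)) ?_
  refine hT.comp ?_
  exact measurable_cleaned (v := fun p : X × (Fin n → E d) => v p.1) (xA := fun p => xA p.1)
    (g := fun p => p.2)
    (fun Q => (hv Q).comp measurable_fst) (fun i => (hA i).comp measurable_fst)
    (fun i => (measurable_pi_apply i).comp measurable_snd) 𝒬

include hv hA hV in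
lemma measurable_batchOut {T : Bool → (Fin n → E d) → ℝ≥0∞} (hT : ∀ b, Measurable (T b))
    (π : 𝒯 → ℝ) (b : Bool) :
    Measurable fun a => batchOut T Λ π (v a) (xA a) (xV a) b := by
  classical
  unfold batchOut
  refine Finset.measurable_fun_sum _ fun 𝒬 _ => Measurable.mul ?_ ?_
  · exact (measurable_gibbsProb n π _ (f := fun a Q j => excess Λ (v a Q) (xA a j))
      (fun Q j => measurable_excess Λ (hv Q) (hA j)) _ 𝒬).ennreal_ofReal
  · convert Measurable.ite (measurableSet_setOfPred.mpr (measurable_detects (Λ := Λ) hv hA hV 𝒬))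
      measurable_const (measurable_lintegral_cleaned (Λ := Λ) hv hA (hT b) 𝒬)

end

lemma sum_ofReal_gibbsProb [Fintype 𝒯] {ι : Type*} {π : 𝒯 → ℝ} (hπ : ∀ Q, 0 < π Q) (n : ℕ) (η : ℝ)
    (f : 𝒯 → ι → NNReal) (J : Finset ι) :
    ∑ 𝒬 ∈ gibbsStates 𝒯 n, ENNReal.ofReal (gibbsProb n π η f J 𝒬) = 1 := by
  rw [← ENNReal.ofReal_sum_of_nonneg fun 𝒬 _ => gibbsProb_nonneg hπ 𝒬, sum_gibbsProb hπ]
  simp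

lemma batchOut_add [Fintype 𝒯] {T : Bool → (Fin n → E d) → ℝ≥0∞} (hT : ∀ b, Measurable (T b))
    (hT1 : ∀ x, T true x + T false x = 1) {π : 𝒯 → ℝ} (hπ : ∀ Q, 0 < π Q) (v : 𝒯 → E d)
    (xA : Fin n → E d) (xV : Fin W → E d) :
    batchOut T Λ π v xA xV true + batchOut T Λ π v xA xV false = 1 := by
  classical
  unfold batchOut
  rw [← Finset.sum_add_distrib]
  refine Eq.trans ?_ (sum_ofReal_gibbsProb hπ n (1 / 64)
    (fun Q j => excess Λ (v Q) (xA j)) Finset.univ)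
  refine Finset.sum_congr rfl fun 𝒬 _ => ?_
  rw [← mul_add]
  refine (congrArg _ ?_).trans (mul_one _)
  by_cases h : Detects Λ v 𝒬 xA xV
  · simp [h]
  · simp only [h, if_false]
    rw [← lintegral_add_left]
    · simp [hT1]
    · exact (hT true).comp (measurable_cleaned (X := Fin n → E d) (v := fun _ => v)
        (xA := fun _ => xA) (fun _ => measurable_const) (fun _ => measurable_const)
        (g := fun g => g) (fun i => measurable_pi_apply i) 𝒬)

lemma batchOut_le_one [Fintype 𝒯] {T : Bool → (Fin n → E d) → ℝ≥0∞} (hT : ∀ b, Measurable (T b))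
    (hT1 : ∀ x, T true x + T false x = 1) {π : 𝒯 → ℝ} (hπ : ∀ Q, 0 < π Q) (v : 𝒯 → E d)
    (xA : Fin n → E d) (xV : Fin W → E d) (b : Bool) : batchOut T Λ π v xA xV b ≤ 1 := by
  rw [← batchOut_add hT hT1 hπ v xA xV (Λ := Λ)]
  cases b
  · exact le_add_self
  · exact le_self_add

end

/-! ### Comparison with removal driven by the bad points alone. -/

section

variable {d n W : ℕ} {Λ : ℝ} {𝒯 : Type*}

lemma measurable_mixPts_cleanedBad (v : 𝒯 → E d) (𝒬 : Finset 𝒯) (J : Finset (Fin n))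
    (y c : Fin n → E d) : Measurable fun p : (Fin n → E d) × (Fin n → E d) =>
      mixPts J (cleanedBad Λ v 𝒬 J y p.2) c p.1 := by
  refine measurable_pi_lambda _ fun i => ?_
  unfold mixPts cleanedBad
  split_ifs
  · exact (measurable_pi_apply i).comp measurable_snd
  · exact measurable_const
  · exact measurable_const.add ((measurable_pi_apply i).comp measurable_fst)

open Classical in
/-- The bound on the error of a batch in terms of a process which removes points only on account of
the bad points. -/
theorem lintegral_batchOut_le [Fintype 𝒯] (hΛ : 6 ≤ Λ) (hd : 0 < d)
    (hn : (n : ℝ) + 1 ≤ Real.exp (Λ / 2)) (hW : 0 < W) {T : Bool → (Fin n → E d) → ℝ≥0∞}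
    (hT : ∀ b, Measurable (T b)) (hT1 : ∀ x, T true x + T false x = 1) {π : 𝒯 → ℝ}
    (hπ : ∀ Q, 0 < π Q) (v : 𝒯 → E d) (J : Finset (Fin n)) (y : Fin n → E d)
    (V : Finset (Fin W)) (hV : 20 * V.card ≤ 9 * W) (yV : Fin W → E d) (b : Bool) (μ : E d)
    (hb : b = false → μ = 0) :
    ∫⁻ z, ∫⁻ zV, batchOut T Λ π v (mixPts J y (fun _ => μ) z) (mixPts V yV (fun _ => μ) zV) (!b)
        ∂(Measure.pi fun _ : Fin W => stdGaussian (E d))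
        ∂(Measure.pi fun _ : Fin n => stdGaussian (E d))
      ≤ ENNReal.ofReal (13 * Real.exp (-2 * Λ)) +
        ∑ 𝒬 ∈ gibbsStates 𝒯 n,
          ENNReal.ofReal (gibbsProb n π (1 / 64) (fun Q j => excess Λ (v Q) (y j)) J 𝒬) *
          ∫⁻ z, ∫⁻ g, T (!b) (mixPts J (cleanedBad Λ v 𝒬 J y g) (fun _ => μ) z)
            ∂(Measure.pi fun _ : Fin n => stdGaussian (E d))
            ∂(Measure.pi fun _ : Fin n => stdGaussian (E d)) := by
  set γn := Measure.pi fun _ : Fin n => stdGaussian (E d) with hγn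
  set γW := Measure.pi fun _ : Fin W => stdGaussian (E d) with hγW
  set xz : (Fin n → E d) → Fin n → E d := fun z => mixPts J y (fun _ => μ) z with hxz
  have hxm : Measurable xz := measurable_mixPts J y _
  have hxi : ∀ i, Measurable fun z => xz z i := fun i => measurable_pi_iff.mp hxm i
  set fz : (Fin n → E d) → 𝒯 → Fin n → NNReal := fun z Q j => excess Λ (v Q) (xz z j) with hfz
  have hfm : ∀ Q j, Measurable fun z => fz z Q j := fun Q j =>
    measurable_excess Λ measurable_const (hxi j)
  set a : (Fin n → E d) → Finset 𝒯 → ℝ≥0∞ := fun z 𝒬 =>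
    ENNReal.ofReal (gibbsProb n π (1 / 64) (fz z) Finset.univ 𝒬) with ha
  set B : Finset 𝒯 → ℝ≥0∞ := fun 𝒬 =>
    ENNReal.ofReal (gibbsProb n π (1 / 64) (fun Q j => excess Λ (v Q) (y j)) J 𝒬) with hB
  set C : (Fin n → E d) → Finset 𝒯 → ℝ≥0∞ := fun z 𝒬 =>
    ∫⁻ g, T (!b) (cleaned Λ v 𝒬 (xz z) g) ∂γn with hC
  set D : (Fin n → E d) → Finset 𝒯 → ℝ≥0∞ := fun z 𝒬 =>
    ∫⁻ g, T (!b) (mixPts J (cleanedBad Λ v 𝒬 J y g) (fun _ => μ) z) ∂γn with hD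
  set viol : (Fin n → E d) → Finset 𝒯 → ℝ≥0∞ := fun z 𝒬 =>
    if ∀ j ∉ J, cover (fz z) 𝒬 j = 0 then 0
    else ENNReal.ofReal (Real.exp (1 / 64 * ∑ j ∈ Jᶜ, (cover (fz z) 𝒬 j : ℝ))) with hviol
  have hTle : ∀ b x, T b x ≤ 1 := by
    intro b x
    rw [← hT1 x]
    cases b
    · exact le_add_self
    · exact le_self_add
  have hC1 : ∀ z 𝒬, C z 𝒬 ≤ 1 := fun z 𝒬 =>
    (lintegral_mono fun g => hTle _ _).trans (by simp)
  have hviolm : ∀ 𝒬, Measurable fun z => viol z 𝒬 := by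
    intro 𝒬
    refine Measurable.ite (measurableSet_setOfPred.mpr (Measurable.forall fun j =>
      measurable_const.imp ?_)) measurable_const ?_
    · exact measurableSet_setOfPred.mp
        ((measurableSet_singleton 0).preimage (measurable_cover hfm 𝒬 j))
    · refine (Real.measurable_exp.comp (measurable_const.mul ?_)).ennreal_ofReal
      exact Finset.measurable_fun_sum _ fun j _ => (measurable_cover hfm 𝒬 j).coe_nnreal_real
  have hDm : ∀ 𝒬, Measurable fun z => D z 𝒬 := fun 𝒬 =>
    Measurable.lintegral_prod_right' (f := fun p : (Fin n → E d) × (Fin n → E d) =>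
      T (!b) (mixPts J (cleanedBad Λ v 𝒬 J y p.2) (fun _ => μ) p.1))
      ((hT _).comp (measurable_mixPts_cleanedBad v 𝒬 J y _))
  -- validation
  have hstate : ∀ z, ∀ 𝒬 ∈ gibbsStates 𝒯 n,
      ∫⁻ zV, (if Detects Λ v 𝒬 (xz z) (mixPts V yV (fun _ => μ) zV) then
        (if (!b) then 1 else 0 : ℝ≥0∞) else C z 𝒬) ∂γW
      ≤ ENNReal.ofReal (5 * Real.exp (-2 * Λ)) + if Vulnerable Λ v 𝒬 J y μ then 0 else C z 𝒬 := by
    intro z 𝒬 h𝒬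
    set 𝒰 := relevantVectors μ v 𝒬 (xz z) with h𝒰
    set S : Set (Fin W → E d) :=
      {zV | W ≤ 20 * (Vᶜ.filter fun i => ¬ Typical Λ 𝒰 (zV i)).card} with hS
    have hpt : ∀ zV, (if Detects Λ v 𝒬 (xz z) (mixPts V yV (fun _ => μ) zV) then
        (if (!b) then 1 else 0 : ℝ≥0∞) else C z 𝒬)
        ≤ S.indicator 1 zV + if Vulnerable Λ v 𝒬 J y μ then 0 else C z 𝒬 := by
      intro zV
      by_cases hzV : zV ∈ S
      · rw [Set.indicator_of_mem hzV]
        refine le_trans ?_ le_self_add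
        split_ifs
        · exact le_rfl
        · exact zero_le
        · exact hC1 _ _
      · rw [Set.indicator_of_notMem hzV, zero_add]
        have hfew : ∀ [DecidablePred fun i => ¬ Typical Λ 𝒰 (zV i)],
            20 * (Vᶜ.filter fun i => ¬ Typical Λ 𝒰 (zV i)).card < W := by
          intro inst
          rw [hS, Set.mem_ofPred_eq, not_le] at hzV
          refine lt_of_le_of_lt (le_of_eq ?_) hzV
          congr!
        by_cases hvul : Vulnerable Λ v 𝒬 J y μ
        · have hdet := detects_of_vulnerable (yV := yV) hΛ hd hV hfew hvul
          rw [if_pos hdet, if_pos hvul]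
          cases b
          · have hμ0 := hb rfl
            subst hμ0
            exact absurd (not_detects_of_null (yV := yV) hΛ hd hV hfew) (not_not.mpr hdet)
          · simp
        · rw [if_neg hvul]
          split_ifs with hdet hbb
          · cases b
            · have hμ0 := hb rfl
              subst hμ0
              exact absurd hdet (not_detects_of_null hΛ hd hV hfew)
            · simp at hbb
          · exact zero_le
          · exact le_rfl
    refine (lintegral_mono hpt).trans ?_
    rw [lintegral_add_right _ measurable_const, lintegral_const, measure_univ, mul_one]
    refine add_le_add ((lintegral_indicator_one_le _).trans ?_) le_rfl
    refine (measure_many_untypical_le hΛ hd hW Vᶜ 𝒰).trans (ENNReal.ofReal_le_ofReal ?_)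
    have hcard : (𝒰.card : ℝ) ≤ 2 * n + 1 := by
      exact_mod_cast card_relevantVectors_le μ v 𝒬 (xz z) (by
        simpa [gibbsStates] using h𝒬)
    have hn0 : (0 : ℝ) ≤ n := Nat.cast_nonneg n
    have hexp3 : (20 : ℝ) ≤ Real.exp (Λ / 2) := by
      have h1 := Real.exp_one_gt_d9
      calc (20 : ℝ) ≤ 2.7182818283 ^ 3 := by norm_num
        _ ≤ Real.exp 1 ^ 3 := by gcongr
        _ = Real.exp 3 := by rw [← Real.exp_nat_mul]; norm_num
        _ ≤ _ := Real.exp_le_exp.mpr (by linarith)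
    have e1 : Real.exp (-2 * Λ) = Real.exp (Λ / 2) * Real.exp (Λ / 2) * Real.exp (-3 * Λ) := by
      rw [← Real.exp_add, ← Real.exp_add]; congr 1; ring
    rw [e1]
    have e2 : 20 * (3 + 2 * (𝒰.card : ℝ)) ≤ 5 * (Real.exp (Λ / 2) * Real.exp (Λ / 2)) := by
      nlinarith
    calc _ = 20 * (3 + 2 * (𝒰.card : ℝ)) * Real.exp (-3 * Λ) := by ring
      _ ≤ 5 * (Real.exp (Λ / 2) * Real.exp (Λ / 2)) * Real.exp (-3 * Λ) := by gcongr
      _ = _ := by ring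
  set R : Set (Fin n → E d) := {z | ¬ Regular Λ (fun _ => μ) (xz z) z} with hR
  have hBle : ∀ z 𝒬, a z 𝒬
      ≤ B 𝒬 * ENNReal.ofReal (Real.exp (1 / 64 * ∑ j ∈ Jᶜ, (cover (fz z) 𝒬 j : ℝ))) := by
    intro z 𝒬
    have hcongr : gibbsProb n π (1 / 64) (fz z) J 𝒬
        = gibbsProb n π (1 / 64) (fun Q j => excess Λ (v Q) (y j)) J 𝒬 :=
      gibbsProb_congr (fun Q j hj => by simp [hfz, hxz, mixPts, hj]) 𝒬
    simp only [ha, hB]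
    rw [← hcongr, ← ENNReal.ofReal_mul (gibbsProb_nonneg hπ 𝒬)]
    exact ENNReal.ofReal_le_ofReal (gibbsProb_univ_le hπ (by norm_num) 𝒬)
  -- Three cases for an invulnerable family. Irregular clean points cost the indicator of `R`. If a
  -- clean point has excess, the true Gibbs weight is at most `B` times the tilt, which is `viol`.
  -- Otherwise the weight is at most `B`, and cleaning coincides with the process driven by the bad
  -- points.
  have hweighted : ∀ z 𝒬, a z 𝒬 * (if Vulnerable Λ v 𝒬 J y μ then 0 else C z 𝒬)
      ≤ R.indicator 1 z * a z 𝒬 + B 𝒬 * (if Vulnerable Λ v 𝒬 J y μ then 0 else viol z 𝒬)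
        + B 𝒬 * D z 𝒬 := by
    intro z 𝒬
    by_cases hvul : Vulnerable Λ v 𝒬 J y μ
    · simp [hvul]
    simp only [hvul, if_false]
    by_cases hzR : z ∈ R
    · rw [Set.indicator_of_mem hzR, add_assoc]
      refine le_trans ?_ le_self_add
      rw [mul_comm]
      exact mul_le_mul_left (hC1 z 𝒬) _
    rw [Set.indicator_of_notMem hzR, zero_mul, zero_add]
    by_cases hcov : ∀ j ∉ J, cover (fz z) 𝒬 j = 0
    · refine le_trans ?_ le_add_self
      have hsum : ∑ j ∈ Jᶜ, (cover (fz z) 𝒬 j : ℝ) = 0 :=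
        Finset.sum_eq_zero fun j hj => by simp [hcov j (by simpa using hj)]
      have h1 := hBle z 𝒬
      rw [hsum, mul_zero, Real.exp_zero, ENNReal.ofReal_one, mul_one] at h1
      refine mul_le_mul' h1 (le_of_eq ?_)
      refine lintegral_congr fun g => ?_
      rw [hxz, cleaned_mixPts_eq hΛ hd hvul (not_not.mp hzR) hcov g]
    · refine le_trans ?_ le_self_add
      simp only [hviol, hcov, if_false]
      exact (mul_le_mul' (hBle z 𝒬) (hC1 z 𝒬)).trans (by rw [mul_one])
  have hbm : ∀ z 𝒬, Measurable fun zV : Fin W → E d =>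
      (if Detects Λ v 𝒬 (xz z) (mixPts V yV (fun _ => μ) zV) then
        (if (!b) then 1 else 0 : ℝ≥0∞) else C z 𝒬) := by
    intro z 𝒬
    exact Measurable.ite (measurableSet_setOfPred.mpr (measurable_detects
      (v := fun _ : Fin W → E d => v) (xA := fun _ => xz z)
      (xV := fun zV => mixPts V yV (fun _ => μ) zV) (fun _ => measurable_const)
      (fun _ => measurable_const) (fun i => measurable_pi_iff.mp (measurable_mixPts V yV _) i) 𝒬))
      measurable_const measurable_const
  have hconditional : ∀ z, ∫⁻ zV, batchOut T Λ π v (xz z) (mixPts V yV (fun _ => μ) zV) (!b) ∂γW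
      ≤ ENNReal.ofReal (5 * Real.exp (-2 * Λ)) + R.indicator 1 z
        + ∑ 𝒬 ∈ gibbsStates 𝒯 n, B 𝒬 * (if Vulnerable Λ v 𝒬 J y μ then 0 else viol z 𝒬)
        + ∑ 𝒬 ∈ gibbsStates 𝒯 n, B 𝒬 * D z 𝒬 := by
    intro z
    have hsa : ∑ 𝒬 ∈ gibbsStates 𝒯 n, a z 𝒬 = 1 := sum_ofReal_gibbsProb hπ _ _ _ _
    calc _ = ∑ 𝒬 ∈ gibbsStates 𝒯 n, a z 𝒬 *
          ∫⁻ zV, (if Detects Λ v 𝒬 (xz z) (mixPts V yV (fun _ => μ) zV) then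
            (if (!b) then 1 else 0 : ℝ≥0∞) else C z 𝒬) ∂γW := by
          unfold batchOut
          rw [lintegral_finsetSum _ fun 𝒬 _ => ((hbm z 𝒬).const_mul _)]
          exact Finset.sum_congr rfl fun 𝒬 _ => lintegral_const_mul _ (hbm z 𝒬)
      _ ≤ ∑ 𝒬 ∈ gibbsStates 𝒯 n, (a z 𝒬 * ENNReal.ofReal (5 * Real.exp (-2 * Λ)) +
          (R.indicator 1 z * a z 𝒬 + B 𝒬 * (if Vulnerable Λ v 𝒬 J y μ then 0 else viol z 𝒬)
          + B 𝒬 * D z 𝒬)) := by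
          refine Finset.sum_le_sum fun 𝒬 h𝒬 => ?_
          refine (mul_le_mul_right (hstate z 𝒬 h𝒬) _).trans ?_
          rw [mul_add]
          exact add_le_add le_rfl (hweighted z 𝒬)
      _ = _ := by
          rw [Finset.sum_add_distrib, Finset.sum_add_distrib, Finset.sum_add_distrib,
            ← Finset.sum_mul, ← Finset.mul_sum, hsa, one_mul, mul_one]
          ring
  have hm1 : Measurable fun z =>
      ∑ 𝒬 ∈ gibbsStates 𝒯 n, B 𝒬 * (if Vulnerable Λ v 𝒬 J y μ then 0 else viol z 𝒬) := by
    refine Finset.measurable_fun_sum _ fun 𝒬 _ => measurable_const.mul ?_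
    split_ifs
    · exact measurable_const
    · exact hviolm 𝒬
  have hm2 : Measurable fun z => ∑ 𝒬 ∈ gibbsStates 𝒯 n, B 𝒬 * D z 𝒬 :=
    Finset.measurable_fun_sum _ fun 𝒬 _ => measurable_const.mul (hDm 𝒬)
  refine (lintegral_mono hconditional).trans ?_
  rw [lintegral_add_right _ hm2, lintegral_add_right _ hm1, lintegral_add_left measurable_const,
    lintegral_const, measure_univ, mul_one,
    lintegral_finsetSum _ fun 𝒬 _ => (hDm 𝒬).const_mul _]
  have t1 : ∫⁻ z, R.indicator 1 z ∂γn ≤ ENNReal.ofReal (7 * Real.exp (-2 * Λ)) :=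
    (lintegral_indicator_one_le _).trans (measure_not_regular_le hΛ hd hn J y _)
  have t2 : ∫⁻ z, ∑ 𝒬 ∈ gibbsStates 𝒯 n,
      B 𝒬 * (if Vulnerable Λ v 𝒬 J y μ then 0 else viol z 𝒬) ∂γn
      ≤ ENNReal.ofReal (Real.exp (-2 * Λ)) := by
    have hm : ∀ 𝒬, Measurable fun z => if Vulnerable Λ v 𝒬 J y μ then 0 else viol z 𝒬 := by
      intro 𝒬
      split_ifs
      · exact measurable_const
      · exact hviolm 𝒬
    rw [lintegral_finsetSum _ fun 𝒬 _ => (hm 𝒬).const_mul _]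
    calc _ ≤ ∑ 𝒬 ∈ gibbsStates 𝒯 n, B 𝒬 * ENNReal.ofReal (Real.exp (-2 * Λ)) := by
          refine Finset.sum_le_sum fun 𝒬 h𝒬 => ?_
          rw [lintegral_const_mul _ (hm 𝒬)]
          refine mul_le_mul_right ?_ _
          by_cases hvul : Vulnerable Λ v 𝒬 J y μ
          · simp [hvul]
          · simp only [hvul, if_false]
            refine lintegral_tilt_clean_le hΛ (by linarith) J y μ v 𝒬
              (by simpa [gibbsStates] using h𝒬) fun Q hQ => ?_
            by_contra! hlt
            exact hvul (Or.inr (Or.inr ⟨Q, hQ, hlt⟩))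
      _ = _ := by
          rw [← Finset.sum_mul, sum_ofReal_gibbsProb hπ, one_mul]
  refine (add_le_add (add_le_add (add_le_add le_rfl t1) t2) le_rfl).trans ?_
  -- `13 = 5 + 7 + 1`: untypical validation points, irregular clean points, and clean points with
  -- excess.
  refine add_le_add (le_of_eq ?_) (Finset.sum_le_sum fun 𝒬 _ => ?_)
  · rw [← ENNReal.ofReal_add (by positivity) (by positivity),
      ← ENNReal.ofReal_add (by positivity) (by positivity)]
    congr 1
    ring
  · rw [lintegral_const_mul _ (hDm 𝒬)]

end

/-! ### Directions spanned by short tuples of pool points. -/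

section

variable {d n W : ℕ} {Λ : ℝ}

/-- Nonempty tuples of at most `n` positions. -/
abbrev Tup (n : ℕ) : Type := Σ q : Fin n, (Fin ((q : ℕ) + 1) → Fin n)

/-- The sum of the points at the positions of a tuple. -/
def tupSum (x : Fin n → E d) (Q : Tup n) : E d := ∑ a, x (Q.2 a)

/-- A prior of `exp (-2Λ)` per position is summable over the at most `n ^ q` tuples of each length
`q`, as `n ≤ exp (Λ / 2)`, and it is still outweighed by the gain `Λ ^ 5 / 64` per position which a
heavy direction brings. -/
noncomputable def tupWeight (Λ : ℝ) (Q : Tup n) : ℝ := Real.exp (-2 * Λ * ((Q.1 : ℕ) + 1))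

lemma tupWeight_pos (Q : Tup n) : 0 < tupWeight Λ Q := Real.exp_pos _

lemma sum_tupWeight_le (hΛ : 6 ≤ Λ) (hn : (n : ℝ) + 1 ≤ Real.exp (Λ / 2)) :
    ∑ Q : Tup n, tupWeight Λ Q ≤ 2 * Real.exp (-3 / 2 * Λ) := by
  set ρ := Real.exp (-3 / 2 * Λ) with hρ
  have hρ0 : 0 < ρ := Real.exp_pos _
  have hρ2 : ρ ≤ 1 / 2 := by
    have h1 : ρ ≤ Real.exp (-1) := Real.exp_le_exp.mpr (by linarith)
    have h2 : Real.exp (-1) ≤ 1 / 2 := by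
      rw [Real.exp_neg, inv_le_comm₀ (Real.exp_pos _) (by norm_num)]
      have := Real.add_one_le_exp (1 : ℝ)
      norm_num; linarith
    linarith
  have hgeom : ∀ k : ℕ, ∑ q ∈ Finset.range k, ρ ^ (q + 1) ≤ 2 * ρ - 2 * ρ ^ (k + 1) := by
    intro k
    induction k with
    | zero => simp
    | succ k ih =>
      rw [Finset.sum_range_succ]
      have : ρ ^ (k + 1 + 1) ≤ ρ ^ (k + 1) / 2 := by
        rw [pow_succ _ (k + 1)]
        nlinarith [pow_pos hρ0 (k + 1)]
      linarith
  rw [Fintype.sum_sigma]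
  calc ∑ q : Fin n, ∑ _Q : Fin ((q : ℕ) + 1) → Fin n, Real.exp (-2 * Λ * ((q : ℕ) + 1))
      ≤ ∑ q : Fin n, ρ ^ ((q : ℕ) + 1) := by
        refine Finset.sum_le_sum fun q _ => ?_
        rw [Finset.sum_const, Finset.card_univ, Fintype.card_fun, Fintype.card_fin, Fintype.card_fin,
          nsmul_eq_mul]
        push_cast
        calc (n : ℝ) ^ ((q : ℕ) + 1) * Real.exp (-2 * Λ * ((q : ℕ) + 1))
            ≤ Real.exp (Λ / 2) ^ ((q : ℕ) + 1) * Real.exp (-2 * Λ * ((q : ℕ) + 1)) := by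
              gcongr; linarith
          _ = ρ ^ ((q : ℕ) + 1) := by
              rw [hρ, ← Real.exp_nat_mul, ← Real.exp_nat_mul, ← Real.exp_add]
              congr 1; push_cast; ring
    _ = ∑ q ∈ Finset.range n, ρ ^ (q + 1) := Fin.sum_univ_eq_sum_range (fun q => ρ ^ (q + 1)) n
    _ ≤ 2 * ρ := (hgeom n).trans (by linarith [pow_pos hρ0 (n + 1)])

/-- A direction that is heavy for some of the points not covered by `𝒬` has large total excess. -/
lemma exists_heavy_of_not_noHeavyDirection {x y : Fin n → E d} {J J' : Finset (Fin n)}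
    {𝒬 : Finset (Tup n)} (hsub : ∀ j ∈ J', j ∈ J ∧ cover (fun Q j => excess Λ (tupSum x Q) (y j)) 𝒬 j = 0)
    (h : ¬ NoHeavyDirection Λ n J' y x) :
    ∃ Q : Tup n, Λ ^ 5 * ((Q.1 : ℕ) + 1) / 64 ≤
      1 / 64 * ∑ j ∈ J with cover (fun Q j => excess Λ (tupSum x Q) (y j)) 𝒬 j = 0,
        (excess Λ (tupSum x Q) (y j) : ℝ) := by
  classical
  unfold NoHeavyDirection at h
  push Not at h
  obtain ⟨k, hk, Q, hQ⟩ := h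
  have hv : ∑ a, x (Q a) ≠ 0 := by
    intro h0
    simp [h0] at hQ
  obtain ⟨q, rfl⟩ : ∃ q, k = q + 1 := by
    refine Nat.exists_eq_succ_of_ne_zero ?_
    rintro rfl
    simp at hv
  refine ⟨⟨⟨q, by omega⟩, Q⟩, ?_⟩
  have hts : tupSum x ⟨⟨q, by omega⟩, Q⟩ = ∑ a, x (Q a) := rfl
  set v := ∑ a, x (Q a) with hvd
  have hv0 : 0 < ‖v‖ ^ 2 := by positivity
  have e1 : ∑ j ∈ J' with Λ ^ 4 * ‖v‖ < |inner ℝ (y j) v|, inner ℝ (y j) v ^ 2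
      ≤ (∑ j ∈ J with cover (fun Q j => excess Λ (tupSum x Q) (y j)) 𝒬 j = 0,
        (excess Λ v (y j) : ℝ)) * ‖v‖ ^ 2 := by
    rw [Finset.sum_mul]
    calc _ = ∑ j ∈ J' with Λ ^ 4 * ‖v‖ < |inner ℝ (y j) v|, (excess Λ v (y j) : ℝ) * ‖v‖ ^ 2 := by
          refine Finset.sum_congr rfl fun j hj => ?_
          have := (Finset.mem_filter.mp hj).2
          simp only [excess, this, if_true]
          rw [Real.coe_toNNReal _ (by positivity), div_mul_cancel₀ _ hv0.ne']
      _ ≤ _ := by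
          refine Finset.sum_le_sum_of_subset_of_nonneg (fun j hj => ?_) fun j _ _ => by positivity
          exact Finset.mem_filter.mpr (hsub j (Finset.mem_filter.mp hj).1)
  rw [hts]
  have e2 := hQ.trans_le e1
  have e3 := lt_of_mul_lt_mul_right e2 hv0.le
  push_cast at e3 ⊢
  linarith

open Classical in
/-- With high probability there is no heavy direction for the bad points that are not removed. -/
lemma sum_gibbsProb_heavy_le (hΛ : 6 ≤ Λ) (hn : (n : ℝ) + 1 ≤ Real.exp (Λ / 2)) (x y : Fin n → E d)
    (J : Finset (Fin n)) (hJ : J.card < n) :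
    ∑ 𝒬 ∈ (gibbsStates (Tup n) n).filter (fun 𝒬 => ¬ NoHeavyDirection Λ n
        (J.filter fun i => ¬ RemovedBy Λ (tupSum x) 𝒬 J y i) y x),
      gibbsProb n (tupWeight Λ) (1 / 64) (fun Q j => excess Λ (tupSum x Q) (y j)) J 𝒬
      ≤ 4 * Real.exp (-3 / 2 * Λ) := by
  set f : Tup n → Fin n → NNReal := fun Q j => excess Λ (tupSum x Q) (y j) with hf
  set c : Tup n → ℝ := fun Q => Λ ^ 5 * ((Q.1 : ℕ) + 1) / 64 with hc
  have hc0 : ∀ Q, 0 < c Q := fun Q => by simp only [hc]; positivity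
  have h1 := gibbsProb_card_eq_le (f := f) (η := 1 / 64) (n := n) (J := J)
    (fun Q => tupWeight_pos (Λ := Λ) Q) hJ
  have h2 := gibbsProb_heavy_le (f := f) (η := 1 / 64) (n := n) (J := J) (by norm_num)
    (fun Q => tupWeight_pos (Λ := Λ) Q) c hc0
  -- Since `Λ ^ 5 / 64 ≥ 4Λ`, the gain of a heavy direction pays for its prior twice.
  have h3 : ∑ Q : Tup n, Real.exp (-c Q) / tupWeight Λ Q ≤ ∑ Q : Tup n, tupWeight Λ Q := by
    refine Finset.sum_le_sum fun Q _ => ?_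
    simp only [hc, tupWeight]
    rw [← Real.exp_sub]
    refine Real.exp_le_exp.mpr ?_
    have e1 : 256 * Λ ≤ Λ ^ 5 := by
      have : (6 : ℝ) ^ 4 ≤ Λ ^ 4 := by gcongr
      calc 256 * Λ ≤ Λ ^ 4 * Λ := by
            refine mul_le_mul_of_nonneg_right ?_ (by linarith)
            refine le_trans ?_ this
            norm_num
        _ = Λ ^ 5 := by ring
    have e2 : (0 : ℝ) ≤ ((Q.1 : ℕ) : ℝ) + 1 := by positivity
    nlinarith [mul_le_mul_of_nonneg_right e1 e2]
  have h4 := sum_tupWeight_le (n := n) hΛ hn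
  have h5 : (gibbsStates (Tup n) n).filter (fun 𝒬 => ¬ NoHeavyDirection Λ n
        (J.filter fun i => ¬ RemovedBy Λ (tupSum x) 𝒬 J y i) y x) ⊆
      (gibbsStates (Tup n) n).filter (fun 𝒬 => 𝒬.card = n) ∪
      (gibbsStates (Tup n) n).filter (fun 𝒬 => 𝒬.card < n ∧
        ∃ Q, c Q ≤ 1 / 64 * ∑ j ∈ J with cover f 𝒬 j = 0, (f Q j : ℝ)) := by
    intro 𝒬 h𝒬
    rw [Finset.mem_filter] at h𝒬
    rw [Finset.mem_union, Finset.mem_filter, Finset.mem_filter]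
    have hcard : 𝒬.card ≤ n := by simpa [gibbsStates] using h𝒬.1
    rcases hcard.eq_or_lt with h | h
    · exact Or.inl ⟨h𝒬.1, h⟩
    · refine Or.inr ⟨h𝒬.1, h, exists_heavy_of_not_noHeavyDirection (fun j hj => ?_) h𝒬.2⟩
      obtain ⟨hjJ, hjr⟩ := Finset.mem_filter.mp hj
      refine ⟨hjJ, ?_⟩
      by_contra hne
      exact hjr (Or.inr (Or.inr hne))
  have hnn : ∀ 𝒬, 0 ≤ gibbsProb n (tupWeight Λ) (1 / 64) f J 𝒬 := fun 𝒬 =>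
    gibbsProb_nonneg (fun Q => tupWeight_pos Q) 𝒬
  refine (Finset.sum_le_sum_of_subset_of_nonneg h5 fun 𝒬 _ _ => hnn 𝒬).trans ?_
  have h6 := Finset.sum_union_inter
    (s₁ := (gibbsStates (Tup n) n).filter (fun 𝒬 => 𝒬.card = n))
    (s₂ := (gibbsStates (Tup n) n).filter (fun 𝒬 => 𝒬.card < n ∧
        ∃ Q, c Q ≤ 1 / 64 * ∑ j ∈ J with cover f 𝒬 j = 0, (f Q j : ℝ)))
    (f := gibbsProb n (tupWeight Λ) (1 / 64) f J)
  have h7 := Finset.sum_nonneg fun 𝒬 (_ : 𝒬 ∈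
    (gibbsStates (Tup n) n).filter (fun 𝒬 => 𝒬.card = n) ∩
    (gibbsStates (Tup n) n).filter (fun 𝒬 => 𝒬.card < n ∧
        ∃ Q, c Q ≤ 1 / 64 * ∑ j ∈ J with cover f 𝒬 j = 0, (f Q j : ℝ))) => hnn 𝒬
  linarith

end

/-! ### The error of a batch with few bad points. -/

section

variable {d n W m : ℕ} {Λ ε : ℝ}

/-- The test `T` errs with probability at most `r` if at most `m` points are bad and the others are
drawn from `N(μ, I)`. If the null hypothesis holds, it may also err on data that is not friendly. -/
def IsGoodTest (T : Bool → (Fin n → E d) → ℝ≥0∞) (Λ ε : ℝ) (m : ℕ) (r : ℝ≥0∞) (b : Bool) (μ : E d) :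
    Prop :=
  ∀ (J : Finset (Fin n)) (y : Fin n → E d), J.card ≤ m →
    ∫⁻ z, T (!b) (mixPts J y (fun _ => μ) z) ∂(Measure.pi fun _ : Fin n => stdGaussian (E d))
      ≤ r + if b then 0 else (Measure.pi fun _ : Fin n => stdGaussian (E d))
        {z | ¬ IsFriendly (Λ ^ 2000) ε (mixPts J y (fun _ => μ) z)}

section

variable {𝒯 : Type*} {T : Bool → (Fin n → E d) → ℝ≥0∞}

/-- For each fixed `g` the processed bad points are an admissible choice of the adversary, so the
guarantee of the test applies before integrating over `g`. -/
lemma lintegral_cleanedBad_alternative (hT : ∀ b, Measurable (T b)) {r : ℝ≥0∞} {μ : E d}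
    (hgood : IsGoodTest T Λ ε m r true μ) (v : 𝒯 → E d) (𝒬 : Finset 𝒯) (J : Finset (Fin n))
    (hJ : J.card ≤ m) (y : Fin n → E d) :
    ∫⁻ z, ∫⁻ g, T false (mixPts J (cleanedBad Λ v 𝒬 J y g) (fun _ => μ) z)
        ∂(Measure.pi fun _ : Fin n => stdGaussian (E d))
        ∂(Measure.pi fun _ : Fin n => stdGaussian (E d)) ≤ r := by
  have hm : Measurable fun p : (Fin n → E d) × (Fin n → E d) =>
      T false (mixPts J (cleanedBad Λ v 𝒬 J y p.2) (fun _ => μ) p.1) :=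
    (hT _).comp (measurable_mixPts_cleanedBad v 𝒬 J y _)
  rw [lintegral_lintegral_swap hm.aemeasurable]
  calc _ ≤ ∫⁻ _g, r ∂(Measure.pi fun _ : Fin n => stdGaussian (E d)) :=
        lintegral_mono fun g => by simpa using hgood J (cleanedBad Λ v 𝒬 J y g) hJ
    _ = r := by simp

-- Under the null hypothesis the fresh points have the law of clean points. The set of bad points
-- thus shrinks to the survivors, and friendliness is needed only for these.
open Classical in
lemma lintegral_cleanedBad_null (hT : ∀ b, Measurable (T b)) {r : ℝ≥0∞}
    (hgood : IsGoodTest T Λ ε m r false 0) (v : 𝒯 → E d) (𝒬 : Finset 𝒯) (J : Finset (Fin n))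
    (hJ : J.card ≤ m) (y : Fin n → E d) :
    ∫⁻ z, ∫⁻ g, T true (mixPts J (cleanedBad Λ v 𝒬 J y g) (fun _ => 0) z)
        ∂(Measure.pi fun _ : Fin n => stdGaussian (E d))
        ∂(Measure.pi fun _ : Fin n => stdGaussian (E d))
      ≤ r + (Measure.pi fun _ : Fin n => stdGaussian (E d))
        {z | ¬ IsFriendly (Λ ^ 2000) ε
          (mixPts (J.filter fun i => ¬ RemovedBy Λ v 𝒬 J y i) y (fun _ => 0) z)} := by
  set J' := J.filter fun i => ¬ RemovedBy Λ v 𝒬 J y i with hJ'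
  have hm : Measurable fun p : (Fin n → E d) × (Fin n → E d) =>
      T true (mixPts J (cleanedBad Λ v 𝒬 J y p.2) (fun _ => 0) p.1) :=
    (hT _).comp (measurable_mixPts_cleanedBad v 𝒬 J y _)
  have hmix := measurePreserving_mix (ι := Fin n) (stdGaussian (E d)) (fun i => i ∉ J)
  have heq : ∀ p : (Fin n → E d) × (Fin n → E d),
      mixPts J (cleanedBad Λ v 𝒬 J y p.2) (fun _ => 0) p.1
        = mixPts J' y (fun _ => 0) (fun i => if i ∉ J then p.1 i else p.2 i) := by
    intro p
    funext i
    by_cases hi : i ∈ J <;> by_cases hr : RemovedBy Λ v 𝒬 J y i <;>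
      simp [mixPts, cleanedBad, hi, hr, hJ']
  rw [← lintegral_prod _ hm.aemeasurable]
  simp_rw [heq]
  have hm2 : Measurable fun z => T true (mixPts J' y (fun _ => 0) z) :=
    (hT _).comp (measurable_mixPts J' y _)
  have e := hmix.lintegral_comp hm2
  rw [e]
  simpa using hgood J' y ((Finset.card_filter_le _ _).trans hJ)

end

open Classical in
/-- A single batch errs with probability not much larger than that of the given test, if it
contains few bad points and, for the null hypothesis, the bad points among the pool points look like
the bad points to be tested. -/
theorem lintegral_batchOut_le_of_isGoodTest {T : Bool → (Fin n → E d) → ℝ≥0∞} {C : ℕ}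
    (hΛ : 6 ≤ Λ) (hC5 : Λ ^ 5 ≤ C) (hC : (C : ℝ) ≤ Λ ^ 6) (hε : ε * n = m) (hd : 0 < d)
    (hmn : m < n) (hharm : ∀ k ≤ n, (harmonic k : ℝ) ≤ Λ)
    (hn : (n : ℝ) + 1 ≤ Real.exp (Λ / 2)) (hW : 0 < W)
    (hT : ∀ b, Measurable (T b)) (hT1 : ∀ x, T true x + T false x = 1) {r : ℝ≥0∞} (b : Bool) (μ : E d)
    (hb : b = false → μ = 0) (hgood : IsGoodTest T Λ ε m r b μ)
    (J : Finset (Fin n)) (hJ : J.card ≤ m) (y : Fin n → E d) (x : Fin n → E d)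
    (V : Finset (Fin W)) (hV : 20 * V.card ≤ 9 * W) (yV : Fin W → E d) (P : Finset (Fin n))
    (hP : ∀ i ∈ P, NormTypical Λ (x i))
    (halike : b = false →
      AlikeHalfspaces Λ d m C n (J.filter fun i => NormTypical Λ (y i)) P y x) :
    ∫⁻ z, ∫⁻ zV, batchOut T Λ (tupWeight Λ) (tupSum x) (mixPts J y (fun _ => μ) z)
          (mixPts V yV (fun _ => μ) zV) (!b)
        ∂(Measure.pi fun _ : Fin W => stdGaussian (E d))
        ∂(Measure.pi fun _ : Fin n => stdGaussian (E d))
      ≤ r + ENNReal.ofReal 0.006 := by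
  have hπ : ∀ Q : Tup n, 0 < tupWeight Λ Q := fun Q => tupWeight_pos Q
  refine (lintegral_batchOut_le hΛ hd hn hW hT hT1 hπ (tupSum x) J y V hV yV b μ hb).trans ?_
  set B : Finset (Tup n) → ℝ≥0∞ := fun 𝒬 => ENNReal.ofReal
    (gibbsProb n (tupWeight Λ) (1 / 64) (fun Q j => excess Λ (tupSum x Q) (y j)) J 𝒬) with hB
  have hBs : ∑ 𝒬 ∈ gibbsStates (Tup n) n, B 𝒬 = 1 := sum_ofReal_gibbsProb hπ _ _ _ _
  have hexp : ∀ t : ℝ, t ≤ -9 → Real.exp t ≤ 1 / 7000 := by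
    intro t ht
    have h1 := Real.exp_one_gt_d9
    have h2 : (7000 : ℝ) ≤ Real.exp 9 := by
      calc (7000 : ℝ) ≤ 2.7182818283 ^ 9 := by norm_num
        _ ≤ Real.exp 1 ^ 9 := by gcongr
        _ = Real.exp 9 := by rw [← Real.exp_nat_mul]; norm_num
    calc Real.exp t ≤ Real.exp (-9) := Real.exp_le_exp.mpr ht
      _ = (Real.exp 9)⁻¹ := Real.exp_neg 9
      _ ≤ _ := by rw [one_div]; exact inv_anti₀ (by norm_num) h2
  have x1 := hexp (-2 * Λ) (by linarith)
  have x2 := hexp (-3 / 2 * Λ) (by linarith)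
  cases b
  · have hμ := hb rfl
    subst hμ
    -- A family that leaves no heavy direction makes the survivors satisfy `cross_corr_le`, so the
    -- data are friendly with high probability. For the other families the trivial bound is used;
    -- their Gibbs mass is at most `4 exp (-3Λ/2)`.
    have key : ∀ 𝒬, ∫⁻ z, ∫⁻ g, T (!false) (mixPts J (cleanedBad Λ (tupSum x) 𝒬 J y g) (fun _ => 0) z)
            ∂(Measure.pi fun _ : Fin n => stdGaussian (E d))
            ∂(Measure.pi fun _ : Fin n => stdGaussian (E d))
        ≤ (r + ENNReal.ofReal (9 * Real.exp (-2 * Λ))) + if ¬ NoHeavyDirection Λ n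
          (J.filter fun i => ¬ RemovedBy Λ (tupSum x) 𝒬 J y i) y x then 1 else 0 := by
      intro 𝒬
      refine (lintegral_cleanedBad_null hT hgood (tupSum x) 𝒬 J hJ y).trans ?_
      rw [add_assoc]
      refine add_le_add le_rfl ?_
      by_cases hheavy : NoHeavyDirection Λ n
          (J.filter fun i => ¬ RemovedBy Λ (tupSum x) 𝒬 J y i) y x
      · simp only [hheavy, not_true, if_false, add_zero]
        have halive : ∀ i ∈ J.filter fun i => ¬ RemovedBy Λ (tupSum x) 𝒬 J y i,
            i ∈ J ∧ NormTypical Λ (y i) ∧ ∀ j ∈ J, j ≠ i → NormTypical Λ (y j) →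
              |inner ℝ (y i) (y j)| ≤ Λ ^ 8 * √d := by
          intro i hi
          obtain ⟨hiJ, hir⟩ := Finset.mem_filter.mp hi
          simp only [RemovedBy, not_or, not_not, not_exists, not_and, not_lt] at hir
          exact ⟨hiJ, hir.1, fun j hj hji hnj => hir.2.1 j hj hji hir.1 hnj⟩
        have hpair : ∀ i ∈ J.filter fun i => ¬ RemovedBy Λ (tupSum x) 𝒬 J y i,
            ∀ j ∈ J.filter fun i => ¬ RemovedBy Λ (tupSum x) 𝒬 J y i, i ≠ j →
            |inner ℝ (y i) (y j)| ≤ Λ ^ 8 * √d := fun i hi j hj hij =>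
          (halive i hi).2.2 j (halive j hj).1 hij.symm (halive j hj).2.1
        refine measure_not_isFriendly_le hΛ hε hd hn _ y (fun _ => 0) (by simp)
          (fun i hi => (halive i hi).2.1) hpair (fun S T hS hT hST hSm hTm => ?_)
        refine cross_corr_le hΛ hC5 hC hd hmn.le hharm y x _
          (J.filter fun i => NormTypical Λ (y i)) P (fun i hi => ?_) (fun i hi => ?_) hpair hheavy
          (halike rfl) S T hS hT hST hSm hTm
        · exact Finset.mem_filter.mpr ⟨(halive i hi).1, (halive i hi).2.1⟩
        · have hs : √(d : ℝ) ≤ d := by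
            have hd1 : (1 : ℝ) ≤ d := by exact_mod_cast hd
            rw [Real.sqrt_le_iff]
            exact ⟨by positivity, by nlinarith⟩
          have h1 := (abs_le.mp (hP i hi)).2
          have h2 : (d : ℝ) ≤ Λ ^ 8 * d :=
            le_mul_of_one_le_left (by positivity) (one_le_pow₀ (by linarith))
          have h3 : Λ ^ 8 * √d ≤ Λ ^ 8 * d := by gcongr
          unfold normCap
          linarith
      · simp only [hheavy, not_false_eq_true, if_true]
        exact prob_le_one.trans le_add_self
    calc _ ≤ ENNReal.ofReal (13 * Real.exp (-2 * Λ)) + ∑ 𝒬 ∈ gibbsStates (Tup n) n, B 𝒬 *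
          ((r + ENNReal.ofReal (9 * Real.exp (-2 * Λ))) + if ¬ NoHeavyDirection Λ n
          (J.filter fun i => ¬ RemovedBy Λ (tupSum x) 𝒬 J y i) y x then 1 else 0) :=
          add_le_add le_rfl (Finset.sum_le_sum fun 𝒬 _ => mul_le_mul_right (key 𝒬) _)
      _ = ENNReal.ofReal (13 * Real.exp (-2 * Λ)) + ((r + ENNReal.ofReal (9 * Real.exp (-2 * Λ)))
          + ∑ 𝒬 ∈ (gibbsStates (Tup n) n).filter (fun 𝒬 => ¬ NoHeavyDirection Λ n
          (J.filter fun i => ¬ RemovedBy Λ (tupSum x) 𝒬 J y i) y x), B 𝒬) := by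
          rw [Finset.sum_congr rfl fun 𝒬 _ => mul_add (B 𝒬) _ _, Finset.sum_add_distrib,
            ← Finset.sum_mul, hBs, one_mul, Finset.sum_filter]
          simp_rw [mul_ite, mul_one, mul_zero]
      _ ≤ ENNReal.ofReal (13 * Real.exp (-2 * Λ)) + ((r + ENNReal.ofReal (9 * Real.exp (-2 * Λ)))
          + ENNReal.ofReal (4 * Real.exp (-3 / 2 * Λ))) := by
          refine add_le_add le_rfl (add_le_add le_rfl ?_)
          rw [← ENNReal.ofReal_sum_of_nonneg fun 𝒬 _ => gibbsProb_nonneg hπ 𝒬]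
          exact ENNReal.ofReal_le_ofReal (sum_gibbsProb_heavy_le hΛ hn x y J (by omega))
      _ = r + ENNReal.ofReal (22 * Real.exp (-2 * Λ) + 4 * Real.exp (-3 / 2 * Λ)) := by
          have e : 22 * Real.exp (-2 * Λ) + 4 * Real.exp (-3 / 2 * Λ) = 13 * Real.exp (-2 * Λ) +
              (9 * Real.exp (-2 * Λ) + 4 * Real.exp (-3 / 2 * Λ)) := by ring
          rw [e, ENNReal.ofReal_add (by positivity) (by positivity),
            ENNReal.ofReal_add (by positivity) (by positivity)]
          ring
      _ ≤ _ := by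
          refine add_le_add le_rfl (ENNReal.ofReal_le_ofReal ?_)
          norm_num
          norm_num at x1 x2
          linarith
  · calc _ ≤ ENNReal.ofReal (13 * Real.exp (-2 * Λ)) + ∑ 𝒬 ∈ gibbsStates (Tup n) n, B 𝒬 * r :=
          add_le_add le_rfl (Finset.sum_le_sum fun 𝒬 _ => mul_le_mul_right
            (lintegral_cleanedBad_alternative hT hgood (tupSum x) 𝒬 J hJ y) _)
      _ = r + ENNReal.ofReal (13 * Real.exp (-2 * Λ)) := by
          rw [← Finset.sum_mul, hBs, one_mul, add_comm]
      _ ≤ _ := by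
          refine add_le_add le_rfl (ENNReal.ofReal_le_ofReal ?_)
          norm_num
          norm_num at x1
          linarith

end

/-! ### Random permutations: symmetrisation and second moments. -/

section

lemma exists_perm_apply_eq_eq {I : Type*} [DecidableEq I] {x y x' y' : I} (hxy : x ≠ y) (hxy' : x' ≠ y') :
    ∃ ρ : Equiv.Perm I, ρ x = x' ∧ ρ y = y' := by
  refine ⟨Equiv.swap (Equiv.swap x x' y) y' * Equiv.swap x x', ?_, ?_⟩
  · rw [Equiv.Perm.mul_apply, Equiv.swap_apply_left]
    refine Equiv.swap_apply_of_ne_of_ne (fun h => hxy ?_) hxy'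
    have : Equiv.swap x x' x = Equiv.swap x x' y := by rw [Equiv.swap_apply_left]; exact h
    exact (Equiv.swap x x').injective this
  · rw [Equiv.Perm.mul_apply, Equiv.swap_apply_left]

section Permutations

variable {I : Type*} [Fintype I] [DecidableEq I]

/-- The permutation exchanging the two copies of the elements of `U`. -/
def swapCopies {n : ℕ} (U : Finset (Fin n)) : Equiv.Perm (Fin n ⊕ Fin n) :=
  Function.Involutive.toPerm
    (Sum.elim (fun i => if i ∈ U then Sum.inr i else Sum.inl i)
      (fun i => if i ∈ U then Sum.inl i else Sum.inr i)) (by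
    rintro (i | i) <;> by_cases h : i ∈ U <;> simp [h])

lemma swapCopies_inr {n : ℕ} (U : Finset (Fin n)) (i : Fin n) :
    swapCopies U (Sum.inr i) = if i ∈ U then Sum.inl i else Sum.inr i := rfl

/-- If a set is hit often by the first half of the positions, it is unlikely to be missed by the
second half. -/
lemma two_pow_mul_card_le {n : ℕ} (e : Fin n ⊕ Fin n ↪ I) (H : Finset I) (g : ℕ) :
    2 ^ g * (Finset.univ.filter fun τ : Equiv.Perm I => (∀ i, τ (e (Sum.inr i)) ∉ H) ∧
      g ≤ (Finset.univ.filter fun i => τ (e (Sum.inl i)) ∈ H).card).card ≤ (Fintype.card I)! := by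
  classical
  set S := Finset.univ.filter fun τ : Equiv.Perm I => (∀ i, τ (e (Sum.inr i)) ∉ H) ∧
      g ≤ (Finset.univ.filter fun i => τ (e (Sum.inl i)) ∈ H).card with hS
  set B : Equiv.Perm I → Finset (Fin n) := fun τ =>
    Finset.univ.filter fun i => τ (e (Sum.inl i)) ∈ H with hB
  set sw : Finset (Fin n) → Equiv.Perm I := fun U => (swapCopies U).viaFintypeEmbedding e with hsw
  have hswr : ∀ U i, sw U (e (Sum.inr i)) = if i ∈ U then e (Sum.inl i) else e (Sum.inr i) := by
    intro U i
    simp only [hsw, Equiv.Perm.viaFintypeEmbedding_apply_image]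
    rw [swapCopies_inr]
    split_ifs <;> rfl
  -- Exchanging the two copies of `U ⊆ B τ` brings exactly the hits at `U` to the second half. So
  -- `U` can be read off from the new permutation, `(τ, U)` is determined by it, and each `τ` in `S`
  -- accounts for at least `2 ^ g` permutations.
  have hrec : ∀ τ ∈ S, ∀ U ⊆ B τ,
      (Finset.univ.filter fun i => (τ * sw U) (e (Sum.inr i)) ∈ H) = U := by
    intro τ hτ U hU
    ext i
    simp only [Finset.mem_filter, Finset.mem_univ, true_and, Equiv.Perm.mul_apply, hswr]
    by_cases h : i ∈ U
    · simp only [h, if_true, iff_true]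
      simpa [hB] using hU h
    · simp only [h, if_false, iff_false]
      exact (Finset.mem_filter.mp hτ).2.1 i
  calc 2 ^ g * S.card = ∑ τ ∈ S, 2 ^ g := by simp [mul_comm]
    _ ≤ ∑ τ ∈ S, (B τ).powerset.card := by
        refine Finset.sum_le_sum fun τ hτ => ?_
        rw [Finset.card_powerset]
        exact Nat.pow_le_pow_right (by norm_num) (Finset.mem_filter.mp hτ).2.2
    _ = (S.sigma fun τ => (B τ).powerset).card := (Finset.card_sigma _ _).symm
    _ ≤ (Finset.univ : Finset (Equiv.Perm I)).card := by
        refine Finset.card_le_card_of_injOn (fun p => p.1 * sw p.2) (fun _ _ => Finset.mem_univ _) ?_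
        rintro ⟨τ, U⟩ hp ⟨τ', U'⟩ hp' heq
        simp only [Finset.coe_sigma, Set.mem_sigma_iff, Finset.mem_coe, Finset.mem_powerset] at hp hp'
        simp only at heq
        have hU : U = U' := by
          rw [← hrec τ hp.1 U hp.2, ← hrec τ' hp'.1 U' hp'.2, heq]
        subst hU
        rw [mul_right_cancel heq]
    _ = (Fintype.card I)! := by rw [Finset.card_univ, Fintype.card_perm]

lemma sum_perm_apply_mul_card (f : I → ℝ) (x : I) :
    (∑ τ : Equiv.Perm I, f (τ x)) * Fintype.card I = (Fintype.card I)! * ∑ y, f y := by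
  have h : ∀ x', ∑ τ : Equiv.Perm I, f (τ x') = ∑ τ : Equiv.Perm I, f (τ x) := by
    intro x'
    rw [← Equiv.sum_comp (Equiv.mulRight (Equiv.swap x x')) fun τ => f (τ x')]
    simp
  have h2 : ∑ x', ∑ τ : Equiv.Perm I, f (τ x') = (Fintype.card I)! * ∑ y, f y := by
    rw [Finset.sum_comm, Finset.sum_congr rfl fun τ _ => Equiv.sum_comp τ f]
    simp [Fintype.card_perm]
  rw [← h2, Finset.sum_congr rfl fun x' _ => h x']
  simp [mul_comm]

/-- Sampling without replacement is negatively correlated: with `b = |B|` and `N` points in all, two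
positions are both hit with probability `b(b-1) / (N(N-1)) ≤ (b / N)²`. -/
lemma sum_perm_pair_mul_card_le (B : Finset I) {x y : I} (hxy : x ≠ y) :
    (∑ τ : Equiv.Perm I, if τ x ∈ B ∧ τ y ∈ B then (1 : ℝ) else 0) * (Fintype.card I : ℝ) ^ 2
      ≤ (Fintype.card I)! * (B.card : ℝ) ^ 2 := by
  classical
  set N := Fintype.card I with hN
  set c : I → I → ℝ := fun x y => ∑ τ : Equiv.Perm I, if τ x ∈ B ∧ τ y ∈ B then (1 : ℝ) else 0
    with hc
  have hconst : ∀ x' y', x' ≠ y' → c x' y' = c x y := by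
    intro x' y' h
    obtain ⟨ρ, h1, h2⟩ := exists_perm_apply_eq_eq hxy h
    simp only [hc]
    rw [← Equiv.sum_comp (Equiv.mulRight ρ)
      fun τ : Equiv.Perm I => if τ x ∈ B ∧ τ y ∈ B then (1 : ℝ) else 0]
    simp [h1, h2]
  have hsum : ∑ p ∈ (Finset.univ : Finset I).offDiag, c p.1 p.2 = N ! * (B.card * (B.card - 1)) := by
    simp only [hc]
    rw [Finset.sum_comm]
    have : ∀ τ : Equiv.Perm I, ∑ p ∈ (Finset.univ : Finset I).offDiag,
        (if τ p.1 ∈ B ∧ τ p.2 ∈ B then (1 : ℝ) else 0) = B.card * (B.card - 1) := by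
      intro τ
      rw [← Finset.sum_filter, Finset.sum_const, nsmul_eq_mul, mul_one]
      have e : ((Finset.univ : Finset I).offDiag.filter fun p => τ p.1 ∈ B ∧ τ p.2 ∈ B)
          = (B.map τ.symm.toEmbedding).offDiag := by
        ext p
        simp only [Finset.mem_filter, Finset.mem_offDiag, Finset.mem_univ, true_and,
          Finset.mem_map_equiv, Equiv.symm_symm]
        tauto
      rw [e, Finset.offDiag_card, Finset.card_map]
      rw [Nat.cast_sub (Nat.le_mul_self _)]
      push_cast
      ring
    rw [Finset.sum_congr rfl fun τ _ => this τ]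
    simp [Fintype.card_perm, hN]
  have hsum2 : ∑ p ∈ (Finset.univ : Finset I).offDiag, c p.1 p.2 = (N * (N - 1)) * c x y := by
    rw [Finset.sum_congr rfl fun p hp => hconst p.1 p.2 (Finset.mem_offDiag.mp hp).2.2,
      Finset.sum_const, Finset.offDiag_card, Finset.card_univ, nsmul_eq_mul,
      Nat.cast_sub (Nat.le_mul_self _)]
    push_cast
    ring
  rw [hsum] at hsum2
  have hN2 : (2 : ℝ) ≤ N := by
    have : 1 < N := Fintype.one_lt_card_iff.mpr ⟨x, y, hxy⟩
    exact_mod_cast this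
  have hBN : (B.card : ℝ) ≤ N := by exact_mod_cast Finset.card_le_univ B
  have hB0 : (0 : ℝ) ≤ B.card := Nat.cast_nonneg _
  have hf0 : (0 : ℝ) ≤ N ! := Nat.cast_nonneg _
  have h1 : (N : ℝ) * (B.card * (B.card - 1)) ≤ (N - 1) * (B.card : ℝ) ^ 2 := by nlinarith
  have h2 : (c x y * (N : ℝ) ^ 2) * (N - 1) ≤ (N ! * (B.card : ℝ) ^ 2) * (N - 1) := by
    calc (c x y * (N : ℝ) ^ 2) * (N - 1) = N * ((N * (N - 1)) * c x y) := by ring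
      _ = N ! * (N * (B.card * (B.card - 1))) := by rw [← hsum2]; ring
      _ ≤ N ! * ((N - 1) * (B.card : ℝ) ^ 2) := mul_le_mul_of_nonneg_left h1 hf0
      _ = _ := by ring
  exact le_of_mul_le_mul_right h2 (by linarith)

/-- Chebyshev's inequality for the number of positions that receive elements of `B`. -/
lemma card_perm_hits_mul_sq_le {ι : Type*} [Fintype ι] [DecidableEq ι] (e : ι ↪ I) (B : Finset I)
    {a : ℝ} (ha : a * Fintype.card I = Fintype.card ι * B.card) (hI : 0 < Fintype.card I) {u c : ℝ}
    (hcu : c ≤ u) :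
    ((Finset.univ.filter fun τ : Equiv.Perm I =>
        u ≤ ((Finset.univ.filter fun i => τ (e i) ∈ B).card : ℝ)).card : ℝ) * (u - c) ^ 2
      ≤ (Fintype.card I)! * (a + (a - c) ^ 2) := by
  classical
  set N := Fintype.card I with hN
  have hN0 : (0 : ℝ) < N := by exact_mod_cast hI
  set Z : Equiv.Perm I → ℝ := fun τ => ((Finset.univ.filter fun i => τ (e i) ∈ B).card : ℝ) with hZ
  have hZs : ∀ τ, Z τ = ∑ i, if τ (e i) ∈ B then (1 : ℝ) else 0 := by
    intro τ; simp [hZ]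
  have hB0 : (0 : ℝ) ≤ B.card := Nat.cast_nonneg _
  have hf0 : (0 : ℝ) < N ! := by exact_mod_cast Nat.factorial_pos N
  have hone : ∀ x : I, ∑ τ : Equiv.Perm I, (if τ x ∈ B then (1 : ℝ) else 0)
      = N ! * (B.card / N) := by
    intro x
    have := sum_perm_apply_mul_card (fun y => if y ∈ B then (1 : ℝ) else 0) x
    rw [Finset.sum_ite_mem, Finset.univ_inter, Finset.sum_const, nsmul_eq_mul, mul_one] at this
    rw [← mul_div_assoc, eq_div_iff hN0.ne']
    exact this
  have ha' : a = Fintype.card ι * (B.card / N) := by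
    rw [← mul_div_assoc, eq_div_iff hN0.ne']; exact ha
  have h1 : ∑ τ, Z τ = N ! * a := by
    simp_rw [hZs]
    rw [Finset.sum_comm, Finset.sum_congr rfl fun i _ => hone (e i), Finset.sum_const,
      Finset.card_univ, nsmul_eq_mul, ha']
    ring
  have h2 : ∑ τ, Z τ ^ 2 ≤ N ! * (a + a ^ 2) := by
    have e1 : ∀ τ, Z τ ^ 2 = ∑ i, ∑ j, if τ (e i) ∈ B ∧ τ (e j) ∈ B then (1 : ℝ) else 0 := by
      intro τ
      rw [hZs, sq, Finset.sum_mul_sum]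
      refine Finset.sum_congr rfl fun i _ => Finset.sum_congr rfl fun j _ => ?_
      by_cases hi : τ (e i) ∈ B <;> by_cases hj : τ (e j) ∈ B <;> simp [hi, hj]
    simp_rw [e1]
    rw [Finset.sum_comm]
    have e2 : ∀ i, ∑ τ : Equiv.Perm I, ∑ j, (if τ (e i) ∈ B ∧ τ (e j) ∈ B then (1 : ℝ) else 0)
        ≤ N ! * (B.card / N) + Fintype.card ι * (N ! * (B.card / N) ^ 2) := by
      intro i
      rw [Finset.sum_comm, ← Finset.add_sum_erase _ _ (Finset.mem_univ i)]
      refine add_le_add (le_of_eq ?_) ?_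
      · simpa using hone (e i)
      · calc _ ≤ ∑ _j ∈ Finset.univ.erase i, N ! * ((B.card : ℝ) / N) ^ 2 := by
              refine Finset.sum_le_sum fun j hj => ?_
              have hij : e i ≠ e j := fun h => (Finset.mem_erase.mp hj).1 (e.injective h).symm
              rw [div_pow, ← mul_div_assoc, le_div_iff₀ (by positivity)]
              exact sum_perm_pair_mul_card_le B hij
          _ ≤ _ := by
              rw [Finset.sum_const, nsmul_eq_mul]
              refine mul_le_mul_of_nonneg_right ?_ (by positivity)
              exact_mod_cast Finset.card_le_univ _
    calc _ ≤ ∑ _i : ι, (N ! * ((B.card : ℝ) / N) + Fintype.card ι * (N ! * (B.card / N) ^ 2)) :=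
          Finset.sum_le_sum fun i _ => e2 i
      _ = _ := by
          rw [Finset.sum_const, Finset.card_univ, nsmul_eq_mul, ha']; ring
  -- The second moment about a free centre `c`: the mean gives Chebyshev's inequality, a smaller `c`
  -- gives Cantelli's.
  have h3 : ∑ τ, (Z τ - c) ^ 2 ≤ N ! * (a + (a - c) ^ 2) := by
    have e1 : ∑ τ, (Z τ - c) ^ 2 = ∑ τ, Z τ ^ 2 - 2 * c * ∑ τ, Z τ + N ! * c ^ 2 := by
      rw [Finset.mul_sum, ← Finset.sum_sub_distrib]
      have : (N ! : ℝ) * c ^ 2 = ∑ _τ : Equiv.Perm I, c ^ 2 := by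
        simp [Fintype.card_perm, hN]
      rw [this, ← Finset.sum_add_distrib]
      exact Finset.sum_congr rfl fun τ _ => by ring
    rw [e1, h1]
    nlinarith
  refine le_trans ?_ h3
  rw [Finset.card_filter]
  push_cast
  rw [Finset.sum_mul]
  refine Finset.sum_le_sum fun τ _ => ?_
  split_ifs with h
  · rw [one_mul]
    have : 0 ≤ u - c := by linarith
    exact pow_le_pow_left₀ this (by linarith) 2
  · rw [zero_mul]; positivity

end Permutations

end

/-! ### Tested and pool positions look alike for pairs of half-spaces. -/

section

lemma AlikeHalfspaces.congr {F : Type*} [NormedAddCommGroup F] [InnerProductSpace ℝ F] {Λ : ℝ}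
    {d m C n : ℕ} {U V : Finset (Fin n)} {u u' v v' : Fin n → F} (hu : ∀ i ∈ U, u i = u' i)
    (hv : ∀ i ∈ V, v i = v' i) (h : AlikeHalfspaces Λ d m C n U V u v) :
    AlikeHalfspaces Λ d m C n U V u' v' := by
  intro s t hs ht σ hσ k hk Q Q' hQ hQ' hyp
  have e1 : ∑ a, u (Q a) = ∑ a, u' (Q a) := Finset.sum_congr rfl fun a _ => hu _ (hQ a)
  have e2 : ∑ a, v (Q' a) = ∑ a, v' (Q' a) := Finset.sum_congr rfl fun a _ => hv _ (hQ' a)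
  have h1 := h s t hs ht σ hσ k hk Q Q' hQ hQ' (fun i hi => by
    rw [e1, e2, hv i hi]; exact hyp i hi)
  rw [e1, e2] at h1
  refine lt_of_le_of_lt (le_of_eq ?_) h1
  congr 2
  refine Finset.filter_congr fun i hi => ?_
  rw [hu i hi]

variable {d m n C : ℕ} {Λ : ℝ} {I : Type*} [Fintype I] [DecidableEq I]

open Classical in
/-- The good bad points lying in an intersection of two half-spaces. -/
noncomputable def halfspaceTrace (Λ : ℝ) (d m : ℕ) (G : Finset I) (x : I → E d) (s t q : ℕ) (σ : ℝ)
    (w w' : E d) : Finset I :=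
  G.filter fun ι => corrLevel Λ d m s t q ≤ σ * inner ℝ (x ι) w ∧
    inner ℝ (x ι) w' < percLevel Λ d q

open Classical in
/-- Random positions look alike with respect to intersections of two half-spaces. -/
lemma card_perm_not_alikeHalfspaces_le (hΛ : 6 ≤ Λ) (hC5 : Λ ^ 5 ≤ C)
    (hn : (n : ℝ) + 1 ≤ Real.exp (Λ / 2)) (hI0 : 0 < Fintype.card I)
    (hI : (Fintype.card I : ℝ) ≤ Real.exp (Λ ^ 2))
    (e : Fin n ⊕ Fin n ↪ I) (G : Finset I) (x : I → E d) :
    ((Finset.univ.filter fun τ : Equiv.Perm I => ¬ AlikeHalfspaces Λ d m C n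
        (Finset.univ.filter fun i => τ (e (Sum.inl i)) ∈ G)
        (Finset.univ.filter fun i => τ (e (Sum.inr i)) ∈ G)
        (fun i => x (τ (e (Sum.inl i)))) (fun i => x (τ (e (Sum.inr i))))).card : ℝ)
      ≤ (Fintype.card I)! * 0.0001 := by
  set N := Fintype.card I with hN
  have hΛ0 : 0 < Λ := by linarith
  have hC0 : 0 < C := by
    have : (0 : ℝ) < C := lt_of_lt_of_le (by positivity) hC5
    exact_mod_cast this
  set D : Finset I → ℕ → Finset (Equiv.Perm I) := fun H g =>
    Finset.univ.filter fun τ : Equiv.Perm I => (∀ i, τ (e (Sum.inr i)) ∉ H) ∧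
      g ≤ (Finset.univ.filter fun i => τ (e (Sum.inl i)) ∈ H).card with hD
  set sg : Bool → ℝ := fun b => if b then 1 else -1 with hsg
  set params : Finset ((ℕ × ℕ) × (Bool × ℕ)) :=
    ((Finset.range (n + 1) ×ˢ Finset.range (n + 1)) ×ˢ (Finset.univ ×ˢ Finset.range (n + 1))).filter
      fun p => p.2.2 < p.1.1 / C with hparams
  set Hs : (p : (ℕ × ℕ) × (Bool × ℕ)) → (Fin (p.1.1 / C) → I) × (Fin p.2.2 → I) → Finset I :=
    fun p Q => halfspaceTrace Λ d m G x p.1.1 p.1.2 (p.1.1 / C) (sg p.2.1)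
      (∑ a, x (Q.1 a)) (∑ a, x (Q.2 a)) with hHs
  have hsub : (Finset.univ.filter fun τ : Equiv.Perm I => ¬ AlikeHalfspaces Λ d m C n
        (Finset.univ.filter fun i => τ (e (Sum.inl i)) ∈ G)
        (Finset.univ.filter fun i => τ (e (Sum.inr i)) ∈ G)
        (fun i => x (τ (e (Sum.inl i)))) (fun i => x (τ (e (Sum.inr i)))))
      ⊆ params.biUnion fun p => Finset.univ.biUnion fun Q => D (Hs p Q) (p.1.1 / 4) := by
    intro τ hτ
    have hτ' := (Finset.mem_filter.mp hτ).2
    unfold AlikeHalfspaces at hτ'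
    push Not at hτ'
    obtain ⟨s, t, hs, ht, σ, hσ, k, hk, Q, Q', hQ, hQ', hyp, hcard⟩ := hτ'
    obtain ⟨b, hb⟩ : ∃ b, sg b = σ := by
      rcases hσ with rfl | rfl
      · exact ⟨true, by simp [hsg]⟩
      · exact ⟨false, by simp [hsg]⟩
    have hkn : k < n + 1 := by
      have : s / C ≤ s := Nat.div_le_self _ _
      omega
    rw [Finset.mem_biUnion]
    refine ⟨((s, t), (b, k)), ?_, ?_⟩
    · simp only [hparams, Finset.mem_filter, Finset.mem_product, Finset.mem_range,
        Finset.mem_univ, true_and]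
      exact ⟨⟨⟨by omega, by omega⟩, hkn⟩, hk⟩
    rw [Finset.mem_biUnion]
    refine ⟨(fun a => τ (e (Sum.inl (Q a))), fun a => τ (e (Sum.inr (Q' a)))), Finset.mem_univ _, ?_⟩
    simp only [hD, Finset.mem_filter, Finset.mem_univ, true_and, hHs, halfspaceTrace, hb]
    refine ⟨fun i hi => ?_, ?_⟩
    · have := hyp i (by simpa using hi.1) hi.2.1
      exact absurd hi.2.2 (not_lt.mpr this)
    · rw [Finset.filter_filter] at hcard
      omega
  have hDcard : ∀ H g, ((D H g).card : ℝ) ≤ N ! / 2 ^ g := by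
    intro H g
    have := two_pow_mul_card_le e H g
    rw [le_div_iff₀ (by positivity), mul_comm]
    exact_mod_cast this
  have hfac : (0 : ℝ) < N ! := by exact_mod_cast Nat.factorial_pos N
  have hone : ∀ p ∈ params, ((Finset.univ.biUnion fun Q => D (Hs p Q) (p.1.1 / 4)).card : ℝ)
      ≤ N ! * (2 * Real.exp (-12 * Λ)) := by
    rintro ⟨⟨s, t⟩, b, k⟩ hp
    simp only [hparams, Finset.mem_filter] at hp
    have hk := hp.2
    have hq : 0 < s / C := by omega
    have hsC : C ≤ s := by
      by_contra! hlt
      rw [Nat.div_eq_of_lt hlt] at hq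
      exact lt_irrefl _ hq
    have hsR : Λ ^ 5 ≤ s := hC5.trans (by exact_mod_cast hsC)
    have h1 : ((Finset.univ.biUnion fun Q => D (Hs ((s, t), (b, k)) Q) (s / 4)).card : ℝ)
        ≤ (N : ℝ) ^ (s / C) * (N : ℝ) ^ k * (N ! / 2 ^ (s / 4)) := by
      calc _ ≤ ((∑ Q : (Fin (s / C) → I) × (Fin k → I),
            (D (Hs ((s, t), (b, k)) Q) (s / 4)).card : ℕ) : ℝ) := by
            exact_mod_cast Finset.card_biUnion_le
        _ ≤ ∑ _Q : (Fin (s / C) → I) × (Fin k → I), (N ! : ℝ) / 2 ^ (s / 4) := by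
            push_cast
            exact Finset.sum_le_sum fun Q _ => hDcard _ _
        _ = _ := by simp [hN]
    refine h1.trans ?_
    have hN1 : (1 : ℝ) ≤ N := by exact_mod_cast hI0
    -- As `C ≥ Λ ^ 5`, tuples of length `s / C` are so short that their number, at most `exp (s /
    -- 108)`, is beaten by the factor `2 ^ (s / 4)`.
    have h2 : (N : ℝ) ^ (s / C) * (N : ℝ) ^ k ≤ Real.exp (s / 108) := by
      calc (N : ℝ) ^ (s / C) * (N : ℝ) ^ k ≤ (N : ℝ) ^ (s / C) * (N : ℝ) ^ (s / C) := by
            gcongr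
        _ ≤ Real.exp (Λ ^ 2) ^ (s / C) * Real.exp (Λ ^ 2) ^ (s / C) := by gcongr
        _ = Real.exp (2 * ((s / C : ℕ) * Λ ^ 2)) := by
            rw [← Real.exp_nat_mul, ← Real.exp_add]; congr 1; ring
        _ ≤ _ := by
            refine Real.exp_le_exp.mpr ?_
            have e1 : ((s / C : ℕ) : ℝ) ≤ s / Λ ^ 5 := by
              refine Nat.cast_div_le.trans ?_
              gcongr
            have e2 : (216 : ℝ) ≤ Λ ^ 3 := by
              calc (216 : ℝ) = 6 ^ 3 := by norm_num
                _ ≤ Λ ^ 3 := by gcongr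
            calc 2 * (((s / C : ℕ) : ℝ) * Λ ^ 2) ≤ 2 * (s / Λ ^ 5 * Λ ^ 2) := by gcongr
              _ = 2 * s / Λ ^ 3 := by field_simp
              _ ≤ 2 * s / 216 := by gcongr
              _ = s / 108 := by ring
    have h3 : Real.exp (s / 8) ≤ 2 * 2 ^ (s / 4) := by
      have e1 : Real.exp (1 / 2) ≤ 2 := by
        have h := Real.exp_one_lt_d9
        have h' : Real.exp (1 / 2) ^ 2 = Real.exp 1 := by rw [← Real.exp_nat_mul]; norm_num
        nlinarith [Real.exp_pos (1 / 2)]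
      have e2 : (s : ℝ) ≤ 4 * ((s / 4 : ℕ) + 1) := by
        have : s ≤ 4 * (s / 4 + 1) := by omega
        exact_mod_cast this
      calc Real.exp (s / 8) ≤ Real.exp (((s / 4 + 1 : ℕ) : ℝ) * (1 / 2)) := by
            refine Real.exp_le_exp.mpr ?_
            push_cast
            linarith
        _ = Real.exp (1 / 2) ^ (s / 4 + 1) := by rw [Real.exp_nat_mul]
        _ ≤ 2 ^ (s / 4 + 1) := by gcongr
        _ = _ := by ring
    have h4 : (1 : ℝ) / 2 ^ (s / 4) ≤ 2 * Real.exp (-(s / 8)) := by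
      rw [div_le_iff₀ (by positivity), Real.exp_neg]
      have := Real.exp_pos ((s : ℝ) / 8)
      rw [mul_assoc, mul_comm _ ((2 : ℝ) ^ _), ← mul_assoc, ← div_eq_mul_inv, one_le_div this]
      exact h3
    calc (N : ℝ) ^ (s / C) * (N : ℝ) ^ k * (N ! / 2 ^ (s / 4))
        = N ! * ((N : ℝ) ^ (s / C) * (N : ℝ) ^ k * (1 / 2 ^ (s / 4))) := by ring
      _ ≤ N ! * (Real.exp (s / 108) * (2 * Real.exp (-(s / 8)))) := by gcongr
      _ = N ! * (2 * Real.exp (s / 108 + -(s / 8))) := by rw [Real.exp_add]; ring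
      _ ≤ _ := by
          gcongr
          have e1 : 1296 * Λ ≤ Λ ^ 5 := by
            have : (6 : ℝ) ^ 4 ≤ Λ ^ 4 := by gcongr
            calc 1296 * Λ ≤ Λ ^ 4 * Λ := by
                  refine mul_le_mul_of_nonneg_right ?_ hΛ0.le
                  refine le_trans ?_ this
                  norm_num
              _ = Λ ^ 5 := by ring
          linarith
  have hpc : (params.card : ℝ) ≤ 2 * Real.exp (Λ / 2) ^ 3 := by
    have h1 : params.card ≤ ((n + 1) * (n + 1)) * (2 * (n + 1)) := by
      refine (Finset.card_filter_le _ _).trans (le_of_eq ?_)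
      simp [Finset.card_product]
    calc (params.card : ℝ) ≤ (((n + 1) * (n + 1)) * (2 * (n + 1)) : ℕ) := by exact_mod_cast h1
      _ = 2 * ((n : ℝ) + 1) ^ 3 := by push_cast; ring
      _ ≤ _ := by gcongr
  calc _ ≤ ((params.biUnion fun p => Finset.univ.biUnion fun Q => D (Hs p Q) (p.1.1 / 4)).card : ℝ) := by
        exact_mod_cast Finset.card_le_card hsub
    _ ≤ ∑ p ∈ params, ((Finset.univ.biUnion fun Q => D (Hs p Q) (p.1.1 / 4)).card : ℝ) := by
        exact_mod_cast Finset.card_biUnion_le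
    _ ≤ ∑ _p ∈ params, N ! * (2 * Real.exp (-12 * Λ)) := Finset.sum_le_sum hone
    _ = params.card * (N ! * (2 * Real.exp (-12 * Λ))) := by rw [Finset.sum_const, nsmul_eq_mul]
    _ ≤ (2 * Real.exp (Λ / 2) ^ 3) * (N ! * (2 * Real.exp (-12 * Λ))) := by gcongr
    _ = N ! * (4 * Real.exp (3 * (Λ / 2) + -12 * Λ)) := by
        rw [Real.exp_add, ← Real.exp_nat_mul]; push_cast; ring
    _ ≤ N ! * 0.0001 := by
        gcongr
        have h1 := Real.exp_one_gt_d9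
        have h2 : (40000 : ℝ) ≤ Real.exp 12 := by
          calc (40000 : ℝ) ≤ 2.7182818283 ^ 12 := by norm_num
            _ ≤ Real.exp 1 ^ 12 := by gcongr
            _ = Real.exp 12 := by rw [← Real.exp_nat_mul]; norm_num
        have h3 : Real.exp (3 * (Λ / 2) + -12 * Λ) ≤ 1 / 40000 := by
          calc _ ≤ Real.exp (-12) := Real.exp_le_exp.mpr (by linarith)
            _ = (Real.exp 12)⁻¹ := Real.exp_neg 12
            _ ≤ _ := by rw [one_div]; exact inv_anti₀ (by norm_num) h2
        linarith

end

/-! ### A batch at random positions errs with probability below one half. -/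

section

lemma lintegral_pi_sum {X ι κ : Type*} [MeasurableSpace X] [Fintype ι] [Fintype κ] (ν : Measure X)
    [IsProbabilityMeasure ν] {f : (ι ⊕ κ → X) → ℝ≥0∞} (hf : Measurable f) :
    ∫⁻ z, f z ∂(Measure.pi fun _ : ι ⊕ κ => ν)
      = ∫⁻ z₂, ∫⁻ z₁, f (Sum.elim z₁ z₂) ∂(Measure.pi fun _ : ι => ν)
        ∂(Measure.pi fun _ : κ => ν) := by
  have h := measurePreserving_sumPiEquivProdPi_symm (fun _ : ι ⊕ κ => ν)
  have e : ∀ p : (ι → X) × (κ → X),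
      (MeasurableEquiv.sumPiEquivProdPi fun _ : ι ⊕ κ => X).symm p = Sum.elim p.1 p.2 := by
    intro p
    funext i
    cases i <;> rfl
  have hs : Measurable fun p : (ι → X) × (κ → X) => f (Sum.elim p.1 p.2) := by
    simpa only [Function.comp_def, e] using hf.comp h.measurable
  rw [← h.lintegral_comp hf]
  simp only [e]
  exact lintegral_prod_symm (μ := Measure.pi fun _ : ι => ν) (ν := Measure.pi fun _ : κ => ν)
    _ hs.aemeasurable

/-- The positions of a batch: points to be tested, points for directions, and validation points. -/
abbrev Batch (n W : ℕ) : Type := (Fin n ⊕ Fin n) ⊕ Fin W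

lemma lintegral_pi_batch {X : Type*} [MeasurableSpace X] {n W : ℕ} (ν : Measure X)
    [IsProbabilityMeasure ν] {f : (Batch n W → X) → ℝ≥0∞} (hf : Measurable f) :
    ∫⁻ z, f z ∂(Measure.pi fun _ : Batch n W => ν)
      = ∫⁻ zP, ∫⁻ zA, ∫⁻ zV, f (Sum.elim (Sum.elim zA zP) zV)
        ∂(Measure.pi fun _ : Fin W => ν) ∂(Measure.pi fun _ : Fin n => ν)
        ∂(Measure.pi fun _ : Fin n => ν) := by
  have hf2 : ∀ zV : Fin W → X, Measurable fun zAP : Fin n ⊕ Fin n → X => f (Sum.elim zAP zV) := by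
    intro zV
    refine hf.comp (measurable_pi_lambda _ fun p => ?_)
    rcases p with p | p
    · exact measurable_pi_apply p
    · exact measurable_const
  have hjoint : Measurable fun q : ((Fin W → X) × (Fin n → X)) × (Fin n → X) =>
      f (Sum.elim (Sum.elim q.2 q.1.2) q.1.1) := by
    refine hf.comp (measurable_pi_lambda _ fun p => ?_)
    rcases p with (p | p) | p
    · exact (measurable_pi_apply p).comp measurable_snd
    · exact (measurable_pi_apply p).comp (measurable_snd.comp measurable_fst)
    · exact (measurable_pi_apply p).comp (measurable_fst.comp measurable_fst)
  rw [lintegral_pi_sum _ hf]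
  simp_rw [lintegral_pi_sum _ (hf2 _)]
  rw [lintegral_lintegral_swap (Measurable.lintegral_prod_right' hjoint).aemeasurable]
  refine lintegral_congr fun zP => ?_
  refine lintegral_lintegral_swap (Measurable.aemeasurable ?_)
  exact hjoint.comp (measurable_prodMk_right.prodMap measurable_id :
    Measurable fun q : (Fin W → X) × (Fin n → X) => ((q.1, zP), q.2))

variable {d n W m C : ℕ} {Λ ε : ℝ}

/-- The output probabilities of a single batch. -/
noncomputable def batchTest (T : Bool → (Fin n → E d) → ℝ≥0∞) (Λ : ℝ) (b : Bool)
    (x : Batch n W → E d) : ℝ≥0∞ :=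
  batchOut T Λ (tupWeight Λ) (tupSum fun i => x (Sum.inl (Sum.inr i)))
    (fun i => x (Sum.inl (Sum.inl i))) (fun i => x (Sum.inr i)) b

lemma measurable_batchTest {T : Bool → (Fin n → E d) → ℝ≥0∞} (hT : ∀ b, Measurable (T b)) (b : Bool) :
    Measurable (batchTest (W := W) T Λ b) := by
  unfold batchTest
  refine measurable_batchOut (v := fun x : Batch n W → E d => tupSum fun i => x (Sum.inl (Sum.inr i)))
    (xA := fun x i => x (Sum.inl (Sum.inl i))) (xV := fun x i => x (Sum.inr i))
    (fun Q => ?_) (fun i => measurable_pi_apply _) (fun i => measurable_pi_apply _) hT _ b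
  unfold tupSum
  exact Finset.measurable_fun_sum _ fun a _ => measurable_pi_apply _

lemma batchTest_add {T : Bool → (Fin n → E d) → ℝ≥0∞} (hT : ∀ b, Measurable (T b))
    (hT1 : ∀ x, T true x + T false x = 1) (x : Batch n W → E d) :
    batchTest T Λ true x + batchTest T Λ false x = 1 :=
  batchOut_add hT hT1 (fun Q => tupWeight_pos Q) _ _ _

section

variable {I : Type*} [DecidableEq I]

/-- The data seen by a batch at the positions `e`. -/
noncomputable def batchData (bad : Finset I) (x : I → E d) (μ : E d) (e : Batch n W → I)
    (z : Batch n W → E d) : Batch n W → E d :=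
  fun p => if e p ∈ bad then x (e p) else μ + z p

lemma measurable_batchData (bad : Finset I) (x : I → E d) (μ : E d) (e : Batch n W → I) :
    Measurable (batchData (n := n) (W := W) bad x μ e) := by
  refine measurable_pi_lambda _ fun p => ?_
  unfold batchData
  split_ifs <;> fun_prop

lemma batchTest_batchData {T : Bool → (Fin n → E d) → ℝ≥0∞} (bad : Finset I) (x : I → E d) (μ : E d)
    (e : Batch n W → I) (b : Bool) (zA zP : Fin n → E d) (zV : Fin W → E d) :
    batchTest T Λ b (batchData bad x μ e (Sum.elim (Sum.elim zA zP) zV))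
      = batchOut T Λ (tupWeight Λ)
        (tupSum (mixPts (Finset.univ.filter fun i => e (Sum.inl (Sum.inr i)) ∈ bad)
          (fun i => x (e (Sum.inl (Sum.inr i)))) (fun _ => μ) zP))
        (mixPts (Finset.univ.filter fun i => e (Sum.inl (Sum.inl i)) ∈ bad)
          (fun i => x (e (Sum.inl (Sum.inl i)))) (fun _ => μ) zA)
        (mixPts (Finset.univ.filter fun i => e (Sum.inr i) ∈ bad)
          (fun i => x (e (Sum.inr i))) (fun _ => μ) zV) b := by
  unfold batchTest
  congr 1
  · congr 1
    funext i
    simp [batchData, mixPts]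
  · funext i
    simp [batchData, mixPts]
  · funext i
    simp [batchData, mixPts]

open Classical in
/-- A batch with few bad points, whose bad pool points look like the bad points to be tested, errs
with probability little more than one third. -/
lemma lintegral_batchTest_le {T : Bool → (Fin n → E d) → ℝ≥0∞}
    (hΛ : 6 ≤ Λ) (hC5 : Λ ^ 5 ≤ C) (hC : (C : ℝ) ≤ Λ ^ 6) (hε : ε * n = m) (hd : 0 < d)
    (hmn : m < n) (hharm : ∀ k ≤ n, (harmonic k : ℝ) ≤ Λ)
    (hn : (n : ℝ) + 1 ≤ Real.exp (Λ / 2)) (hW : 0 < W)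
    (hT : ∀ b, Measurable (T b)) (hT1 : ∀ x, T true x + T false x = 1) {r : ℝ≥0∞}
    (hr : r ≤ ENNReal.ofReal (1 / 3)) (b : Bool) (μ : E d)
    (hb : b = false → μ = 0) (hgood : IsGoodTest T Λ ε m r b μ)
    (bad : Finset I) (x : I → E d) (e : Batch n W → I)
    (hA : (Finset.univ.filter fun i => e (Sum.inl (Sum.inl i)) ∈ bad).card ≤ m)
    (hV : 20 * (Finset.univ.filter fun i => e (Sum.inr i) ∈ bad).card ≤ 9 * W)
    (halike : AlikeHalfspaces Λ d m C n
        (Finset.univ.filter fun i => e (Sum.inl (Sum.inl i)) ∈ bad.filter fun ι => NormTypical Λ (x ι))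
        (Finset.univ.filter fun i => e (Sum.inl (Sum.inr i)) ∈ bad.filter fun ι => NormTypical Λ (x ι))
        (fun i => x (e (Sum.inl (Sum.inl i)))) (fun i => x (e (Sum.inl (Sum.inr i))))) :
    ∫⁻ z, batchTest T Λ (!b) (batchData bad x μ e z)
        ∂(Measure.pi fun _ : Batch n W => stdGaussian (E d)) ≤ ENNReal.ofReal 0.34 := by
  rw [lintegral_pi_batch _ (f := fun z => batchTest T Λ (!b) (batchData bad x μ e z))
    ((measurable_batchTest hT _).comp (measurable_batchData bad x μ _))]
  refine (lintegral_mono (g := fun _ => ENNReal.ofReal 0.34) fun zP => ?_).trans (by simp)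
  simp_rw [batchTest_batchData]
  -- Only the bad pool points of typical norm enter the comparison with the tested points. They do
  -- not depend on the Gaussian sample, so the bound holds for every value of the clean pool points.
  have hPG : ∀ i ∈ Finset.univ.filter fun i => e (Sum.inl (Sum.inr i)) ∈
      bad.filter fun ι => NormTypical Λ (x ι), e (Sum.inl (Sum.inr i)) ∈ bad ∧
        NormTypical Λ (x (e (Sum.inl (Sum.inr i)))) := by
    intro i hi
    simpa using hi
  have hx : ∀ i ∈ Finset.univ.filter fun i => e (Sum.inl (Sum.inr i)) ∈
      bad.filter fun ι => NormTypical Λ (x ι),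
      mixPts (Finset.univ.filter fun i => e (Sum.inl (Sum.inr i)) ∈ bad)
          (fun i => x (e (Sum.inl (Sum.inr i)))) (fun _ => μ) zP i = x (e (Sum.inl (Sum.inr i))) := by
    intro i hi
    simp [mixPts, (hPG i hi).1]
  refine (lintegral_batchOut_le_of_isGoodTest hΛ hC5 hC hε hd hmn hharm hn hW hT hT1
    b μ hb hgood _ hA (fun i => x (e (Sum.inl (Sum.inl i)))) _ _ hV _
    (Finset.univ.filter fun i => e (Sum.inl (Sum.inr i)) ∈ bad.filter fun ι => NormTypical Λ (x ι))
    (fun i hi => ?_) (fun _ => ?_)).trans ?_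
  · rw [hx i hi]
    exact (hPG i hi).2
  · rw [Finset.filter_filter]
    simp only [Finset.mem_filter] at halike ⊢
    exact halike.congr (fun i _ => rfl) fun i hi => (hx i (by simpa using hi)).symm
  · refine (add_le_add hr le_rfl).trans ?_
    rw [← ENNReal.ofReal_add (by norm_num) (by norm_num)]
    exact ENNReal.ofReal_le_ofReal (by norm_num)

end

lemma badRatio_le {I : Type*} [Fintype I] (hI : 0 < Fintype.card I) (bad : Finset I)
    (hbad : 200 * (n * bad.card) ≤ 101 * (m * Fintype.card I)) :
    200 * ((n : ℝ) * (bad.card / Fintype.card I)) ≤ 101 * m := by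
  have hN0 : (0 : ℝ) < Fintype.card I := by exact_mod_cast hI
  have hbadR : 200 * ((n : ℝ) * bad.card) ≤ 101 * (m * Fintype.card I) := by exact_mod_cast hbad
  rw [← mul_div_assoc, ← mul_div_assoc, div_le_iff₀ hN0]
  linarith

variable {I : Type*} [Fintype I] [DecidableEq I]

/-- Cantelli's inequality for the number of bad points among `n` random ones. -/
lemma card_perm_many_bad_le (hI : 0 < Fintype.card I) (e : Fin n ↪ I) (bad : Finset I)
    (hbad : 200 * (n * bad.card) ≤ 101 * (m * Fintype.card I)) :
    ((Finset.univ.filter fun τ : Equiv.Perm I =>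
      (m : ℝ) + 1 ≤ ((Finset.univ.filter fun i => τ (e i) ∈ bad).card : ℝ)).card : ℝ)
      ≤ (Fintype.card I)! * 0.21 := by
  have hN0 : (Fintype.card I : ℝ) ≠ 0 := by exact_mod_cast hI.ne'
  have hρ := badRatio_le hI bad hbad
  have ha0 : 0 ≤ (n : ℝ) * (bad.card / Fintype.card I) := by positivity
  have haN : (n : ℝ) * (bad.card / Fintype.card I) * Fintype.card I
      = Fintype.card (Fin n) * bad.card := by
    rw [Fintype.card_fin, mul_assoc, div_mul_cancel₀ _ hN0]
  generalize (n : ℝ) * (bad.card / Fintype.card I) = a at hρ ha0 haN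
  have hm0 : (0 : ℝ) ≤ m := Nat.cast_nonneg m
  -- Cantelli with `c = a - 1/2`: as `a ≤ 101 m / 200`, the threshold `m + 1` lies at least `3/2 +
  -- 99 m / 200` above `c`. The resulting ratio stays below `0.21` for all `m`; the worst case is
  -- near `m = 2`.
  have h := card_perm_hits_mul_sq_le e bad haN hI (u := m + 1) (c := a - 1 / 2) (by linarith)
  have hfac : (0 : ℝ) ≤ (Fintype.card I)! := Nat.cast_nonneg _
  have h3 : 0 < ((m : ℝ) + 1 - (a - 1 / 2)) ^ 2 := by
    have : 0 < (m : ℝ) + 1 - (a - 1 / 2) := by linarith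
    positivity
  have h2 : a + (a - (a - 1 / 2)) ^ 2 ≤ 0.21 * ((m : ℝ) + 1 - (a - 1 / 2)) ^ 2 := by
    have g2 : 3 / 2 + 99 / 200 * (m : ℝ) ≤ m + 1 - (a - 1 / 2) := by linarith
    have g3 : (3 / 2 + 99 / 200 * (m : ℝ)) ^ 2 ≤ (m + 1 - (a - 1 / 2)) ^ 2 := by gcongr
    have g4 : 101 / 200 * (m : ℝ) + 1 / 4 ≤ 0.21 * (3 / 2 + 99 / 200 * (m : ℝ)) ^ 2 := by
      nlinarith [sq_nonneg ((m : ℝ) - 19 / 10)]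
    have g5 : (a - (a - 1 / 2)) ^ 2 = 1 / 4 := by ring
    rw [g5]
    linarith
  refine le_of_mul_le_mul_right (h.trans ?_) h3
  rw [mul_assoc]
  exact mul_le_mul_of_nonneg_left h2 hfac

/-- Chebyshev's inequality for the number of bad points among the validation points. -/
lemma card_perm_many_bad_validation_le (hI : 0 < Fintype.card I) (hmn : 2 * m < n) (hW : 1000 ≤ W)
    (e : Fin W ↪ I) (bad : Finset I)
    (hbad : 200 * (n * bad.card) ≤ 101 * (m * Fintype.card I)) :
    ((Finset.univ.filter fun τ : Equiv.Perm I =>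
      9 / 20 * (W : ℝ) ≤ ((Finset.univ.filter fun i => τ (e i) ∈ bad).card : ℝ)).card : ℝ)
      ≤ (Fintype.card I)! * 0.0066 := by
  have hN0 : (Fintype.card I : ℝ) ≠ 0 := by exact_mod_cast hI.ne'
  have hρ := badRatio_le hI bad hbad
  have hn0 : (0 : ℝ) < n := by
    have : 0 < n := by omega
    exact_mod_cast this
  have hmnR : 2 * (m : ℝ) ≤ n := by exact_mod_cast hmn.le
  have hWR : (1000 : ℝ) ≤ W := by exact_mod_cast hW
  have hρ0 : 0 ≤ (bad.card : ℝ) / Fintype.card I := by positivity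
  have haN : (W : ℝ) * (bad.card / Fintype.card I) * Fintype.card I
      = Fintype.card (Fin W) * bad.card := by
    rw [Fintype.card_fin, mul_assoc, div_mul_cancel₀ _ hN0]
  generalize (bad.card : ℝ) / Fintype.card I = ρ at hρ hρ0 haN
  -- The bad fraction is at most `101/200 * (m / n)`, and `2 m < n`.
  have hρ2 : ρ ≤ 101 / 400 := by
    have : (400 * ρ) * n ≤ 101 * n := by linarith
    have := le_of_mul_le_mul_right this hn0
    linarith
  have haW : (W : ℝ) * ρ ≤ 101 / 400 * W := by
    rw [mul_comm]; gcongr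
  generalize (W : ℝ) * ρ = a at haN haW
  have h := card_perm_hits_mul_sq_le e bad haN hI (u := 9 / 20 * W) (c := a) (by linarith)
  have hfac : (0 : ℝ) ≤ (Fintype.card I)! := Nat.cast_nonneg _
  have g1 : 79 / 400 * (W : ℝ) ≤ 9 / 20 * W - a := by linarith
  have h3 : 0 < (9 / 20 * (W : ℝ) - a) ^ 2 := by
    have : 0 < 9 / 20 * (W : ℝ) - a := by linarith
    positivity
  have h2 : a + (a - a) ^ 2 ≤ 0.0066 * (9 / 20 * (W : ℝ) - a) ^ 2 := by
    have g2 : (79 / 400 * (W : ℝ)) ^ 2 ≤ (9 / 20 * W - a) ^ 2 := by gcongr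
    have g3 : 101 / 400 * (W : ℝ) ≤ 0.0066 * (79 / 400 * (W : ℝ)) ^ 2 := by nlinarith
    rw [sub_self]
    linarith
  refine le_of_mul_le_mul_right (h.trans ?_) h3
  rw [mul_assoc]
  exact mul_le_mul_of_nonneg_left h2 hfac

open Classical in
/-- A batch at random positions errs with probability less than one half. -/
theorem sum_perm_batchTest_le {T : Bool → (Fin n → E d) → ℝ≥0∞}
    (hΛ : 6 ≤ Λ) (hC5 : Λ ^ 5 ≤ C) (hC : (C : ℝ) ≤ Λ ^ 6) (hε : ε * n = m) (hd : 0 < d)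
    (hmn : 2 * m < n) (hharm : ∀ k ≤ n, (harmonic k : ℝ) ≤ Λ)
    (hn : (n : ℝ) + 1 ≤ Real.exp (Λ / 2)) (hW : 1000 ≤ W)
    (hT : ∀ b, Measurable (T b)) (hT1 : ∀ x, T true x + T false x = 1) {r : ℝ≥0∞}
    (hr : r ≤ ENNReal.ofReal (1 / 3)) (b : Bool) (μ : E d)
    (hb : b = false → μ = 0) (hgood : IsGoodTest T Λ ε m r b μ)
    (hI0 : 0 < Fintype.card I) (hI : (Fintype.card I : ℝ) ≤ Real.exp (Λ ^ 2))
    (bad : Finset I) (hbad : 200 * (n * bad.card) ≤ 101 * (m * Fintype.card I)) (x : I → E d)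
    (e : Batch n W ↪ I) :
    ∑ τ : Equiv.Perm I, ∫⁻ z, batchTest T Λ (!b) (batchData bad x μ (fun p => τ (e p)) z)
        ∂(Measure.pi fun _ : Batch n W => stdGaussian (E d))
      ≤ (Fintype.card I)! * ENNReal.ofReal 0.49 := by
  set G := bad.filter fun ι => NormTypical Λ (x ι) with hG
  set B1 := Finset.univ.filter fun τ : Equiv.Perm I => (m : ℝ) + 1 ≤
    ((Finset.univ.filter fun i => τ (e (Sum.inl (Sum.inl i))) ∈ bad).card : ℝ) with hB1
  set B2 := Finset.univ.filter fun τ : Equiv.Perm I => 9 / 20 * (W : ℝ) ≤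
    ((Finset.univ.filter fun i => τ (e (Sum.inr i)) ∈ bad).card : ℝ) with hB2
  set B3 := Finset.univ.filter fun τ : Equiv.Perm I => ¬ AlikeHalfspaces Λ d m C n
    (Finset.univ.filter fun i => τ (e (Sum.inl (Sum.inl i))) ∈ G)
    (Finset.univ.filter fun i => τ (e (Sum.inl (Sum.inr i))) ∈ G)
    (fun i => x (τ (e (Sum.inl (Sum.inl i))))) (fun i => x (τ (e (Sum.inl (Sum.inr i))))) with hB3
  have hfac : (0 : ℝ) ≤ (Fintype.card I)! := Nat.cast_nonneg _
  have hc1 : (B1.card : ℝ) ≤ (Fintype.card I)! * 0.21 := card_perm_many_bad_le hI0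
    (((Function.Embedding.inl (β := Fin n)).trans Function.Embedding.inl).trans e) bad hbad
  have hc2 : (B2.card : ℝ) ≤ (Fintype.card I)! * 0.0066 := card_perm_many_bad_validation_le hI0 hmn hW
    (Function.Embedding.inr.trans e) bad hbad
  have hc3 : (B3.card : ℝ) ≤ (Fintype.card I)! * 0.0001 :=
    card_perm_not_alikeHalfspaces_le hΛ hC5 hn hI0 hI (Function.Embedding.inl.trans e) G x
  -- Outside the exceptional permutations the error is at most `0.34`; altogether it is at most
  -- `0.34 + 0.66 * (0.21 + 0.0066 + 0.0001) < 0.49`.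
  have hpt : ∀ τ : Equiv.Perm I,
      ∫⁻ z, batchTest T Λ (!b) (batchData bad x μ (fun p => τ (e p)) z)
        ∂(Measure.pi fun _ : Batch n W => stdGaussian (E d))
      ≤ ENNReal.ofReal (0.34 + if τ ∈ B1 ∪ B2 ∪ B3 then 0.66 else 0) := by
    intro τ
    by_cases hτ : τ ∈ B1 ∪ B2 ∪ B3
    · rw [if_pos hτ]
      refine (lintegral_mono fun z => show _ ≤ (1 : ℝ≥0∞) from
        batchOut_le_one hT hT1 (fun Q => tupWeight_pos Q) _ _ _ _).trans ?_
      norm_num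
    · rw [if_neg hτ, add_zero]
      simp only [Finset.mem_union, not_or, hB1, hB2, hB3, Finset.mem_filter, Finset.mem_univ,
        true_and, not_le, not_not] at hτ
      obtain ⟨⟨h1, h2⟩, h3⟩ := hτ
      refine lintegral_batchTest_le hΛ hC5 hC hε hd (by omega) hharm hn (by omega) hT hT1 hr b μ hb
        hgood bad x (fun p => τ (e p)) ?_ ?_ (by convert h3)
      · have : (((Finset.univ.filter fun i => τ (e (Sum.inl (Sum.inl i))) ∈ bad).card : ℕ) : ℝ)
            < ((m + 1 : ℕ) : ℝ) := by push_cast; exact h1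
        exact Nat.lt_succ_iff.mp (by exact_mod_cast this)
      · have : (20 * ((Finset.univ.filter fun i => τ (e (Sum.inr i)) ∈ bad).card : ℕ) : ℝ)
            ≤ 9 * W := by linarith
        exact_mod_cast this
  refine (Finset.sum_le_sum fun τ _ => hpt τ).trans ?_
  rw [← ENNReal.ofReal_sum_of_nonneg fun τ _ => by split_ifs <;> norm_num,
    ← ENNReal.ofReal_natCast, ← ENNReal.ofReal_mul hfac]
  refine ENNReal.ofReal_le_ofReal ?_
  rw [Finset.sum_add_distrib, Finset.sum_ite_mem, Finset.univ_inter, Finset.sum_const,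
    Finset.sum_const, Finset.card_univ, Fintype.card_perm, nsmul_eq_mul, nsmul_eq_mul]
  have hcard : ((B1 ∪ B2 ∪ B3).card : ℝ) ≤ B1.card + B2.card + B3.card := by
    have h1 := Finset.card_union_le (B1 ∪ B2) B3
    have h2 := Finset.card_union_le B1 B2
    exact_mod_cast h1.trans (by omega)
  linarith

end

/-! ### From the given tester to a symmetric test that rejects unfriendly data. -/

section

variable {d n m : ℕ} {κ Λ ε p : ℝ}

lemma isFriendly_iff {X : Fin n → E d} : IsFriendly κ ε X ↔
    (∀ S T : Finset (Fin n), Disjoint S T → (S.card : ℝ) ≤ ε * n → (T.card : ℝ) ≤ ε * n →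
      |inner ℝ (∑ i ∈ S, X i) (∑ i ∈ T, X i)| ≤
        κ * (√((S.card : ℝ) * T.card) * max (√(ε * n * d)) (ε * n))) ∧
    (∀ i j : Fin n, i ≠ j → |inner ℝ (X i) (X j)| ≤ κ * √d) ∧
    ∀ i : Fin n, |‖X i‖ ^ 2 - d| ≤ κ * √d :=
  ⟨fun h => ⟨h.1, h.2, h.3⟩, fun h => ⟨h.1, h.2.1, h.2.2⟩⟩

lemma measurableSet_isFriendly : MeasurableSet {X : Fin n → E d | IsFriendly κ ε X} := by
  simp only [isFriendly_iff]
  have hi : ∀ f g : (Fin n → E d) → E d, Measurable f → Measurable g → ∀ c : ℝ,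
      Measurable fun X => |inner ℝ (f X) (g X)| ≤ c := fun f g hf hg c =>
    measurableSet_setOfPred.mp (measurableSet_le (hf.inner hg).abs measurable_const)
  refine measurableSet_setOfPred.mpr (Measurable.and ?_ (Measurable.and ?_ ?_))
  · refine Measurable.forall fun S => Measurable.forall fun T => ?_
    refine Measurable.imp measurable_const (Measurable.imp measurable_const
      (Measurable.imp measurable_const (hi _ _ ?_ ?_ _))) <;> fun_prop
  · refine Measurable.forall fun i => Measurable.forall fun j => ?_
    exact Measurable.imp measurable_const (hi _ _ (by fun_prop) (by fun_prop) _)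
  · refine Measurable.forall fun i => ?_
    refine measurableSet_setOfPred.mp (measurableSet_le ?_ measurable_const)
    fun_prop

lemma IsFriendly.comp_perm {X : Fin n → E d} (h : IsFriendly κ ε X) (π : Equiv.Perm (Fin n)) :
    IsFriendly κ ε fun i => X (π i) := by
  refine ⟨fun S T hST hS hT => ?_, fun i j hij => h.inner_le _ _ (π.injective.ne hij),
    fun i => h.norm_sq _⟩
  have := h.cross_sum (S.map π.toEmbedding) (T.map π.toEmbedding)
    ((Finset.disjoint_map _).mpr hST) (by simpa using hS) (by simpa using hT)
  simpa using this

lemma isFriendly_comp_perm_iff {X : Fin n → E d} (π : Equiv.Perm (Fin n)) :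
    IsFriendly κ ε (fun i => X (π i)) ↔ IsFriendly κ ε X :=
  ⟨fun h => by simpa using h.comp_perm π⁻¹, fun h => h.comp_perm π⟩

lemma measurable_plant (k : ℕ) (y : Fin n → E d) : Measurable fun z => plant k y z := by
  refine measurable_pi_lambda _ fun i => ?_
  unfold plant
  split_ifs <;> fun_prop

lemma measurable_plant_add (k : ℕ) (y : Fin n → E d) (μ : E d) :
    Measurable fun z : Fin n → E d => plant k y fun j => μ + z j :=
  (measurable_plant k y).comp (by fun_prop : Measurable fun (z : Fin n → E d) j => μ + z j)

lemma measurePreserving_add_gaussian (μ : E d) :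
    MeasurePreserving (fun (z : Fin n → E d) i => μ + z i)
      (Measure.pi fun _ => stdGaussian (E d)) (Measure.pi fun _ => gaussian d μ) :=
  measurePreserving_pi _ _ fun _ => ⟨by fun_prop, rfl⟩

lemma lintegral_contaminatedLaw (k : ℕ) (μ : E d) (y : Fin n → E d) {f : (Fin n → E d) → ℝ≥0∞}
    (hf : Measurable f) :
    ∫⁻ x, f x ∂(contaminatedLaw n k (gaussian d μ) y)
      = (n ! : ℝ≥0∞)⁻¹ * ∑ σ : Equiv.Perm (Fin n),
        ∫⁻ z, f (fun i => plant k y (fun j => μ + z j) (σ i))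
          ∂(Measure.pi fun _ : Fin n => stdGaussian (E d)) := by
  rw [contaminatedLaw, lintegral_smul_measure, lintegral_finsetSum_measure, smul_eq_mul]
  congr 1
  refine Finset.sum_congr rfl fun σ _ => ?_
  have hm : Measurable fun (z : Fin n → E d) i => plant k y z (σ i) :=
    measurable_pi_lambda _ fun i => (measurable_pi_apply (σ i)).comp (measurable_plant k y)
  have hfm : Measurable fun z : Fin n → E d => f fun i => plant k y z (σ i) := hf.comp hm
  rw [lintegral_map hf hm, ← (measurePreserving_add_gaussian μ).lintegral_comp hfm]

section

variable {Ω : Type*} [MeasurableSpace Ω] (ν : Measure Ω) [IsProbabilityMeasure ν]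
  (A : Kernel Ω Bool) [IsMarkovKernel A] {P : Ω → Prop}

open Classical in
lemma compProd_promise_error (hP : MeasurableSet {x | P x}) (b : Bool) :
    (ν ⊗ₘ A) {xb | P xb.1 → xb.2 = b}ᶜ = ∫⁻ x, (if P x then A x {!b} else 0) ∂ν := by
  have hs : MeasurableSet {xb : Ω × Bool | P xb.1 → xb.2 = b}ᶜ := by
    refine MeasurableSet.compl (measurableSet_setOfPred.mpr (Measurable.imp ?_ ?_))
    · exact (measurableSet_setOfPred.mp hP).comp measurable_fst
    · exact measurableSet_setOfPred.mp (measurable_snd (measurableSet_singleton b))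
  rw [Measure.compProd_apply hs]
  refine lintegral_congr fun x => ?_
  split_ifs with h
  · congr 1
    ext c
    simp only [Set.mem_preimage, Set.mem_compl_iff, Set.mem_ofPred_eq, h, true_imp_iff,
      Set.mem_singleton_iff]
    cases b <;> cases c <;> simp
  · convert measure_empty (μ := A x)
    ext c
    simp [h]

open Classical in
lemma le_compProd_real_iff (hP : MeasurableSet {x | P x}) (b : Bool) :
    p ≤ (ν ⊗ₘ A).real {xb | P xb.1 → xb.2 = b} ↔
      ∫⁻ x, (if P x then A x {!b} else 0) ∂ν ≤ ENNReal.ofReal (1 - p) ∧ p ≤ 1 := by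
  have hs : MeasurableSet {xb : Ω × Bool | P xb.1 → xb.2 = b} := by
    refine measurableSet_setOfPred.mpr (Measurable.imp ?_ ?_)
    · exact (measurableSet_setOfPred.mp hP).comp measurable_fst
    · exact measurableSet_setOfPred.mp (measurable_snd (measurableSet_singleton b))
  rw [← compProd_promise_error ν A hP b, ← ofReal_measureReal]
  have h1 := probReal_add_probReal_compl (μ := ν ⊗ₘ A) hs
  have h2 : (ν ⊗ₘ A).real {xb | P xb.1 → xb.2 = b} ≤ 1 := measureReal_le_one
  constructor
  · intro h
    exact ⟨ENNReal.ofReal_le_ofReal (by linarith), h.trans h2⟩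
  · rintro ⟨h, hp⟩
    have := (ENNReal.ofReal_le_ofReal_iff (by linarith)).mp h
    linarith

end

open Classical in
/-- The test that rejects data that is not friendly, and otherwise permutes the data at random and
runs `A`. -/
noncomputable def symmTest (A : Kernel (Fin n → E d) Bool) (κ ε : ℝ) (b : Bool) (x : Fin n → E d) :
    ℝ≥0∞ :=
  if IsFriendly κ ε x then (n ! : ℝ≥0∞)⁻¹ * ∑ π : Equiv.Perm (Fin n), A (fun i => x (π i)) {b}
  else if b then 1 else 0

lemma measurable_symmTest (A : Kernel (Fin n → E d) Bool) (b : Bool) :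
    Measurable (symmTest A κ ε b) := by
  classical
  unfold symmTest
  refine Measurable.ite measurableSet_isFriendly ?_ measurable_const
  refine Measurable.const_mul (Finset.measurable_fun_sum _ fun π _ => ?_) _
  exact (A.measurable_coe (measurableSet_singleton b)).comp (by fun_prop)

lemma factorial_inv_mul_cancel (n : ℕ) : (n ! : ℝ≥0∞)⁻¹ * n ! = 1 :=
  ENNReal.inv_mul_cancel (by exact_mod_cast n.factorial_ne_zero) (ENNReal.natCast_ne_top _)

lemma symmTest_add (A : Kernel (Fin n → E d) Bool) [IsMarkovKernel A] (x : Fin n → E d) :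
    symmTest A κ ε true x + symmTest A κ ε false x = 1 := by
  unfold symmTest
  split_ifs
  · rw [← mul_add, ← Finset.sum_add_distrib]
    have : ∀ w : Fin n → E d, A w {true} + A w {false} = 1 := by
      intro w
      rw [← measure_union (by simp) (measurableSet_singleton _)]
      have : ({true} ∪ {false} : Set Bool) = Set.univ := by
        ext c; cases c <;> simp
      rw [this, measure_univ]
    simp only [this]
    simp [Fintype.card_perm, factorial_inv_mul_cancel]
  all_goals simp_all

/-- A permutation that moves a set of `m` elements to the first `m` places. -/
lemma exists_perm_lt_iff (J : Finset (Fin n)) (hJ : J.card = m) :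
    ∃ ρ : Equiv.Perm (Fin n), ∀ i, ((ρ i : Fin n) : ℕ) < m ↔ i ∈ J := by
  have hmn : m ≤ n := by rw [← hJ]; exact (Finset.card_le_univ J).trans (by simp)
  have h2 : Fintype.card {i : Fin n // i ∈ J} = Fintype.card {i : Fin n // (i : ℕ) < m} := by
    rw [Fintype.card_coe, hJ, Fintype.card_subtype]
    have : (Finset.univ.filter fun i : Fin n => (i : ℕ) < m) = Finset.univ.map (Fin.castLEEmb hmn) := by
      ext i
      simp only [Finset.mem_filter, Finset.mem_univ, true_and, Finset.mem_map, Fin.castLEEmb_apply]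
      exact ⟨fun h => ⟨⟨i, h⟩, rfl⟩, fun ⟨a, ha⟩ => by rw [← ha]; exact a.2⟩
    rw [this]
    simp
  obtain e := Fintype.equivOfCardEq h2
  refine ⟨e.extendSubtype, fun i => ⟨fun h => ?_, fun h => e.extendSubtype_mem i h⟩⟩
  by_contra hi
  exact e.extendSubtype_not_mem i hi h

lemma measurePreserving_comp_perm (ρ : Equiv.Perm (Fin n)) (ν : Measure (E d))
    [IsProbabilityMeasure ν] :
    MeasurePreserving (fun (z : Fin n → E d) i => z (ρ i)) (Measure.pi fun _ => ν)
      (Measure.pi fun _ => ν) := by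
  have h := measurePreserving_piCongrLeft (fun _ : Fin n => ν) ρ.symm
  convert h using 1
  funext z i
  have := (MeasurableEquiv.piCongrLeft (fun _ => E d) ρ.symm).apply_symm_apply
  rw [MeasurableEquiv.coe_piCongrLeft]
  have h2 := Equiv.piCongrLeft_apply_apply (P := fun _ : Fin n => E d) ρ.symm z (ρ i)
  simpa using h2.symm

-- The contaminated law plants the bad points at the first `m` places and permutes. The random
-- permutation inside `symmTest` does the same for any set `J` of `m` places: a permutation carrying
-- `J` to the first places only reindexes the average.
open Classical in
lemma sum_perm_lintegral_mixPts_le {A : Kernel (Fin n → E d) Bool} [IsMarkovKernel A] {b : Bool}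
    {μ : E d} (hm : ⌊ε * n⌋₊ = m)
    (hA : ∀ y, p ≤ (contaminatedLaw n ⌊ε * n⌋₊ (gaussian d μ) y ⊗ₘ A).real
      {xb | IsFriendly κ ε xb.1 → xb.2 = b})
    (J : Finset (Fin n)) (hJ : J.card = m) (y : Fin n → E d) :
    ∫⁻ z, (if IsFriendly κ ε (mixPts J y (fun _ => μ) z) then
        symmTest A κ ε (!b) (mixPts J y (fun _ => μ) z) else 0)
        ∂(Measure.pi fun _ : Fin n => stdGaussian (E d)) ≤ ENNReal.ofReal (1 - p) := by
  obtain ⟨ρ, hρ⟩ := exists_perm_lt_iff J hJ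
  have h := ((le_compProd_real_iff _ A measurableSet_isFriendly b).mp
    (hA fun i => y (ρ⁻¹ i))).1
  set F : (Fin n → E d) → ℝ≥0∞ := fun x => if IsFriendly κ ε x then A x {!b} else 0 with hF
  have hFm : Measurable F := Measurable.ite measurableSet_isFriendly
    (A.measurable_coe (measurableSet_singleton _)) measurable_const
  rw [lintegral_contaminatedLaw _ _ _ hFm, hm] at h
  refine le_trans (le_of_eq ?_) h
  have hT : ∀ x, (if IsFriendly κ ε x then symmTest A κ ε (!b) x else 0)
      = (n ! : ℝ≥0∞)⁻¹ * ∑ π : Equiv.Perm (Fin n), F fun i => x (π i) := by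
    intro x
    simp only [hF, isFriendly_comp_perm_iff]
    split_ifs with hx
    · rw [symmTest, if_pos hx]
    · simp
  simp only [hT]
  have hFπ : ∀ π : Equiv.Perm (Fin n), Measurable fun z : Fin n → E d =>
      F fun i => mixPts J y (fun _ => μ) z (π i) := fun π =>
    hFm.comp (measurable_pi_lambda _ fun i =>
      (measurable_pi_apply (π i)).comp (measurable_mixPts J y fun _ => μ))
  rw [lintegral_const_mul _ (Finset.measurable_fun_sum _ fun π _ => hFπ π),
    lintegral_finsetSum _ fun π _ => hFπ π]
  congr 1
  refine Fintype.sum_equiv (Equiv.mulLeft ρ) _ _ fun π => ?_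
  have hmp := measurePreserving_comp_perm ρ⁻¹ (stdGaussian (E d))
  have hG : Measurable fun z : Fin n → E d => F fun i =>
      plant m (fun i => y (ρ⁻¹ i)) (fun j => μ + z j) ((Equiv.mulLeft ρ π) i) :=
    hFm.comp (measurable_pi_lambda _ fun i =>
      measurable_pi_iff.mp (measurable_plant_add m (fun i => y (ρ⁻¹ i)) μ) _)
  rw [← hmp.lintegral_comp hG]
  refine lintegral_congr fun z => ?_
  congr 1
  funext i
  simp [plant, mixPts, hρ]

/-- With fewer than `m` bad points, `J` is enlarged to `m` places, and the added places hold an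
independent sample from `N(μ, I)`, fixed before the guarantee is applied. Rejecting unfriendly data
is right under an alternative; under the null hypothesis it costs the probability of such data. -/
theorem isGoodTest_symmTest {A : Kernel (Fin n → E d) Bool} [IsMarkovKernel A] {b : Bool} {μ : E d}
    (hm : ⌊ε * n⌋₊ = m) (hmn : m ≤ n)
    (hA : ∀ y, p ≤ (contaminatedLaw n ⌊ε * n⌋₊ (gaussian d μ) y ⊗ₘ A).real
      {xb | IsFriendly (Λ ^ 2000) ε xb.1 → xb.2 = b}) :
    IsGoodTest (symmTest A (Λ ^ 2000) ε) Λ ε m (ENNReal.ofReal (1 - p)) b μ := by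
  classical
  intro J y hJ
  obtain ⟨J', hJJ', -, hJ'⟩ := Finset.exists_subsuperset_card_eq (Finset.subset_univ J) hJ
    (by simpa using hmn)
  set γ := Measure.pi fun _ : Fin n => stdGaussian (E d) with hγ
  set T := symmTest A (Λ ^ 2000) ε with hT
  set F : (Fin n → E d) → ℝ≥0∞ := fun x => if IsFriendly (Λ ^ 2000) ε x then T (!b) x else 0 with hF
  have hFm : Measurable F :=
    Measurable.ite measurableSet_isFriendly (measurable_symmTest A _) measurable_const
  have hX : Measurable fun z : Fin n → E d => mixPts J y (fun _ => μ) z := measurable_mixPts J y _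
  have hFX : Measurable fun z => F (mixPts J y (fun _ => μ) z) := hFm.comp hX
  have hmix := measurePreserving_mix (ι := Fin n) (stdGaussian (E d)) (fun i => i ∉ J')
  have key : ∫⁻ z, F (mixPts J y (fun _ => μ) z) ∂γ ≤ ENNReal.ofReal (1 - p) := by
    have hFX' : Measurable fun a : (Fin n → E d) × (Fin n → E d) =>
        F (mixPts J y (fun _ => μ) fun i => if i ∉ J' then a.1 i else a.2 i) :=
      hFX.comp hmix.measurable
    rw [← hmix.lintegral_comp hFX, lintegral_prod_symm _ hFX'.aemeasurable]
    refine (lintegral_mono (g := fun _ => ENNReal.ofReal (1 - p)) fun z' => ?_).trans (by simp)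
    have h := sum_perm_lintegral_mixPts_le hm hA J' hJ' (mixPts J y (fun _ => μ) z')
    refine le_trans (le_of_eq (lintegral_congr fun z => ?_)) h
    have : mixPts J y (fun _ => μ) (fun i => if i ∉ J' then z i else z' i)
        = mixPts J' (mixPts J y (fun _ => μ) z') (fun _ => μ) z := by
      funext i
      by_cases hi : i ∈ J
      · simp [mixPts, hi, hJJ' hi]
      · by_cases hi' : i ∈ J' <;> simp [mixPts, hi, hi']
    simp only [hF, this, hT]
  have hS : MeasurableSet {z | ¬ IsFriendly (Λ ^ 2000) ε (mixPts J y (fun _ => μ) z)} :=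
    (hX measurableSet_isFriendly).compl
  refine le_trans ?_ (add_le_add_left key _)
  cases b with
  | true =>
    simp only [if_true, add_zero]
    refine lintegral_mono fun z => ?_
    simp only [hF]
    split_ifs with h
    · exact le_rfl
    · simp [hT, symmTest, h]
  | false =>
    simp only [Bool.false_eq_true, if_false]
    rw [← lintegral_indicator_one hS, ← lintegral_add_left hFX]
    refine lintegral_mono fun z => ?_
    simp only [hF]
    by_cases h : IsFriendly (Λ ^ 2000) ε (mixPts J y (fun _ => μ) z)
    · simp [h]
    · simp [hT, symmTest, h]

end

/-! ### Products over disjoint blocks and the majority of independent bits. -/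

section

section

variable {α κ : Type*} [Fintype α] [DecidableEq α] [DecidableEq κ]

/-- If the factors depend on the values of a permutation on disjoint blocks, and each factor is at
most `ρ` on average given the values on other blocks, then the product is at most a power of `ρ`
on average. -/
lemma sum_perm_prod_le (B : κ → Finset α)
    (q : κ → Equiv.Perm α → ℝ≥0∞)
    (hlocal : ∀ k (σ τ : Equiv.Perm α), (∀ i ∈ B k, τ i = i) → q k (σ * τ) = q k σ)
    {ρ : ℝ≥0∞} (S : Finset κ)
    (hq : ∀ S' ⊆ S, ∀ k ∈ S, k ∉ S' → ∀ σ, ∑ τ : Equiv.Perm {i // i ∉ S'.biUnion B},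
      q k (σ * Equiv.Perm.ofSubtype τ) ≤ (Fintype.card {i // i ∉ S'.biUnion B})! * ρ) :
    ∑ σ, ∏ k ∈ S, q k σ ≤ (Fintype.card α)! * ρ ^ S.card := by
  induction S using Finset.induction_on with
  | empty => simp [Fintype.card_perm]
  | insert k S hk ih =>
    have ih' := ih fun S' hS' l hl => hq S' (hS'.trans (Finset.subset_insert _ _)) l
      (Finset.mem_insert_of_mem hl)
    set N := (Fintype.card {i // i ∉ S.biUnion B})! with hN
    have hN0 : (N : ℝ≥0∞) ≠ 0 := by exact_mod_cast Nat.factorial_ne_zero _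
    have hNt : (N : ℝ≥0∞) ≠ ⊤ := ENNReal.natCast_ne_top _
    -- A permutation that fixes the blocks of `S` leaves all factors but that of `k` unchanged.
    -- Averaging over these permutations takes the conditional mean of the factor of `k` given the
    -- other blocks.
    have hmove : ∀ τ : Equiv.Perm {i // i ∉ S.biUnion B},
        ∑ σ, ∏ l ∈ insert k S, q l σ
          = ∑ σ, (∏ l ∈ S, q l σ) * q k (σ * Equiv.Perm.ofSubtype τ) := by
      intro τ
      rw [← Equiv.sum_comp (Equiv.mulRight (Equiv.Perm.ofSubtype τ))]
      refine Finset.sum_congr rfl fun σ _ => ?_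
      rw [Finset.prod_insert hk, mul_comm]
      congr 1
      refine Finset.prod_congr rfl fun l hl => hlocal l σ _ fun i hi => ?_
      exact Equiv.Perm.ofSubtype_apply_of_not_mem τ
        (not_not.mpr (Finset.mem_biUnion.mpr ⟨l, hl, hi⟩))
    have h1 : (N : ℝ≥0∞) * ∑ σ, ∏ l ∈ insert k S, q l σ
        ≤ N * ((Fintype.card α)! * ρ ^ (insert k S).card) := by
      calc (N : ℝ≥0∞) * ∑ σ, ∏ l ∈ insert k S, q l σ
          = ∑ τ : Equiv.Perm {i // i ∉ S.biUnion B}, ∑ σ,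
              (∏ l ∈ S, q l σ) * q k (σ * Equiv.Perm.ofSubtype τ) := by
            rw [← Finset.sum_congr rfl fun τ _ => hmove τ, Finset.sum_const, Finset.card_univ,
              Fintype.card_perm, nsmul_eq_mul]
        _ = ∑ σ, (∏ l ∈ S, q l σ) * ∑ τ : Equiv.Perm {i // i ∉ S.biUnion B},
              q k (σ * Equiv.Perm.ofSubtype τ) := by
            rw [Finset.sum_comm]
            simp_rw [Finset.mul_sum]
        _ ≤ ∑ σ, (∏ l ∈ S, q l σ) * (N * ρ) := by
            gcongr with σ _
            exact hq S (Finset.subset_insert _ _) k (Finset.mem_insert_self _ _) hk σ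
        _ = (∑ σ, ∏ l ∈ S, q l σ) * (N * ρ) := by rw [Finset.sum_mul]
        _ ≤ ((Fintype.card α)! * ρ ^ S.card) * (N * ρ) := by gcongr
        _ = _ := by rw [Finset.card_insert_of_notMem hk, pow_succ]; ring
    exact (ENNReal.mul_le_mul_iff_right hN0 hNt).mp h1

end

section

variable {X ι κ : Type*} [MeasurableSpace X] [Fintype ι] [Fintype κ]

lemma measurePreserving_comp_embedding (ν : Measure X) [IsProbabilityMeasure ν] (e : κ ↪ ι) :
    MeasurePreserving (fun (z : ι → X) k => z (e k)) (Measure.pi fun _ => ν)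
      (Measure.pi fun _ => ν) := by
  classical
  have hm : Measurable fun (z : ι → X) k => z (e k) := by fun_prop
  refine ⟨hm, (Measure.pi_eq fun s hs => ?_).symm⟩
  rw [Measure.map_apply hm (MeasurableSet.univ_pi hs)]
  have : (fun (z : ι → X) k => z (e k)) ⁻¹' (Set.univ.pi s)
      = Set.univ.pi fun i => ⋂ k, ⋂ _ : e k = i, s k := by
    ext z
    simp only [Set.mem_preimage, Set.mem_pi, Set.mem_univ, true_imp_iff, Set.mem_iInter]
    exact ⟨fun h i k hk => hk ▸ h k, fun h k => h _ k rfl⟩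
  rw [this, Measure.pi_pi]
  have h2 : ∀ k, (⋂ l, ⋂ _ : e l = e k, s l) = s k := by
    intro k
    ext w
    simp only [Set.mem_iInter, e.injective.eq_iff]
    exact ⟨fun h => h k rfl, fun h l hl => hl ▸ h⟩
  rw [← Finset.prod_subset (Finset.subset_univ (Finset.univ.map e)), Finset.prod_map]
  · simp only [h2]
  · intro i _ hi
    have : (⋂ k, ⋂ _ : e k = i, s k) = Set.univ := by
      refine Set.iInter_eq_univ.mpr fun k => Set.iInter_eq_univ.mpr fun hk => ?_
      exact absurd (Finset.mem_map.mpr ⟨k, Finset.mem_univ _, hk⟩) hi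
    rw [this, measure_univ]

lemma lintegral_mul_of_disjoint (ν : Measure X) [IsProbabilityMeasure ν] (p : ι → Prop)
    [DecidablePred p] {f g : (ι → X) → ℝ≥0∞} (hf : Measurable f) (hg : Measurable g)
    (hfp : ∀ z w, (∀ i, p i → z i = w i) → f z = f w)
    (hgp : ∀ z w, (∀ i, ¬ p i → z i = w i) → g z = g w) :
    ∫⁻ z, f z * g z ∂(Measure.pi fun _ => ν)
      = (∫⁻ z, f z ∂(Measure.pi fun _ => ν)) * ∫⁻ z, g z ∂(Measure.pi fun _ => ν) := by
  have h := measurePreserving_mix (ι := ι) ν p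
  have hfg : Measurable fun z => f z * g z := hf.mul hg
  rw [← h.lintegral_comp hfg, ← lintegral_prod_mul hf.aemeasurable hg.aemeasurable]
  refine lintegral_congr fun z => ?_
  rw [hfp (fun i => if p i then z.1 i else z.2 i) z.1 fun i hi => if_pos hi,
    hgp (fun i => if p i then z.1 i else z.2 i) z.2 fun i hi => if_neg hi]

lemma lintegral_prod_blocks {β : Type*} (ν : Measure X) [IsProbabilityMeasure ν]
    (e : β → κ ↪ ι) (he : ∀ a b, a ≠ b → ∀ k l, e a k ≠ e b l) {f : β → (κ → X) → ℝ≥0∞}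
    (hf : ∀ b, Measurable (f b)) (S : Finset β) :
    ∫⁻ z, ∏ b ∈ S, f b (fun k => z (e b k)) ∂(Measure.pi fun _ => ν)
      = ∏ b ∈ S, ∫⁻ z, f b z ∂(Measure.pi fun _ => ν) := by
  classical
  have hm : ∀ b, Measurable fun z : ι → X => f b fun k => z (e b k) := fun b =>
    (hf b).comp (by fun_prop)
  induction S using Finset.induction_on with
  | empty => simp
  | insert b S hb ih =>
    simp only [Finset.prod_insert hb]
    rw [lintegral_mul_of_disjoint ν (fun i => ∃ k, e b k = i) (hm b)
      (Finset.measurable_fun_prod _ fun c _ => hm c), ih,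
      (measurePreserving_comp_embedding ν (e b)).lintegral_comp (hf b)]
    · intro z w h
      congr 1
      funext k
      exact h _ ⟨k, rfl⟩
    · intro z w h
      refine Finset.prod_congr rfl fun c hc => ?_
      congr 1
      funext k
      refine h _ fun ⟨l, hl⟩ => he b c ?_ l k hl
      rintro rfl
      exact hb hc

end

section

variable {κ : Type*} [Fintype κ]

/-- The probability that a strict majority of independent bits are `b`, where `g k b` is the
probability that bit `k` is `b`. -/
noncomputable def majorityProb (g : κ → Bool → ℝ≥0∞) (b : Bool) : ℝ≥0∞ := by
  classical
  exact ∑ S ∈ (Finset.univ : Finset (Finset κ)).filter fun S => Fintype.card κ < 2 * S.card,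
    (∏ k ∈ S, g k b) * ∏ k ∈ Finset.univ \ S, g k (!b)

lemma majorityProb_add {g : κ → Bool → ℝ≥0∞} (hg : ∀ k, g k true + g k false = 1)
    (hκ : Odd (Fintype.card κ)) : majorityProb g true + majorityProb g false = 1 := by
  classical
  have h := Finset.prod_add (fun k => g k true) (fun k => g k false) Finset.univ
  simp only [hg, Finset.prod_const_one, Finset.powerset_univ] at h
  rw [h, ← Finset.sum_filter_add_sum_filter_not _ fun S : Finset κ => Fintype.card κ < 2 * S.card]
  unfold majorityProb
  congr 1
  refine Finset.sum_bij' (fun S _ => Finset.univ \ S) (fun S _ => Finset.univ \ S) ?_ ?_ ?_ ?_ ?_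
  · intro S hS
    simp only [Finset.mem_filter, Finset.mem_univ, true_and] at hS ⊢
    rw [Finset.card_univ_sdiff]
    omega
  · intro S hS
    simp only [Finset.mem_filter, Finset.mem_univ, true_and] at hS ⊢
    rw [Finset.card_univ_sdiff]
    have := Finset.card_le_univ S
    obtain ⟨c, hc⟩ := hκ
    omega
  · intro S _
    simp
  · intro S _
    simp
  · intro S _
    simp [mul_comm]

/-- Markov's inequality for the exponential moment: as `1 + δ g = (1 + δ) g + (1 - g)`, the right
side is the mean of `1 + δ` raised to the number of bits equal to `b`, and a majority has at least
`j + 1` of them. -/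
lemma majorityProb_mul_pow_le {g : κ → Bool → ℝ≥0∞} (hg : ∀ k, g k true + g k false = 1)
    (b : Bool) {j : ℕ} (hκ : Fintype.card κ = 2 * j + 1) (δ : ℝ≥0∞) :
    majorityProb g b * (1 + δ) ^ (j + 1) ≤ ∑ S : Finset κ, δ ^ S.card * ∏ k ∈ S, g k b := by
  classical
  have hg' : ∀ k, g k b + g k (!b) = 1 := by
    intro k
    cases b
    · rw [add_comm]; exact hg k
    · exact hg k
  have h1 : ∀ k, (1 + δ) * g k b + g k (!b) = δ * g k b + 1 := by
    intro k
    calc (1 + δ) * g k b + g k (!b) = δ * g k b + (g k b + g k (!b)) := by ring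
      _ = δ * g k b + 1 := by rw [hg']
  have h2 : ∑ S : Finset κ, δ ^ S.card * ∏ k ∈ S, g k b
      = ∑ S : Finset κ, (∏ k ∈ S, (1 + δ) * g k b) * ∏ k ∈ Finset.univ \ S, g k (!b) := by
    have e1 := Finset.prod_add (fun k => (1 + δ) * g k b) (fun k => g k (!b)) Finset.univ
    have e2 := Finset.prod_add (fun k => δ * g k b) (fun _ => 1) Finset.univ
    simp only [h1, Finset.powerset_univ] at e1 e2
    rw [← e1, e2]
    simp [Finset.prod_mul_distrib]
  rw [h2]
  unfold majorityProb
  rw [Finset.sum_mul]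
  refine (Finset.sum_le_sum fun S hS => ?_).trans
    (Finset.sum_le_sum_of_subset (Finset.filter_subset _ _))
  simp only [Finset.mem_filter, Finset.mem_univ, true_and] at hS
  rw [Finset.prod_mul_distrib, Finset.prod_const, mul_comm, ← mul_assoc]
  gcongr
  · exact le_self_add
  · omega

end

end

/-! ### The majority vote over batches. -/

section

variable {d n W m C N j : ℕ} {Λ ε : ℝ} {κ : Type*} [Fintype κ]

/-- The test that takes the majority vote of the batches at the positions `e`. -/
noncomputable def majorityTest (T : Bool → (Fin n → E d) → ℝ≥0∞) (Λ : ℝ) (e : κ × Batch n W ↪ Fin N)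
    (b : Bool) (x : Fin N → E d) : ℝ≥0∞ :=
  majorityProb (fun k c => batchTest T Λ c fun p => x (e (k, p))) b

lemma majorityTest_add {T : Bool → (Fin n → E d) → ℝ≥0∞} (hT : ∀ b, Measurable (T b))
    (hT1 : ∀ x, T true x + T false x = 1) (hκ : Odd (Fintype.card κ)) (e : κ × Batch n W ↪ Fin N)
    (x : Fin N → E d) : majorityTest T Λ e true x + majorityTest T Λ e false x = 1 :=
  majorityProb_add (fun _ => batchTest_add hT hT1 _) hκ

lemma measurable_majorityTest {T : Bool → (Fin n → E d) → ℝ≥0∞} (hT : ∀ b, Measurable (T b))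
    (e : κ × Batch n W ↪ Fin N) (b : Bool) : Measurable (majorityTest T Λ e b) := by
  have h : ∀ k c, Measurable fun x : Fin N → E d => batchTest T Λ c fun p => x (e (k, p)) :=
    fun k c => (measurable_batchTest hT c).comp (by fun_prop)
  unfold majorityTest majorityProb
  exact Finset.measurable_fun_sum _ fun S _ =>
    (Finset.measurable_fun_prod _ fun k _ => h k _).mul (Finset.measurable_fun_prod _ fun k _ => h k _)

/-- The batches in `S` all err with exponentially small probability. -/
lemma sum_perm_prod_batchTest_le {T : Bool → (Fin n → E d) → ℝ≥0∞}
    (hΛ : 6 ≤ Λ) (hC5 : Λ ^ 5 ≤ C) (hC : (C : ℝ) ≤ Λ ^ 6) (hε : ε * n = m) (hd : 0 < d)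
    (hmn : 2 * m < n) (hharm : ∀ k ≤ n, (harmonic k : ℝ) ≤ Λ)
    (hn : (n : ℝ) + 1 ≤ Real.exp (Λ / 2)) (hW : 1000 ≤ W)
    (hT : ∀ b, Measurable (T b)) (hT1 : ∀ x, T true x + T false x = 1) {r : ℝ≥0∞}
    (hr : r ≤ ENNReal.ofReal (1 / 3)) (b : Bool) (μ : E d)
    (hb : b = false → μ = 0) (hgood : IsGoodTest T Λ ε m r b μ)
    (hN : (N : ℝ) ≤ Real.exp (Λ ^ 2)) (e : κ × Batch n W ↪ Fin N) {k : ℕ}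
    (hk : 200 * (n * k) + 101 * (m * (Fintype.card κ * (2 * n + W))) ≤ 101 * (m * N))
    (hlt : Fintype.card κ * (2 * n + W) < N)
    (y : Fin N → E d) (S : Finset κ) :
    ∑ σ : Equiv.Perm (Fin N), ∫⁻ z, ∏ l ∈ S, batchTest T Λ (!b)
        (fun p => plant k y (fun i => μ + z i) (σ (e (l, p))))
        ∂(Measure.pi fun _ : Fin N => stdGaussian (E d))
      ≤ N ! * ENNReal.ofReal 0.49 ^ S.card := by
  classical
  set bad := Finset.univ.filter fun i : Fin N => (i : ℕ) < k with hbad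
  set q : κ → Equiv.Perm (Fin N) → ℝ≥0∞ := fun l σ => ∫⁻ z, batchTest T Λ (!b)
    (batchData bad y μ (fun p => σ (e (l, p))) z)
    ∂(Measure.pi fun _ : Batch n W => stdGaussian (E d)) with hq
  have hsplit : ∀ σ : Equiv.Perm (Fin N), ∫⁻ z, ∏ l ∈ S, batchTest T Λ (!b)
        (fun p => plant k y (fun i => μ + z i) (σ (e (l, p))))
        ∂(Measure.pi fun _ : Fin N => stdGaussian (E d)) = ∏ l ∈ S, q l σ := by
    intro σ
    set es : κ → Batch n W ↪ Fin N := fun l =>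
      ⟨fun p => σ (e (l, p)), fun p p' h => by simpa using h⟩ with hes
    have hes' : ∀ a b, a ≠ b → ∀ p p', es a p ≠ es b p' := by
      intro a b hab p p' h
      have h' : σ (e (a, p)) = σ (e (b, p')) := h
      simp only [EmbeddingLike.apply_eq_iff_eq, Prod.mk.injEq] at h'
      exact hab h'.1
    have h := lintegral_prod_blocks (stdGaussian (E d)) es hes'
      (f := fun l z => batchTest T Λ (!b) (batchData bad y μ (fun p => σ (e (l, p))) z))
      (fun l => (measurable_batchTest hT _).comp (measurable_batchData bad y μ _)) S
    refine Eq.trans ?_ h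
    refine lintegral_congr fun z => Finset.prod_congr rfl fun l _ => ?_
    congr 1
    funext p
    change plant k y (fun i => μ + z i) (σ (e (l, p)))
      = batchData bad y μ (fun p => σ (e (l, p))) (fun p => z (σ (e (l, p)))) p
    simp [plant, batchData, hbad]
  simp only [hsplit]
  set B : κ → Finset (Fin N) := fun l => Finset.univ.image fun p => e (l, p) with hB
  have hBc : ∀ S' : Finset κ, (S'.biUnion B).card ≤ Fintype.card κ * (2 * n + W) := by
    intro S'
    refine (Finset.card_biUnion_le_card_mul S' B (2 * n + W) fun l _ => ?_).trans
      (Nat.mul_le_mul_right _ (Finset.card_le_univ _))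
    refine Finset.card_image_le.trans (le_of_eq ?_)
    simp
    ring
  have h := sum_perm_prod_le B q (ρ := ENNReal.ofReal 0.49) ?_ S ?_
  · simpa using h
  · intro l σ τ h
    have : ∀ p, τ (e (l, p)) = e (l, p) := fun p =>
      h _ (Finset.mem_image_of_mem _ (Finset.mem_univ p))
    simp [hq, this]
  -- With the positions of the batches in `S'` fixed, `l` is a batch at random positions among the
  -- remaining ones. At most `k` of these hold bad points, and `hk` keeps the bad fraction at most
  -- `101/200 * (m / n)`.
  · intro S' _ l _ hl σ
    set R := {i // i ∉ S'.biUnion B} with hR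
    have hmem : ∀ p, e (l, p) ∉ S'.biUnion B := by
      intro p hp
      obtain ⟨l', hl', h⟩ := Finset.mem_biUnion.mp hp
      obtain ⟨p', -, h⟩ := Finset.mem_image.mp h
      have := e.injective h
      simp only [Prod.mk.injEq] at this
      exact hl (this.1 ▸ hl')
    set e' : Batch n W ↪ R := ⟨fun p => ⟨e (l, p), hmem p⟩, fun p p' h => by
      have := e.injective (congrArg Subtype.val h)
      simpa using this⟩ with he'
    have hRc : Fintype.card R = N - (S'.biUnion B).card := by
      simp only [hR, Fintype.card_subtype_compl, Fintype.card_fin, Fintype.card_coe]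
    have hBS := hBc S'
    have hR0 : 0 < Fintype.card R := by omega
    have hbadR : ((Finset.univ.filter fun i : R => σ i ∈ bad).card) ≤ k := by
      refine le_trans ?_ ((Fin.card_filter_val_lt (n := N) (m := k)).trans_le (min_le_right _ _))
      refine Finset.card_le_card_of_injOn (fun i : R => σ i) (fun i hi => ?_) ?_
      · simpa only [Finset.coe_filter, Finset.mem_univ, true_and, Set.mem_ofPred_eq, hbad,
          Finset.mem_filter] using hi
      · exact (σ.injective.comp Subtype.val_injective).injOn
    have h := sum_perm_batchTest_le hΛ hC5 hC hε hd hmn hharm hn hW hT hT1 hr b μ hb hgood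
      hR0 (le_trans (by exact_mod_cast (by omega : Fintype.card R ≤ N)) hN)
      (Finset.univ.filter fun i : R => σ i ∈ bad) ?_ (fun i => y (σ i)) e'
    · refine le_trans (le_of_eq (Finset.sum_congr rfl fun τ _ => ?_)) h
      refine lintegral_congr fun z => ?_
      congr 1
      funext p
      have hτ : Equiv.Perm.ofSubtype τ (e (l, p)) = τ (e' p) :=
        Equiv.Perm.ofSubtype_apply_of_mem τ (hmem p)
      simp [batchData, hτ]
    · have h1 : N ≤ Fintype.card R + Fintype.card κ * (2 * n + W) := by omega
      have h2 := Nat.mul_le_mul_left (101 * m) h1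
      have h3 := Nat.mul_le_mul_left (200 * n) hbadR
      nlinarith

/-- Since `(1 + 0.04 * 0.49)² * (1 + 1/2600) ≤ 1.04`, every increase of `j` gains a factor `1 +
1/2600`. By Bernoulli's inequality `j = 300000` gives a factor above `100`. -/
lemma le_of_mul_pow_le {w : ℝ≥0∞} (hj : 300000 ≤ j) (hle1 : w ≤ 1)
    (h1 : w * (1 + ENNReal.ofReal 0.04) ^ (j + 1)
      ≤ (1 + ENNReal.ofReal 0.04 * ENNReal.ofReal 0.49) ^ (2 * j + 1)) :
    w ≤ ENNReal.ofReal 0.01 := by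
  have hδ1 : 1 + ENNReal.ofReal 0.04 = ENNReal.ofReal 1.04 := by
    rw [← ENNReal.ofReal_one, ← ENNReal.ofReal_add (by norm_num) (by norm_num)]
    norm_num
  lift w to NNReal using ne_top_of_le_ne_top ENNReal.one_ne_top hle1
  rw [hδ1, ← ENNReal.ofReal_mul (by norm_num), ← ENNReal.ofReal_one,
    ← ENNReal.ofReal_add (by norm_num) (by norm_num), ← ENNReal.ofReal_pow (by norm_num),
    ← ENNReal.ofReal_pow (by norm_num), ← ENNReal.ofReal_coe_nnreal,
    ← ENNReal.ofReal_mul (by positivity), ENNReal.ofReal_le_ofReal_iff (by positivity)] at h1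
  rw [← ENNReal.ofReal_coe_nnreal]
  refine ENNReal.ofReal_le_ofReal ?_
  have hB := one_add_mul_le_pow (a := (1 / 2600 : ℝ)) (by norm_num) j
  have hjR : (300000 : ℝ) ≤ j := by exact_mod_cast hj
  have h2 : ((1 : ℝ) + 0.04 * 0.49) ^ 2 * (1 + 1 / 2600) ≤ 1.04 := by norm_num
  have h3 : (((1 : ℝ) + 0.04 * 0.49) ^ 2) ^ j * (1 + 1 / 2600) ^ j ≤ 1.04 ^ j := by
    rw [← mul_pow]
    exact pow_le_pow_left₀ (by norm_num) h2 j
  have h4 : (0 : ℝ) < (((1 : ℝ) + 0.04 * 0.49) ^ 2) ^ j := by positivity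
  have h5 : (w : ℝ) * (1 + 1 / 2600) ^ j ≤ 1 := by
    have h6 : (w : ℝ) * ((((1 : ℝ) + 0.04 * 0.49) ^ 2) ^ j * (1 + 1 / 2600) ^ j)
        ≤ (((1 : ℝ) + 0.04 * 0.49) ^ 2) ^ j := by
      calc _ ≤ (w : ℝ) * 1.04 ^ j := by gcongr
        _ ≤ _ := by
          rw [pow_succ, pow_succ, pow_mul, ← mul_assoc] at h1
          nlinarith
    have : (((1 : ℝ) + 0.04 * 0.49) ^ 2) ^ j * ((w : ℝ) * (1 + 1 / 2600) ^ j)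
        ≤ (((1 : ℝ) + 0.04 * 0.49) ^ 2) ^ j * 1 := by linarith
    exact le_of_mul_le_mul_left this h4
  have h7 : (w : ℝ) * 100 ≤ w * (1 + 1 / 2600) ^ j := by
    gcongr
    refine le_trans ?_ hB
    linarith
  linarith

/-- The majority vote errs with small probability. -/
theorem lintegral_majorityTest_le {T : Bool → (Fin n → E d) → ℝ≥0∞}
    (hΛ : 6 ≤ Λ) (hC5 : Λ ^ 5 ≤ C) (hC : (C : ℝ) ≤ Λ ^ 6) (hε : ε * n = m) (hd : 0 < d)
    (hmn : 2 * m < n) (hharm : ∀ k ≤ n, (harmonic k : ℝ) ≤ Λ)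
    (hn : (n : ℝ) + 1 ≤ Real.exp (Λ / 2)) (hW : 1000 ≤ W)
    (hT : ∀ b, Measurable (T b)) (hT1 : ∀ x, T true x + T false x = 1) {r : ℝ≥0∞}
    (hr : r ≤ ENNReal.ofReal (1 / 3)) (b : Bool) (μ : E d)
    (hb : b = false → μ = 0) (hgood : IsGoodTest T Λ ε m r b μ)
    (hN : (N : ℝ) ≤ Real.exp (Λ ^ 2)) (e : κ × Batch n W ↪ Fin N) {k : ℕ}
    (hk : 200 * (n * k) + 101 * (m * (Fintype.card κ * (2 * n + W))) ≤ 101 * (m * N))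
    (hlt : Fintype.card κ * (2 * n + W) < N)
    (hκ : Fintype.card κ = 2 * j + 1) (hj : 300000 ≤ j) (y : Fin N → E d) :
    ∫⁻ x, majorityTest T Λ e (!b) x ∂(contaminatedLaw N k (gaussian d μ) y)
      ≤ ENNReal.ofReal 0.01 := by
  classical
  obtain ⟨δ, hδ⟩ : ∃ δ, δ = ENNReal.ofReal 0.04 := ⟨_, rfl⟩
  have hP : ∀ S : Finset κ, Measurable fun x : Fin N → E d =>
      ∏ l ∈ S, batchTest T Λ (!b) fun p => x (e (l, p)) := fun S =>
    Finset.measurable_fun_prod _ fun l _ => (measurable_batchTest hT _).comp (by fun_prop)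
  have hm := measurable_majorityTest (Λ := Λ) hT e (!b)
  have h1 : (∫⁻ x, majorityTest T Λ e (!b) x ∂(contaminatedLaw N k (gaussian d μ) y))
      * (1 + δ) ^ (j + 1) ≤ (1 + δ * ENNReal.ofReal 0.49) ^ Fintype.card κ := by
    rw [← lintegral_mul_const _ hm]
    calc _ ≤ ∫⁻ x, ∑ S : Finset κ, δ ^ S.card * ∏ l ∈ S, batchTest T Λ (!b) (fun p => x (e (l, p)))
          ∂(contaminatedLaw N k (gaussian d μ) y) :=
          lintegral_mono fun x => majorityProb_mul_pow_le
            (g := fun l c => batchTest T Λ c fun p => x (e (l, p)))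
            (fun _ => batchTest_add hT hT1 _) (!b) hκ δ
      _ = ∑ S : Finset κ, δ ^ S.card * ∫⁻ x, ∏ l ∈ S, batchTest T Λ (!b) (fun p => x (e (l, p)))
          ∂(contaminatedLaw N k (gaussian d μ) y) := by
          rw [lintegral_finsetSum _ fun S _ => (hP S).const_mul _]
          refine Finset.sum_congr rfl fun S _ => ?_
          rw [lintegral_const_mul _ (hP S)]
      _ ≤ ∑ S : Finset κ, δ ^ S.card * ENNReal.ofReal 0.49 ^ S.card := by
          refine Finset.sum_le_sum fun S _ => mul_le_mul_right ?_ _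
          rw [lintegral_contaminatedLaw _ _ _ (hP S)]
          refine (mul_le_mul_right (sum_perm_prod_batchTest_le hΛ hC5 hC hε hd hmn hharm hn hW hT hT1
            hr b μ hb hgood hN e hk hlt y S) _).trans (le_of_eq ?_)
          rw [← mul_assoc, factorial_inv_mul_cancel, one_mul]
      _ = _ := by
          have h := Finset.prod_add (fun _ : κ => δ * ENNReal.ofReal 0.49) (fun _ => 1) Finset.univ
          simp only [Finset.prod_const, one_pow, mul_one, Finset.powerset_univ, Finset.card_univ,
            mul_pow] at h
          rw [add_comm, h]
  have hle1 : ∫⁻ x, majorityTest T Λ e (!b) x ∂(contaminatedLaw N k (gaussian d μ) y) ≤ 1 := by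
    refine (lintegral_mono (g := fun _ => 1) fun x => ?_).trans (by simp)
    have h := majorityTest_add (Λ := Λ) hT hT1 ⟨j, hκ⟩ e x
    cases b
    · exact h ▸ le_self_add
    · exact h ▸ le_add_self
  obtain ⟨w, hw⟩ : ∃ w, w = ∫⁻ x, majorityTest T Λ e (!b) x ∂(contaminatedLaw N k (gaussian d μ) y) :=
    ⟨_, rfl⟩
  rw [← hw] at h1 hle1 ⊢
  rw [hκ, hδ] at h1
  exact le_of_mul_pow_le hj hle1 h1

end

/-! ### The breakdown point: fewer than half of the points may be bad. -/

section

variable {d n m : ℕ} {Λ ε : ℝ}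

/-- Planting independent Gaussian points with means `c i` at `J` makes the whole dataset Gaussian
with means `c`. The same law thus arises from different choices of which points are called bad. -/
lemma lintegral_mixPts_random (J : Finset (Fin n)) (c : Fin n → E d) (μ : E d)
    (hc : ∀ i ∉ J, c i = μ) {F : (Fin n → E d) → ℝ≥0∞} (hF : Measurable F) :
    ∫⁻ z', ∫⁻ z, F (mixPts J (fun i => c i + z' i) (fun _ => μ) z)
        ∂(Measure.pi fun _ : Fin n => stdGaussian (E d))
        ∂(Measure.pi fun _ : Fin n => stdGaussian (E d))
      = ∫⁻ z, F (mixPts ∅ 0 c z) ∂(Measure.pi fun _ : Fin n => stdGaussian (E d)) := by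
  have hmix := measurePreserving_mix (ι := Fin n) (stdGaussian (E d)) (fun i => i ∉ J)
  have hG : Measurable fun z : Fin n → E d => F (mixPts ∅ 0 c z) := hF.comp (measurable_mixPts _ _ _)
  have hG' : Measurable fun a : (Fin n → E d) × (Fin n → E d) =>
      F (mixPts ∅ 0 c fun i => if i ∉ J then a.1 i else a.2 i) := hG.comp hmix.measurable
  rw [← hmix.lintegral_comp hG, lintegral_prod_symm _ hG'.aemeasurable]
  refine lintegral_congr fun z' => lintegral_congr fun z => ?_
  congr 1
  funext i
  by_cases hi : i ∈ J <;> simp [mixPts, hi]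
  rw [hc i hi]

lemma measure_not_isFriendly_mixPts (κ ε : ℝ) (J : Finset (Fin n)) (y c : Fin n → E d) :
    (Measure.pi fun _ : Fin n => stdGaussian (E d)) {z | ¬ IsFriendly κ ε (mixPts J y c z)}
      = ∫⁻ z, ({x | ¬ IsFriendly κ ε x}.indicator 1 (mixPts J y c z) : ℝ≥0∞)
        ∂(Measure.pi fun _ : Fin n => stdGaussian (E d)) := by
  have hS : MeasurableSet {z | ¬ IsFriendly κ ε (mixPts J y c z)} :=
    measurable_mixPts J y c measurableSet_isFriendly.compl
  rw [← lintegral_indicator_one hS]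
  rfl

/-- Robust testing is impossible if half of the points may be bad. -/
lemma two_mul_lt_of_isGoodTest {T : Bool → (Fin n → E d) → ℝ≥0∞}
    (hΛ : 6 ≤ Λ) (hε : ε * n = m) (hd : 0 < d) (hn0 : 0 < n)
    (hn : (n : ℝ) + 1 ≤ Real.exp (Λ / 2)) (hmn : m ≤ n)
    (hT : ∀ b, Measurable (T b)) (hT1 : ∀ x, T true x + T false x = 1) {r : ℝ≥0∞}
    (hr : r ≤ ENNReal.ofReal (1 / 3)) {μ : E d} (hμ : ‖μ‖ ≤ 1)
    (hnull : IsGoodTest T Λ ε m r false 0) (halt : IsGoodTest T Λ ε m r true μ) : 2 * m < n := by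
  classical
  by_contra hlt
  set γ := Measure.pi fun _ : Fin n => stdGaussian (E d) with hγ
  set J := Finset.univ.filter fun i : Fin n => (i : ℕ) < n - m with hJ
  have hJc : J.card = n - m := by
    rw [hJ, Fin.card_filter_val_lt]
    omega
  -- If `n ≤ 2 m`, one law serves as contaminated data for both hypotheses: the first `n - m ≤ m`
  -- points are centred and the other `m` have mean `μ`. The data are friendly since `‖μ‖ ≤ 1`, so
  -- the test would have to accept and to reject with probability near `2/3`.
  set c : Fin n → E d := fun i => if i ∈ J then 0 else μ with hc
  have hmeas : MeasurableSet {x : Fin n → E d | ¬ IsFriendly (Λ ^ 2000) ε x} :=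
    measurableSet_isFriendly.compl
  have h1 : ∫⁻ z, T false (mixPts ∅ 0 c z) ∂γ ≤ r := by
    rw [← lintegral_mixPts_random J c μ (fun i hi => by simp [hc, hi]) (hT false)]
    refine (lintegral_mono (g := fun _ => r) fun z' => ?_).trans (by simp)
    simpa using halt J (fun i => c i + z' i) (by omega)
  have h2 : ∫⁻ z, T true (mixPts ∅ 0 c z) ∂γ
      ≤ r + γ {z | ¬ IsFriendly (Λ ^ 2000) ε (mixPts ∅ 0 c z)} := by
    have hcJ : ∀ i ∉ Jᶜ, c i = 0 := fun i hi => by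
      simp only [Finset.mem_compl, not_not] at hi
      simp [hc, hi]
    rw [measure_not_isFriendly_mixPts, ← lintegral_mixPts_random Jᶜ c 0 hcJ (hT true),
      ← lintegral_mixPts_random Jᶜ c 0 hcJ (measurable_one.indicator hmeas)]
    calc _ ≤ ∫⁻ z', (r + ∫⁻ z, ({x | ¬ IsFriendly (Λ ^ 2000) ε x}.indicator 1
          (mixPts Jᶜ (fun i => c i + z' i) (fun _ => 0) z) : ℝ≥0∞) ∂γ) ∂γ := by
          refine lintegral_mono fun z' => ?_
          have h := hnull Jᶜ (fun i => c i + z' i) (by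
            rw [Finset.card_compl, Fintype.card_fin, hJc]; omega)
          simp only [Bool.not_false, Bool.false_eq_true, if_false] at h
          rwa [measure_not_isFriendly_mixPts] at h
      _ = _ := by
          rw [lintegral_add_left measurable_const]
          simp [hγ]
  have h3 : γ {z | ¬ IsFriendly (Λ ^ 2000) ε (mixPts ∅ 0 c z)}
      ≤ ENNReal.ofReal (9 * Real.exp (-2 * Λ)) := by
    refine measure_not_isFriendly_le hΛ hε hd hn ∅ 0 c (fun i => ?_) ?_ ?_ ?_
    · simp only [hc]
      split_ifs
      · simp
      · exact hμ
    · simp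
    · simp
    · intro S T hS hT _ _ _
      rw [Finset.subset_empty.mp hS, Finset.subset_empty.mp hT]
      simp
  have h4 : (1 : ℝ≥0∞) ≤ ENNReal.ofReal (1 / 3 + (1 / 3 + 9 * Real.exp (-2 * Λ))) := by
    have e1 : ∫⁻ z, (T true (mixPts ∅ 0 c z) + T false (mixPts ∅ 0 c z)) ∂γ = 1 := by
      simp [hT1]
    have hm : Measurable fun z => T true (mixPts ∅ 0 c z) := (hT true).comp (measurable_mixPts _ _ _)
    rw [lintegral_add_left hm] at e1
    rw [ENNReal.ofReal_add (by positivity) (by positivity),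
      ENNReal.ofReal_add (by positivity) (by positivity), ← e1, add_comm]
    exact add_le_add (h1.trans hr) (h2.trans (add_le_add hr h3))
  have h5 : Real.exp (-2 * Λ) ≤ 1 / 100 := by
    have : Real.exp (-2 * Λ) ≤ Real.exp (-5) := Real.exp_le_exp.mpr (by linarith)
    have h6 : Real.exp (-5) * Real.exp 5 = 1 := by rw [← Real.exp_add]; simp
    have h7 : (100 : ℝ) ≤ Real.exp 5 := by
      have := Real.exp_one_gt_d9
      calc (100 : ℝ) ≤ 2.7 ^ 5 := by norm_num
        _ ≤ Real.exp 1 ^ 5 := by gcongr; linarith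
        _ = Real.exp 5 := by rw [← Real.exp_nat_mul]; norm_num
    nlinarith [Real.exp_pos (-5)]
  rw [← ENNReal.ofReal_one, ENNReal.ofReal_le_ofReal_iff (by positivity)] at h4
  linarith

end

/-! ### Assembly of the tester. -/

section

variable {d n : ℕ} {κ α ε p : ℝ}

lemma exists_kernel_apply_singleton {Ω : Type*} [MeasurableSpace Ω] {T : Bool → Ω → ℝ≥0∞}
    (hT : ∀ b, Measurable (T b)) (hT1 : ∀ x, T true x + T false x = 1) :
    ∃ A : Kernel Ω Bool, IsMarkovKernel A ∧ ∀ x b, A x {b} = T b x := by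
  refine ⟨⟨fun x => T true x • Measure.dirac true + T false x • Measure.dirac false, ?_⟩,
    ⟨fun x => ⟨?_⟩⟩, fun x b => ?_⟩
  · refine Measure.measurable_of_measurable_coe _ fun s _ => ?_
    simp only [Measure.add_apply, Measure.smul_apply, smul_eq_mul]
    exact ((hT true).mul_const _).add ((hT false).mul_const _)
  · simp [hT1]
  · cases b <;> simp

lemma isFriendly_of_isEmpty (x : Fin 0 → E d) : IsFriendly κ ε x := by
  refine ⟨fun S T _ _ _ => ?_, fun i => i.elim0, fun i => i.elim0⟩
  rw [Subsingleton.elim S ∅]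
  simp

lemma FriendlyTesterExists.of_zero (h : FriendlyTesterExists d 0 κ α ε p) :
    ObliviousTesterExists d 0 α (ε / 2) (p - 0.01) := by
  obtain ⟨A, hA, h0, h1⟩ := h
  simp only [isFriendly_of_isEmpty, true_imp_iff, Nat.cast_zero, mul_zero, Nat.floor_zero] at h0 h1
  refine ⟨A, hA, ?_⟩
  simp only [IsTesterUnder, true_imp_iff, Nat.cast_zero, mul_zero, Nat.floor_zero]
  exact ⟨fun y => (by linarith : p - 0.01 ≤ p).trans (h0 y),
    fun μ hμ y => (by linarith : p - 0.01 ≤ p).trans (h1 μ hμ y)⟩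

theorem FriendlyTesterExists.oblivious {L j : ℕ} (hj : 300000 ≤ j)
    (hL : L = 102 * 1002 * (2 * j + 1)) (hL' : (L : ℝ) ≤ Real.exp 30) (hd : 2 ≤ d)
    (hn : 0 < n) (hα0 : 0 < α) (hα : α ≤ 1) (hε1 : ε ≤ 1) {m : ℕ} (hm : ε * n = m)
    (hp : 2 / 3 < p) (h : FriendlyTesterExists d n ((10 * Real.log (n * d)) ^ 2000) α ε p) :
    ObliviousTesterExists d (n * L) α (ε / 2) (p - 0.01) := by
  obtain ⟨A, hA, h0, h1⟩ := h
  set Λ := 10 * Real.log (n * d) with hΛdef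
  have hnR : (1 : ℝ) ≤ n := by exact_mod_cast hn
  have hdR : (2 : ℝ) ≤ d := by exact_mod_cast hd
  have hnd : 2 * (n : ℝ) ≤ n * d := by nlinarith
  have hexp : Real.exp (Λ / 10) = n * d := by
    rw [hΛdef, mul_div_cancel_left₀ _ (by norm_num), Real.exp_log (by linarith)]
  have hΛ : 6 ≤ Λ := by
    have h2 : Real.log 2 ≤ Real.log (n * d) := Real.log_le_log (by norm_num) (by linarith)
    have := Real.log_two_gt_d9
    linarith
  have hn' : (n : ℝ) + 1 ≤ Real.exp (Λ / 2) := by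
    calc (n : ℝ) + 1 ≤ n * d := by linarith
      _ = Real.exp (Λ / 10) := hexp.symm
      _ ≤ _ := Real.exp_le_exp.mpr (by linarith)
  have hlog : Real.log n ≤ Λ / 10 := by
    rw [hΛdef, mul_div_cancel_left₀ _ (by norm_num)]
    exact Real.log_le_log (by linarith) (by nlinarith)
  have hharm : ∀ k ≤ n, (harmonic k : ℝ) ≤ Λ := by
    intro k hk
    refine (harmonic_le_one_add_log k).trans ?_
    rcases Nat.eq_zero_or_pos k with rfl | hk0
    · simp; linarith
    · have : Real.log k ≤ Real.log n :=
        Real.log_le_log (by exact_mod_cast hk0) (by exact_mod_cast hk)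
      linarith
  have hC5 : Λ ^ 5 ≤ ⌈Λ ^ 5⌉₊ := Nat.le_ceil _
  have hC : (⌈Λ ^ 5⌉₊ : ℝ) ≤ Λ ^ 6 := by
    have h1 := (Nat.ceil_lt_add_one (by positivity : (0 : ℝ) ≤ Λ ^ 5)).le
    have h2 : (1 : ℝ) ≤ Λ ^ 5 := one_le_pow₀ (by linarith)
    nlinarith [pow_succ Λ 5]
  have hfloor : ⌊ε * n⌋₊ = m := by rw [hm, Nat.floor_natCast]
  have hmn : m ≤ n := by
    have : (m : ℝ) ≤ n := by rw [← hm]; nlinarith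
    exact_mod_cast this
  have hp1 : p ≤ 1 := (h0 0).trans measureReal_le_one
  have hr : ENNReal.ofReal (1 - p) ≤ ENNReal.ofReal (1 / 3) :=
    ENNReal.ofReal_le_ofReal (by linarith)
  set T := symmTest A (Λ ^ 2000) ε with hT
  have hTm : ∀ b, Measurable (T b) := measurable_symmTest A
  have hT1 : ∀ x, T true x + T false x = 1 := symmTest_add A
  have hnull : IsGoodTest T Λ ε m (ENNReal.ofReal (1 - p)) false 0 := isGoodTest_symmTest hfloor hmn h0
  have halt : ∀ μ : E d, α ≤ ‖μ‖ → IsGoodTest T Λ ε m (ENNReal.ofReal (1 - p)) true μ :=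
    fun μ hμ => isGoodTest_symmTest hfloor hmn (h1 μ hμ)
  -- A vector of norm exactly `α ≤ 1` is an admissible alternative that is small enough for the
  -- breakdown argument.
  have hmn2 : 2 * m < n := by
    have hnorm : ‖(EuclideanSpace.single ⟨0, by omega⟩ α : E d)‖ = α := by
      rw [PiLp.norm_single, Real.norm_eq_abs, abs_of_pos hα0]
    exact two_mul_lt_of_isGoodTest hΛ hm (by omega) hn hn' hmn hTm hT1 hr (hnorm.trans_le hα) hnull
      (halt _ hnorm.ge)
  have hcard : Fintype.card (Fin (2 * j + 1) × Batch n (1000 * n))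
      = (2 * j + 1) * (2 * n + 1000 * n) := by
    simp only [Fintype.card_prod, Fintype.card_sum, Fintype.card_fin]
    ring
  obtain ⟨e⟩ : Nonempty (Fin (2 * j + 1) × Batch n (1000 * n) ↪ Fin (n * L)) := by
    refine Function.Embedding.nonempty_of_card_le ?_
    rw [hcard, Fintype.card_fin, hL]
    calc _ = 1002 * (n * (2 * j + 1)) := by ring
      _ ≤ 1002 * 102 * (n * (2 * j + 1)) := by gcongr; norm_num
      _ = _ := by ring
  have hN : ((n * L : ℕ) : ℝ) ≤ Real.exp (Λ ^ 2) := by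
    calc ((n * L : ℕ) : ℝ) = n * L := by push_cast; ring
      _ ≤ Real.exp (Λ / 2) * Real.exp 30 := by
        gcongr
        linarith
      _ = Real.exp (Λ / 2 + 30) := (Real.exp_add _ _).symm
      _ ≤ _ := Real.exp_le_exp.mpr (by nlinarith)
  have hk : ⌊ε / 2 * (n * L : ℕ)⌋₊ = m * (51 * 1002 * (2 * j + 1)) := by
    have : ε / 2 * (n * L : ℕ) = ((m * (51 * 1002 * (2 * j + 1)) : ℕ) : ℝ) := by
      push_cast
      rw [← hm, hL]
      push_cast
      ring
    rw [this, Nat.floor_natCast]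
  have hmaj : ∀ b μ, (b = false → μ = 0) → IsGoodTest T Λ ε m (ENNReal.ofReal (1 - p)) b μ →
      ∀ y, ∫⁻ x, majorityTest T Λ e (!b) x
        ∂(contaminatedLaw (n * L) ⌊ε / 2 * (n * L : ℕ)⌋₊ (gaussian d μ) y) ≤ ENNReal.ofReal 0.01 := by
    intro b μ hb hgood y
    refine lintegral_majorityTest_le hΛ hC5 hC hm (by omega) hmn2 hharm hn' (by omega)
      hTm hT1 hr b μ hb hgood hN e ?_ ?_ ?_ hj y
    -- The batches use only one part in `102` of the sample, so setting other batches aside raises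
    -- the bad fraction at most by the factor `102/101`. In numbers, `200 * 51 + 101 = 10301 ≤ 10302
    -- = 101 * 102`.
    · rw [hk, Fintype.card_fin, hL]
      calc _ = 1002 * 10301 * (m * n * (2 * j + 1)) := by ring
        _ ≤ 1002 * 10302 * (m * n * (2 * j + 1)) := by gcongr; norm_num
        _ = _ := by ring
    · rw [Fintype.card_fin, hL]
      calc _ = 1002 * (n * (2 * j + 1)) := by ring
        _ < 1002 * 102 * (n * (2 * j + 1)) := by gcongr; norm_num
        _ = _ := by ring
    · rw [Fintype.card_fin]
  obtain ⟨B, hB, hBT⟩ := exists_kernel_apply_singleton (measurable_majorityTest (Λ := Λ) hTm e)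
    (majorityTest_add hTm hT1 (by rw [Fintype.card_fin]; exact ⟨j, rfl⟩) e)
  have hfin : ∀ b μ, (b = false → μ = 0) → IsGoodTest T Λ ε m (ENNReal.ofReal (1 - p)) b μ →
      ∀ y, p - 0.01 ≤ (contaminatedLaw (n * L) ⌊ε / 2 * (n * L : ℕ)⌋₊ (gaussian d μ) y ⊗ₘ B).real
        {xb | True → xb.2 = b} := by
    intro b μ hb hgood y
    rw [le_compProd_real_iff (P := fun _ => True) _ B (by simp) b]
    -- The majority errs with probability at most `0.01` whatever `p` is, and `p ≤ 1` makes this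
    -- enough for success probability `p - 0.01`.
    refine ⟨?_, by linarith⟩
    simp only [if_true, hBT]
    exact (hmaj b μ hb hgood y).trans (ENNReal.ofReal_le_ofReal (by linarith))
  exact ⟨B, hB, hfin false 0 (fun _ => rfl) hnull,
    fun μ hμ => hfin true μ (fun h => by simp at h) (halt μ hμ)⟩

end

end RobustMeanTesting

theorem mainTheorem7 :
    ∃ (C : ℕ) (L : ℕ → ℕ),
      (∀ x : ℕ, 1 ≤ x → (L x : ℝ) ≤ C * (1 + Real.log x) ^ C) ∧
      ∀ (d n : ℕ) (α ε p : ℝ), 2 ≤ d → 0 < α → α ≤ 1 → 0 ≤ ε → ε ≤ 1 →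
        (∃ k : ℕ, ε * n = k) → (n : ℝ) ≤ (1.1 : ℝ) ^ d → 2 / 3 < p →
        RobustMeanTesting.FriendlyTesterExists d n ((10 * Real.log (n * d)) ^ 2000) α ε p →
        RobustMeanTesting.ObliviousTesterExists d (n * L (n * d)) α (ε / 2) (p - 0.01) := by
  obtain ⟨j, hj⟩ : ∃ j, j = 300000 := ⟨_, rfl⟩
  obtain ⟨L, hL⟩ : ∃ L, L = 102 * 1002 * (2 * j + 1) := ⟨_, rfl⟩
  have hL' : (L : ℝ) ≤ Real.exp 30 := by
    have := Real.exp_one_gt_d9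
    calc (L : ℝ) ≤ 2.7 ^ 30 := by rw [hL, hj]; norm_num
      _ ≤ Real.exp 1 ^ 30 := by gcongr; linarith
      _ = Real.exp 30 := by rw [← Real.exp_nat_mul]; norm_num
  -- The factor is a constant `L`, which also serves as `C` because `1 + log x ≥ 1`.
  refine ⟨L, fun _ => L, fun x hx => ?_, ?_⟩
  · have h : (1 : ℝ) ≤ (1 + Real.log x) ^ L :=
      one_le_pow₀ (by linarith [Real.log_nonneg (by exact_mod_cast hx : (1 : ℝ) ≤ x)])
    exact le_mul_of_one_le_right (Nat.cast_nonneg _) h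
  · intro d n α ε p hd hα0 hα _ hε1 hε _ hp h
    obtain ⟨m, hm⟩ := hε
    rcases Nat.eq_zero_or_pos n with rfl | hn
    · rw [Nat.zero_mul]
      exact h.of_zero
    · exact h.oblivious hj.ge hL hL' hd hn hα0 hα hε1 hm hp
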